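/- **Setting.** Let $d\ge 3$ be an integer, let $a$ satisfy $$\frac{4}{(4d-3)(d-2)}<a<\frac1{(d-1)(d-2)},\qquad a_1:=\frac a2+\frac1{2(d-1)(d-2)},$$ and let $$\frac{(d-1)a_1}{2}+\frac1{2(d-2)}<\mu<\frac1{d-2},\qquad \gamma:=\frac{\mu+1-(d-1)a}{\mu+a}.$$ Write $\Pi_+=\{(r,z):r>0,z>0\}$, $\langle r,z\rangle=(1+r^2+z^2)^{1/2}$, $\langle z\rangle=(1+z^2)^{1/2}$, and $\delta_d=0$ for odd $d$, $\delta_d=1$ for even $d$. For $M>1$ let $\mathcal A_M$ be the set of $\psi\in C(\overline{\Pi_+})\cap C^2(\Pi_+)$ such that $\psi(0,0)=a$; $0<\psi\le a_1$ and $M^{-1}\langle r,z\rangle^{d-2-1/\mu}\le\psi\le M\langle r,z\rangle^{d-2-1/\mu}$ on $\overline{\Pi_+}$; and, on $\Pi_+$, $$|\nabla\psi|\le\tfrac1{10}\langle r,z\rangle^{-1+\frac1{d\mu}}\langle z\rangle^{-\frac1{d\mu}}\psi,\qquad |\langle r,z\rangle\partial_r\psi|\le\tfrac1{10}\psi,$$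 $$|\nabla^2\psi|\le\tfrac1{10}\Big(\langle r,z\rangle^{2-d+\frac1\mu}r^{d-3-\frac{d-1}{d\mu}}\langle z\rangle^{-1-\frac1{d\mu}}+r^{d-3-\gamma}\mathbf 1_{r^2+z^2\le1}\Big)\psi .$$ Fix $\lambda>1$; a function $\Theta\in C^\infty((0,\infty);(0,1])$ with $\Theta(s)\to0$ as $s\to0^+$, $\Theta=1$ on $[1,\infty)$ and $\Theta(s)=s^{\delta_d+(d-1)/(d\mu)}$ on $(0,\frac1{10}]$; and a function $\eta\in C^\infty((0,\frac\pi2);[0,1])$ with $\eta=1$ on $(0,\arctan(2d)]$ and $\eta=0$ on $[\arccos\frac1{3d},\frac\pi2)$. Put $\chi(\sigma)=\eta(\sigma)+(1-\eta(\sigma))(\cos\sigma)^{1+1/(d\mu)}$. *Transport map.* For $\psi\in\mathcal A_M$, $\Omega=\mathcal F(\psi)\in C^1(\Pi_+)$ denotes the solution in $\Pi_+$ of $$(\mu+\psi+z\partial_z\psi)\,r\partial_r\Omega+(\mu-(d-1)\psi-r\partial_r\psi)\,z\partial_z\Omega=-\Omega$$ such that, for every $\sigma\in(0,\frac\pi2)$,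 at the point $(\sin\sigma,z)$ of the curve $\{r^2+(\mu+\psi(r,z))^2z^2=1,\ r,z>0\}$ one has $$\Omega(\sin\sigma,z)=\Theta(\lambda\sigma)(\sin\sigma)^{-\frac{d-1}{d\mu}}(\cos\sigma)^{-\frac1{d\mu}}\chi(\sigma).$$ *Elliptic map.* $\psi=\mathcal G(\Omega)\in C^1(\overline{\Pi_+})\cap C^2(\Pi_+)$ denotes the solution of $$\Big(\partial_r^2+\frac dr\partial_r+\partial_z^2+\frac2z\partial_z\Big)\psi=-\frac{a}{\mathfrak M(\Omega)}\,r^{d-3}\,\frac{\Omega}{z}\quad\text{in }\Pi_+,\qquad \psi\to0\ \text{ as } r+z\to\infty,$$ where $$\mathfrak M(\Omega)=\frac{1}{(d+4)(d+2)|B_1|}\int_{\mathbb R^{d+1}\times\mathbb R^3}|(\xi,\eta)|^{-d-2}\,|\xi|^{d-3}|\eta|^{-1}\,\Omega(|\xi|,|\eta|)\,d\xi\,d\eta$$ and $B_1$ is the unit ball of $\mathbb R^{d+4}$. **Proposition.** Let $\psi_*\in\mathcal A_M$ be a fixed point of $\mathcal G\circ\mathcal F$, let $\Omega_*=\mathcal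 F(\psi_*)$, and extend $\Omega_*$ to $\{r>0,\ z\in\mathbb R\}$ by $\Omega_*(r,-z)=-\Omega_*(r,z)$, so that $\Omega_*(r,0)=0$. Put $\alpha_*:=d-2-\frac1{\mu+a}$. Then $\alpha_*\in(0,1)$. Moreover, the function $r^{d-2}\Omega_*$, defined to be $0$ at $r=0$, satisfies $$r^{d-2}\Omega_*\in C^{\alpha_*}(\{(r,z):r\ge0,\ z\in\mathbb R\}).$$ For $x\in\mathbb R^d$ let $r=(x_1^2+\dots+x_{d-1}^2)^{1/2}$ and $z=x_d$. For every $1\le i\le d-1$, the function $x\mapsto x_ir^{d-3}\Omega_*(r,z)$, defined to be $0$ on the axis $\{r=0\}$, belongs to $C^{\alpha_*}(\mathbb R^d)$, and $$\|r^{d-2}\Omega_*\|_{C^{\alpha_*}(\{r\ge0\})}+\|x_ir^{d-3}\Omega_*\|_{C^{\alpha_*}(\mathbb R^d)}<\infty .$$ Here $\|f\|_{C^{\alpha}}=\sup|f|+\sup_{x\ne y}|f(x)-f(y)|/|x-y|^{\alpha}$. -/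

import Mathlib

open Set Filter MeasureTheory
open scoped Topology NNReal ENNReal

noncomputable section

namespace EulerProfile

/-! ### Parameters -/

/-- The auxiliary parameter `a₁`. -/
def a1 (d : ℕ) (a : ℝ) : ℝ := a / 2 + 1 / (2 * ((d : ℝ) - 1) * ((d : ℝ) - 2))

/-- The admissible range of `a`. -/
def ARange (d : ℕ) (a : ℝ) : Prop :=
  4 / ((4 * (d : ℝ) - 3) * ((d : ℝ) - 2)) < a ∧ a < 1 / (((d : ℝ) - 1) * ((d : ℝ) - 2))

/-- The admissible range of `μ`. -/
def MuRange (d : ℕ) (a μ : ℝ) : Prop :=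
  ((d : ℝ) - 1) * a1 d a / 2 + 1 / (2 * ((d : ℝ) - 2)) < μ ∧ μ < 1 / ((d : ℝ) - 2)

/-- The exponent `γ`. -/
def gam (d : ℕ) (a μ : ℝ) : ℝ := (μ + 1 - ((d : ℝ) - 1) * a) / (μ + a)

/-- `δ_d = 0` for odd `d` and `δ_d = 1` for even `d`. -/
def delta (d : ℕ) : ℝ := if Even d then 1 else 0

/-- The Hölder exponent `α_* = d - 2 - 1 / (μ + a)`. -/
def alphaStar (d : ℕ) (a μ : ℝ) : ℝ := (d : ℝ) - 2 - 1 / (μ + a)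

/-! ### The quarter plane and partial derivatives.
Points of the meridian plane are pairs `(r, z)`. -/

/-- The open quadrant. -/
def quadrant : Set (ℝ × ℝ) := {p | 0 < p.1 ∧ 0 < p.2}

/-- The closed quadrant. -/
def closedQuadrant : Set (ℝ × ℝ) := {p | 0 ≤ p.1 ∧ 0 ≤ p.2}

/-- `∂_r f`. -/
def pr (f : ℝ × ℝ → ℝ) (p : ℝ × ℝ) : ℝ := deriv (fun s => f (s, p.2)) p.1

/-- `∂_z f`. -/
def pz (f : ℝ × ℝ → ℝ) (p : ℝ × ℝ) : ℝ := deriv (fun s => f (p.1, s)) p.2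

/-- The Euclidean length `|∇_{r,z} f|`. -/
def gradNorm (f : ℝ × ℝ → ℝ) (p : ℝ × ℝ) : ℝ := √((pr f p) ^ 2 + (pz f p) ^ 2)

/-- The Euclidean length `|∇²_{r,z} f|` of the Hessian matrix. -/
def hessNorm (f : ℝ × ℝ → ℝ) (p : ℝ × ℝ) : ℝ :=
  √((pr (pr f) p) ^ 2 + (pr (pz f) p) ^ 2 + (pz (pr f) p) ^ 2 + (pz (pz f) p) ^ 2)

/-- The Japanese bracket `⟨r, z⟩`. -/
def jap (p : ℝ × ℝ) : ℝ := √(1 + p.1 ^ 2 + p.2 ^ 2)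

/-- The Japanese bracket `⟨z⟩`. -/
def japz (z : ℝ) : ℝ := √(1 + z ^ 2)

/-! ### The classes of stream functions -/

/-- The class `𝒜⁰`. -/
structure MemA0 (d : ℕ) (a μ : ℝ) (ψ : ℝ × ℝ → ℝ) : Prop where
  continuousOn : ContinuousOn ψ closedQuadrant
  contDiffOn : ContDiffOn ℝ 2 ψ quadrant
  origin : ψ (0, 0) = a
  pos : ∀ p ∈ closedQuadrant, 0 < ψ p
  le_a1 : ∀ p ∈ closedQuadrant, ψ p ≤ a1 d a
  grad_le : ∀ p ∈ quadrant, gradNorm ψ p ≤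
    1 / 10 * jap p ^ (-1 + 1 / ((d : ℝ) * μ)) * japz p.2 ^ (-(1 / ((d : ℝ) * μ))) * ψ p
  pr_le : ∀ p ∈ quadrant, |jap p * pr ψ p| ≤ 1 / 10 * ψ p
  hess_le : ∀ p ∈ quadrant, hessNorm ψ p ≤
    1 / 10 * (jap p ^ (2 - (d : ℝ) + 1 / μ) * p.1 ^ ((d : ℝ) - 3 - ((d : ℝ) - 1) / ((d : ℝ) * μ))
        * japz p.2 ^ (-1 - 1 / ((d : ℝ) * μ))
      + (if p.1 ^ 2 + p.2 ^ 2 ≤ 1 then p.1 ^ ((d : ℝ) - 3 - gam d a μ) else 0)) * ψ p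

/-- The class `𝒜_M`. -/
structure MemA (d : ℕ) (a μ M : ℝ) (ψ : ℝ × ℝ → ℝ) : Prop extends MemA0 d a μ ψ where
  lower : ∀ p ∈ closedQuadrant, M⁻¹ * jap p ^ ((d : ℝ) - 2 - 1 / μ) ≤ ψ p
  upper : ∀ p ∈ closedQuadrant, ψ p ≤ M * jap p ^ ((d : ℝ) - 2 - 1 / μ)

/-! ### The transport equation and its data -/

/-- The cut-off functions `Θ` allowed in the initial data. -/
structure IsTheta (d : ℕ) (μ : ℝ) (Θ : ℝ → ℝ) : Prop where
  smooth : ContDiffOn ℝ (⊤ : ℕ∞) Θ (Ioi 0)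
  mem_Ioc : ∀ s, 0 < s → Θ s ∈ Ioc (0 : ℝ) 1
  tendsto_zero : Tendsto Θ (𝓝[>] 0) (𝓝 0)
  eq_one : ∀ s, 1 ≤ s → Θ s = 1
  eq_rpow : ∀ s ∈ Ioc (0 : ℝ) (1 / 10), Θ s = s ^ (delta d + ((d : ℝ) - 1) / ((d : ℝ) * μ))

/-- The angular cut-off functions `η` allowed in the initial data. -/
structure IsEta (d : ℕ) (η : ℝ → ℝ) : Prop where
  smooth : ContDiffOn ℝ (⊤ : ℕ∞) η (Ioo 0 (Real.pi / 2))
  mem_Icc : ∀ σ ∈ Ioo (0 : ℝ) (Real.pi / 2), η σ ∈ Icc (0 : ℝ) 1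
  eq_one : ∀ σ ∈ Ioc (0 : ℝ) (Real.arctan (2 * d)), η σ = 1
  eq_zero : ∀ σ ∈ Ico (Real.arccos (1 / (3 * d))) (Real.pi / 2), η σ = 0

/-- The angular weight `χ_μ` built from `η`. -/
def chi (d : ℕ) (μ : ℝ) (η : ℝ → ℝ) (σ : ℝ) : ℝ :=
  η σ + (1 - η σ) * Real.cos σ ^ (1 + 1 / ((d : ℝ) * μ))

/-- The initial curve `Γ₀` determined by `ψ`. -/
def Gamma0 (μ : ℝ) (ψ : ℝ × ℝ → ℝ) : Set (ℝ × ℝ) :=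
  {p | p.1 ^ 2 + (μ + ψ p) ^ 2 * p.2 ^ 2 = 1 ∧ 0 < p.1 ∧ 0 < p.2}

/-- `Ω` is the `C¹` solution in the open quadrant of the linear transport equation with coefficient
`ψ`, with the data `Θ(λσ) (sin σ)^{-(d-1)/(dμ)} (cos σ)^{-1/(dμ)} χ(σ)` at the point of `Γ₀` whose
first coordinate is `sin σ`. -/
structure IsTransportImage (d : ℕ) (μ lam : ℝ) (Θ η : ℝ → ℝ) (ψ Ω : ℝ × ℝ → ℝ) : Prop where
  contDiffOn : ContDiffOn ℝ 1 Ω quadrant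
  eqn : ∀ p ∈ quadrant,
    (μ + ψ p + p.2 * pz ψ p) * (p.1 * pr Ω p)
      + (μ - ((d : ℝ) - 1) * ψ p - p.1 * pr ψ p) * (p.2 * pz Ω p) = -Ω p
  data : ∀ σ ∈ Ioo (0 : ℝ) (Real.pi / 2), ∀ z, (Real.sin σ, z) ∈ Gamma0 μ ψ →
    Ω (Real.sin σ, z) = Θ (lam * σ) * Real.sin σ ^ (-(((d : ℝ) - 1) / ((d : ℝ) * μ)))
      * Real.cos σ ^ (-(1 / ((d : ℝ) * μ))) * chi d μ η σ

/-! ### The elliptic equation -/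

/-- `β_d = 1 / ((d+4)(d+2) |B₁|)`, where `B₁` is the unit ball of `ℝ^{d+4}`. -/
def beta (d : ℕ) : ℝ :=
  1 / (((d : ℝ) + 4) * ((d : ℝ) + 2)
    * (volume (Metric.ball (0 : EuclideanSpace ℝ (Fin (d + 4))) 1)).toReal)

/-- The Newtonian potential in `ℝ^{d+1} × ℝ³ = ℝ^{d+4}` of `(ξ, η) ↦ |ξ|^{d-3} |η|⁻¹ Ω(|ξ|, |η|)`,
at the point `(x, y)`. -/
def newtonPotential (d : ℕ) (Ω : ℝ × ℝ → ℝ)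
    (x : EuclideanSpace ℝ (Fin (d + 1))) (y : EuclideanSpace ℝ (Fin 3)) : ℝ :=
  beta d * ∫ Y : EuclideanSpace ℝ (Fin (d + 1)) × EuclideanSpace ℝ (Fin 3),
    (√(‖x - Y.1‖ ^ 2 + ‖y - Y.2‖ ^ 2) ^ (d + 2))⁻¹
      * (‖Y.1‖ ^ (d - 3) * ‖Y.2‖⁻¹ * Ω (‖Y.1‖, ‖Y.2‖))

/-- The normalization `𝔐(Ω)`: the value of the potential at the origin. -/
def mass (d : ℕ) (Ω : ℝ × ℝ → ℝ) : ℝ := newtonPotential d Ω 0 0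

/-- `ψ` is the solution, `C¹` up to the boundary and vanishing at infinity, of the rescaled elliptic
equation with source `Ω`. -/
structure IsEllipticImage (d : ℕ) (a : ℝ) (Ω ψ : ℝ × ℝ → ℝ) : Prop where
  contDiffOn_one : ContDiffOn ℝ 1 ψ closedQuadrant
  contDiffOn_two : ContDiffOn ℝ 2 ψ quadrant
  eqn : ∀ p ∈ quadrant,
    pr (pr ψ) p + (d : ℝ) / p.1 * pr ψ p + pz (pz ψ) p + 2 / p.2 * pz ψ p
      = -(a / mass d Ω) * p.1 ^ (d - 3) * (Ω p / p.2)
  tendsto_zero : Tendsto ψ (comap (fun p : ℝ × ℝ => p.1 + p.2) atTop ⊓ 𝓟 closedQuadrant) (𝓝 0)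

/-- `ψ ∈ 𝒜_M` is a fixed point of the map `ψ ↦ Ω ↦ ψ` (transport map followed by elliptic map), and
`Ω` is the image of `ψ` under the transport map. -/
structure IsFixedPoint (d : ℕ) (a μ M lam : ℝ) (Θ η : ℝ → ℝ) (ψ Ω : ℝ × ℝ → ℝ) : Prop where
  mem : MemA d a μ M ψ
  transport : IsTransportImage d μ lam Θ η ψ Ω
  elliptic : IsEllipticImage d a Ω ψ

/-! ### Extension, vorticity components, Hölder norms -/

/-- The extension of `Ω` from the open quadrant that is odd in `z` (hence zero at `z = 0`). -/
def oddExt (Ω : ℝ × ℝ → ℝ) (r z : ℝ) : ℝ :=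
  if 0 < z then Ω (r, z) else if z < 0 then -Ω (r, -z) else 0

/-- The closed half-plane `{(r, z) : r ≥ 0}` with the Euclidean distance. -/
abbrev HalfPlane : Type := {p : EuclideanSpace ℝ (Fin 2) // 0 ≤ p 0}

/-- `r^{d-2} Ω` on the closed half-plane; it is zero at `r = 0`. -/
def scalarVorticity (d : ℕ) (Ω : ℝ × ℝ → ℝ) (p : HalfPlane) : ℝ :=
  if p.1 0 = 0 then 0 else (p.1 0) ^ (d - 2) * oddExt Ω (p.1 0) (p.1 1)

/-- `r = (x₁² + ⋯ + x_{d-1}²)^{1/2}`. -/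
def radius {d : ℕ} (x : EuclideanSpace ℝ (Fin d)) : ℝ :=
  √(∑ i : Fin d, if (i : ℕ) + 1 < d then x i ^ 2 else 0)

/-- `z = x_d`, the last coordinate. -/
def height {d : ℕ} (hd : 3 ≤ d) (x : EuclideanSpace ℝ (Fin d)) : ℝ := x ⟨d - 1, by omega⟩

/-- The Cartesian component `x_i r^{d-3} Ω(r, z)`, set to zero on the axis `r = 0`. -/
def cartesianVorticity {d : ℕ} (hd : 3 ≤ d) (Ω : ℝ × ℝ → ℝ) (i : Fin d)
    (x : EuclideanSpace ℝ (Fin d)) : ℝ :=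
  if radius x = 0 then 0 else x i * radius x ^ (d - 3) * oddExt Ω (radius x) (height hd x)

/-- The `C^α` norm: supremum norm plus `α`-Hölder seminorm, with value `∞` if infinite. -/
def cHolderNorm {X : Type*} [PseudoEMetricSpace X] (α : ℝ) (f : X → ℝ) : ℝ≥0∞ :=
  (⨆ x, ‖f x‖ₑ) + eHolderNorm α.toNNReal f

/-- `f ∈ C^α` for an exponent `α ∈ (0, 1)`: bounded and `α`-Hölder continuous. -/
def MemCHolder {X : Type*} [PseudoEMetricSpace X] (α : ℝ) (f : X → ℝ) : Prop :=
  (∃ B : ℝ, ∀ x, |f x| ≤ B) ∧ MemHolder α.toNNReal f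

end EulerProfile

end

/-! Put Q = (μ + ψ) z and A = ∂_z Q. Dividing the transport equation by A gives r ∂_r Ω + F ∂_Q Ω =
-Ω / A in the coordinates (r, Q), with F > 0. Both r and Q grow along characteristics, so these
cross the curve r² + Q² = 1 outwards. On that curve Ω = E(r) Q with E and r E' bounded.

The damping rate 1/A decides the growth. Towards the origin ψ tends to a and 1/A to 1/(μ + a), so Ω
is O(r^{-1/(μ+a)}) and its gradient is one power of r worse (`gradient_inner`). Towards infinity ψ
decays and 1/A tends to 1/μ = d - 2 + β with β > 0, so r^{d-2} Ω and r^{d-2} ∇Ω stay bounded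
(`gradient_outer`). The errors are absorbed by exponential weights in `inner_bound` and
`outer_bound`. This works because ψ decays like a negative power of r² + Q², and because near the
axis z ∂_r ∂_z ψ and z ∂_z² ψ are O(r^{-θ}) with θ < 1.

Since Ω is only C¹, the transport equations for its derivatives are not classical. `FlowDeriv` gives
them a meaning through difference quotients, and a maximum principle on compact sets
(`FlowDeriv.le_of_compact`) replaces integration along characteristics.

With α = d - 2 - 1/(μ + a), the outcome (`vorticity_bounds`) is that r^{d-2} Ω is bounded and
O(r^α), with gradient O(1 + r^{α-1}). Such a function is α-Hölder (`holder_of_gradient`). The odd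
extension causes no jump because Ω vanishes linearly at z = 0 (`exists_le_strQ`), and the factor x_i
/ r is harmless because the profile is O(r^α) at the axis (`holder_of_angular_factor`). -/

noncomputable section

namespace EulerProfile

/-! ### Partial derivatives on the open quadrant -/

lemma isOpen_quadrant : IsOpen quadrant :=
  (isOpen_lt continuous_const continuous_fst).inter (isOpen_lt continuous_const continuous_snd)

lemma quadrant_mem_nhds {p : ℝ × ℝ} (hp : p ∈ quadrant) : quadrant ∈ 𝓝 p :=
  isOpen_quadrant.mem_nhds hp

lemma quadrant_subset_closedQuadrant : quadrant ⊆ closedQuadrant := fun _ hp => ⟨hp.1.le, hp.2.le⟩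

section Partial

variable {f : ℝ × ℝ → ℝ} {p : ℝ × ℝ}

lemma hasDerivAt_slice_fst (hf : DifferentiableAt ℝ f p) :
    HasDerivAt (fun s => f (s, p.2)) (fderiv ℝ f p (1, 0)) p.1 := by
  have h1 : HasDerivAt (fun s : ℝ => (s, p.2)) ((1 : ℝ), (0 : ℝ)) p.1 :=
    (hasDerivAt_id p.1).prodMk (hasDerivAt_const _ _)
  exact (show HasFDerivAt f (fderiv ℝ f p) (p.1, p.2) from hf.hasFDerivAt).comp_hasDerivAt p.1 h1

lemma hasDerivAt_slice_snd (hf : DifferentiableAt ℝ f p) :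
    HasDerivAt (fun s => f (p.1, s)) (fderiv ℝ f p (0, 1)) p.2 := by
  have h1 : HasDerivAt (fun s : ℝ => (p.1, s)) ((0 : ℝ), (1 : ℝ)) p.2 :=
    (hasDerivAt_const _ _).prodMk (hasDerivAt_id p.2)
  exact (show HasFDerivAt f (fderiv ℝ f p) (p.1, p.2) from hf.hasFDerivAt).comp_hasDerivAt p.2 h1

lemma pr_eq_fderiv (hf : DifferentiableAt ℝ f p) : pr f p = fderiv ℝ f p (1, 0) :=
  (hasDerivAt_slice_fst hf).deriv

lemma pz_eq_fderiv (hf : DifferentiableAt ℝ f p) : pz f p = fderiv ℝ f p (0, 1) :=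
  (hasDerivAt_slice_snd hf).deriv

lemma hasDerivAt_pr (hf : DifferentiableAt ℝ f p) :
    HasDerivAt (fun s => f (s, p.2)) (pr f p) p.1 := by
  rw [pr_eq_fderiv hf]; exact hasDerivAt_slice_fst hf

lemma hasDerivAt_pz (hf : DifferentiableAt ℝ f p) :
    HasDerivAt (fun s => f (p.1, s)) (pz f p) p.2 := by
  rw [pz_eq_fderiv hf]; exact hasDerivAt_slice_snd hf

lemma fderiv_apply_eq (hf : DifferentiableAt ℝ f p) (v : ℝ × ℝ) :
    fderiv ℝ f p v = v.1 * pr f p + v.2 * pz f p := by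
  rw [pr_eq_fderiv hf, pz_eq_fderiv hf]
  have : v = v.1 • ((1 : ℝ), (0 : ℝ)) + v.2 • ((0 : ℝ), (1 : ℝ)) := by ext <;> simp
  conv_lhs => rw [this]
  rw [map_add, map_smul, map_smul]; rfl

lemma contDiffAt_of_mem {n : WithTop ℕ∞} {E : Type*} [NormedAddCommGroup E] [NormedSpace ℝ E]
    {F : ℝ × ℝ → E} (hf : ContDiffOn ℝ n F quadrant) (hp : p ∈ quadrant) : ContDiffAt ℝ n F p :=
  hf.contDiffAt (quadrant_mem_nhds hp)

lemma differentiableAt_of_mem {E : Type*} [NormedAddCommGroup E] [NormedSpace ℝ E]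
    {F : ℝ × ℝ → E} (hf : ContDiffOn ℝ 1 F quadrant) (hp : p ∈ quadrant) :
    DifferentiableAt ℝ F p :=
  (contDiffAt_of_mem hf hp).differentiableAt one_ne_zero

lemma contDiffOn_pr {m n : WithTop ℕ∞} (hf : ContDiffOn ℝ n f quadrant) (hmn : m + 1 ≤ n) :
    ContDiffOn ℝ m (pr f) quadrant := by
  have hd : ContDiffOn ℝ 1 f quadrant := hf.of_le (le_trans le_add_self hmn)
  refine ((hf.fderiv_of_isOpen isOpen_quadrant hmn).clm_apply
    (contDiffOn_const (c := ((1 : ℝ), (0 : ℝ))))).congr fun p hp => ?_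
  exact pr_eq_fderiv (differentiableAt_of_mem hd hp)

lemma contDiffOn_pz {m n : WithTop ℕ∞} (hf : ContDiffOn ℝ n f quadrant) (hmn : m + 1 ≤ n) :
    ContDiffOn ℝ m (pz f) quadrant := by
  have hd : ContDiffOn ℝ 1 f quadrant := hf.of_le (le_trans le_add_self hmn)
  refine ((hf.fderiv_of_isOpen isOpen_quadrant hmn).clm_apply
    (contDiffOn_const (c := ((0 : ℝ), (1 : ℝ))))).congr fun p hp => ?_
  exact pz_eq_fderiv (differentiableAt_of_mem hd hp)

lemma pr_pz_comm (hf : ContDiffOn ℝ 2 f quadrant) (hp : p ∈ quadrant) :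
    pr (pz f) p = pz (pr f) p := by
  have h1 : ContDiffOn ℝ 1 f quadrant := hf.of_le (by norm_num)
  have hfd : DifferentiableAt ℝ (fderiv ℝ f) p :=
    differentiableAt_of_mem (hf.fderiv_of_isOpen isOpen_quadrant (m := 1) (by norm_num)) hp
  have ez : pz f =ᶠ[𝓝 p] fun q => fderiv ℝ f q (0, 1) := by
    filter_upwards [quadrant_mem_nhds hp] with q hq
    exact pz_eq_fderiv (differentiableAt_of_mem h1 hq)
  have er : pr f =ᶠ[𝓝 p] fun q => fderiv ℝ f q (1, 0) := by
    filter_upwards [quadrant_mem_nhds hp] with q hq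
    exact pr_eq_fderiv (differentiableAt_of_mem h1 hq)
  rw [pr_eq_fderiv (differentiableAt_of_mem (contDiffOn_pz hf (m := 1) (by norm_num)) hp),
    pz_eq_fderiv (differentiableAt_of_mem (contDiffOn_pr hf (m := 1) (by norm_num)) hp),
    ez.fderiv_eq, er.fderiv_eq]
  have e1 : ∀ v w : ℝ × ℝ, fderiv ℝ (fun q => fderiv ℝ f q v) p w
      = fderiv ℝ (fderiv ℝ f) p w v := by
    intro v w
    have := (hfd.hasFDerivAt.clm_apply (hasFDerivAt_const v p)).fderiv
    rw [this]; simp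
  rw [e1, e1]
  exact ((contDiffAt_of_mem hf hp).isSymmSndFDerivAt (by simp)).eq _ _

end Partial

/-! ### Derivatives along a vector field of functions that are merely limits of `C¹` functions -/

/-- `Y` is the derivative of `X` along the field `w`, in the sense that there are approximations of
`X` whose derivatives along `w` approximate `Y`, both locally uniformly in the quadrant. -/
def FlowDeriv (w : ℝ × ℝ → ℝ × ℝ) (X Y : ℝ × ℝ → ℝ) : Prop :=
  ∃ F : ℝ → ℝ × ℝ → ℝ, (∀ h > 0, ∀ p ∈ quadrant, DifferentiableAt ℝ (F h) p) ∧
    ∀ p ∈ quadrant,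
      Tendsto (fun x : ℝ × (ℝ × ℝ) => F x.1 x.2) (𝓝[>] 0 ×ˢ 𝓝 p) (𝓝 (X p)) ∧
      Tendsto (fun x : ℝ × (ℝ × ℝ) => fderiv ℝ (F x.1) x.2 (w x.2)) (𝓝[>] 0 ×ˢ 𝓝 p) (𝓝 (Y p))

lemma eventually_pos_mem {p : ℝ × ℝ} (hp : p ∈ quadrant) :
    ∀ᶠ x : ℝ × (ℝ × ℝ) in 𝓝[>] 0 ×ˢ 𝓝 p, 0 < x.1 ∧ x.2 ∈ quadrant :=
  (eventually_mem_nhdsWithin.prod_mk (quadrant_mem_nhds hp))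

namespace FlowDeriv

variable {w : ℝ × ℝ → ℝ × ℝ} {X Y X₁ Y₁ X₂ Y₂ c : ℝ × ℝ → ℝ}

lemma congr {X' Y' : ℝ × ℝ → ℝ} (h : FlowDeriv w X Y) (hX : ∀ p ∈ quadrant, X' p = X p)
    (hY : ∀ p ∈ quadrant, Y' p = Y p) : FlowDeriv w X' Y' := by
  obtain ⟨F, hd, hF⟩ := h
  refine ⟨F, hd, fun p hp => ?_⟩
  rw [hX p hp, hY p hp]
  exact hF p hp

lemma neg_field (h : FlowDeriv w X Y) : FlowDeriv (fun p => -w p) X (fun p => -Y p) := by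
  obtain ⟨F, hd, hF⟩ := h
  refine ⟨F, hd, fun p hp => ⟨(hF p hp).1, ?_⟩⟩
  simpa using (hF p hp).2.neg

lemma add (h₁ : FlowDeriv w X₁ Y₁) (h₂ : FlowDeriv w X₂ Y₂) :
    FlowDeriv w (fun p => X₁ p + X₂ p) (fun p => Y₁ p + Y₂ p) := by
  obtain ⟨F₁, hd₁, hF₁⟩ := h₁
  obtain ⟨F₂, hd₂, hF₂⟩ := h₂
  refine ⟨fun h p => F₁ h p + F₂ h p, fun h hh p hp => (hd₁ h hh p hp).add (hd₂ h hh p hp),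
    fun p hp => ⟨(hF₁ p hp).1.add (hF₂ p hp).1, ?_⟩⟩
  refine ((hF₁ p hp).2.add (hF₂ p hp).2).congr' ?_
  filter_upwards [eventually_pos_mem hp] with x hx
  rw [fderiv_fun_add (hd₁ _ hx.1 _ hx.2) (hd₂ _ hx.1 _ hx.2)]; rfl

lemma mul_left (hw : ContinuousOn w quadrant) (hc : ContDiffOn ℝ 1 c quadrant)
    (h : FlowDeriv w X Y) :
    FlowDeriv w (fun p => c p * X p) (fun p => c p * Y p + X p * fderiv ℝ c p (w p)) := by
  obtain ⟨F, hd, hF⟩ := h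
  refine ⟨fun h p => c p * F h p,
    fun h hh p hp => (differentiableAt_of_mem hc hp).mul (hd h hh p hp), fun p hp => ⟨?_, ?_⟩⟩
  · exact (((contDiffAt_of_mem hc hp).continuousAt.tendsto.comp tendsto_snd)).mul (hF p hp).1
  · have hcw : ContinuousAt (fun q => fderiv ℝ c q (w q)) p :=
      (((hc.continuousOn_fderiv_of_isOpen isOpen_quadrant le_rfl).clm_apply hw).continuousAt
        (quadrant_mem_nhds hp))
    refine (((((contDiffAt_of_mem hc hp).continuousAt.tendsto.comp tendsto_snd)).mul
      (hF p hp).2).add ((hF p hp).1.mul (hcw.tendsto.comp tendsto_snd))).congr' ?_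
    filter_upwards [eventually_pos_mem hp] with x hx
    rw [fderiv_fun_mul (differentiableAt_of_mem hc hx.2) (hd _ hx.1 _ hx.2)]
    simp

lemma neg (hw : ContinuousOn w quadrant) (h : FlowDeriv w X Y) :
    FlowDeriv w (fun p => -X p) (fun p => -Y p) :=
  (h.mul_left hw (contDiffOn_const (c := (-1 : ℝ)))).congr (fun p _ => by ring)
    (fun p _ => by simp)

lemma of_contDiffOn (hw : ContinuousOn w quadrant) (hX : ContDiffOn ℝ 1 X quadrant) :
    FlowDeriv w X (fun p => fderiv ℝ X p (w p)) := by
  refine ⟨fun _ => X, fun h _ p hp => differentiableAt_of_mem hX hp, fun p hp => ⟨?_, ?_⟩⟩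
  · exact (contDiffAt_of_mem hX hp).continuousAt.tendsto.comp tendsto_snd
  · have : ContinuousAt (fun q => fderiv ℝ X q (w q)) p :=
      (((hX.continuousOn_fderiv_of_isOpen isOpen_quadrant le_rfl).clm_apply hw).continuousAt
        (quadrant_mem_nhds hp))
    exact this.tendsto.comp tendsto_snd

end FlowDeriv

lemma tendsto_add_smul (p e : ℝ × ℝ) :
    Tendsto (fun x : ℝ × (ℝ × ℝ) => x.2 + x.1 • e) (𝓝[>] 0 ×ˢ 𝓝 p) (𝓝 p) := by
  have h : Tendsto (fun x : ℝ × (ℝ × ℝ) => x.2 + x.1 • e) (𝓝 (0, p)) (𝓝 (p + (0 : ℝ) • e)) := by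
    apply Continuous.tendsto'
    · fun_prop
    · simp
  rw [zero_smul, add_zero, nhds_prod_eq] at h
  exact h.mono_left (prod_mono nhdsWithin_le_nhds le_rfl)

/-- Strict differentiability is what makes the limit joint in the step and the base point, as the
locally uniform convergence in `FlowDeriv` demands. -/
lemma tendsto_difference_quotient {E : Type*} [NormedAddCommGroup E] [NormedSpace ℝ E]
    {f : ℝ × ℝ → E} {f' : ℝ × ℝ →L[ℝ] E} {p : ℝ × ℝ} (hf : HasStrictFDerivAt f f' p)
    (e : ℝ × ℝ) :
    Tendsto (fun x : ℝ × (ℝ × ℝ) => x.1⁻¹ • (f (x.2 + x.1 • e) - f x.2)) (𝓝[>] 0 ×ˢ 𝓝 p)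
      (𝓝 (f' e)) := by
  have hlim : Tendsto (fun x : ℝ × (ℝ × ℝ) => (x.2 + x.1 • e, x.2)) (𝓝[>] 0 ×ˢ 𝓝 p)
      (𝓝 (p, p)) :=
    (tendsto_add_smul p e).prodMk_nhds tendsto_snd
  have h1 := hf.isLittleO.comp_tendsto hlim
  have h2 : (fun x : ℝ × (ℝ × ℝ) => f (x.2 + x.1 • e) - f x.2 - x.1 • f' e)
      =o[𝓝[>] 0 ×ˢ 𝓝 p] fun x => x.1 := by
    refine (h1.trans_isBigO ?_).congr_left ?_
    · refine Asymptotics.IsBigO.of_bound ‖e‖ (Eventually.of_forall fun x => ?_)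
      simp only [Function.comp, add_sub_cancel_left, norm_smul]
      rw [mul_comm]
    · intro x; simp
  have h3 : Tendsto (fun x : ℝ × (ℝ × ℝ) => x.1⁻¹ • (f (x.2 + x.1 • e) - f x.2 - x.1 • f' e))
      (𝓝[>] 0 ×ˢ 𝓝 p) (𝓝 0) := h2.tendsto_inv_smul_nhds_zero
  have h4 := h3.add_const (f' e)
  rw [zero_add] at h4
  refine h4.congr' ?_
  have : ∀ᶠ x : ℝ × (ℝ × ℝ) in 𝓝[>] 0 ×ˢ 𝓝 p, 0 < x.1 :=
    tendsto_fst.eventually eventually_mem_nhdsWithin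
  filter_upwards [this] with x hx
  rw [smul_sub _ _ (x.1 • f' e), smul_smul, inv_mul_cancel₀ hx.ne', one_smul, sub_add_cancel]

/-- Formally this differentiates the equation in the direction e, which would need second
derivatives of `Om`. Instead the equation is subtracted at p + h e and p: the derivative along `v`
of the difference quotient of `Om` equals that of `S` minus `fderiv ℝ Om (p + h • e)` applied to
that of `v`, and only first derivatives remain as h → 0. Taking e in the closed quadrant keeps p + h
e in the domain. -/
lemma FlowDeriv.directional {v : ℝ × ℝ → ℝ × ℝ} {Om S : ℝ × ℝ → ℝ} {e : ℝ × ℝ}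
    (he : e ∈ closedQuadrant) (hv : ContDiffOn ℝ 1 v quadrant) (hO : ContDiffOn ℝ 1 Om quadrant)
    (hS : ContDiffOn ℝ 1 S quadrant) (heq : ∀ p ∈ quadrant, fderiv ℝ Om p (v p) = S p) :
    FlowDeriv v (fun p => fderiv ℝ Om p e)
      (fun p => fderiv ℝ S p e - fderiv ℝ Om p (fderiv ℝ v p e)) := by
  have hshift : ∀ h > (0 : ℝ), ∀ p ∈ quadrant, p + h • e ∈ quadrant := fun h hh p hp =>
    ⟨by simpa using add_pos_of_pos_of_nonneg hp.1 (mul_nonneg hh.le he.1),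
      by simpa using add_pos_of_pos_of_nonneg hp.2 (mul_nonneg hh.le he.2)⟩
  have hder : ∀ h > (0 : ℝ), ∀ p ∈ quadrant,
      HasFDerivAt (fun p => h⁻¹ • (Om (p + h • e) - Om p))
        (h⁻¹ • (fderiv ℝ Om (p + h • e) - fderiv ℝ Om p)) p := by
    intro h hh p hp
    have h1 : HasFDerivAt (fun p => Om (p + h • e)) (fderiv ℝ Om (p + h • e)) p := by
      have := (differentiableAt_of_mem hO (hshift h hh p hp)).hasFDerivAt.comp p
        ((hasFDerivAt_id p).add_const (h • e))
      rwa [ContinuousLinearMap.comp_id] at this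
    exact (h1.sub (differentiableAt_of_mem hO hp).hasFDerivAt).const_smul h⁻¹
  refine ⟨fun h p => h⁻¹ • (Om (p + h • e) - Om p),
    fun h hh p hp => (hder h hh p hp).differentiableAt, fun p hp => ⟨?_, ?_⟩⟩
  · exact tendsto_difference_quotient
      ((contDiffAt_of_mem hO hp).hasStrictFDerivAt one_ne_zero) e
  · have t1 := tendsto_difference_quotient
      ((contDiffAt_of_mem hS hp).hasStrictFDerivAt one_ne_zero) e
    have t2 := tendsto_difference_quotient
      ((contDiffAt_of_mem hv hp).hasStrictFDerivAt one_ne_zero) e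
    have t3 : Tendsto (fun x : ℝ × (ℝ × ℝ) => fderiv ℝ Om (x.2 + x.1 • e)) (𝓝[>] 0 ×ˢ 𝓝 p)
        (𝓝 (fderiv ℝ Om p)) :=
      (((hO.continuousOn_fderiv_of_isOpen isOpen_quadrant le_rfl).continuousAt
        (quadrant_mem_nhds hp)).tendsto.comp (tendsto_add_smul p e))
    have t4 := (isBoundedBilinearMap_apply (𝕜 := ℝ) (E := ℝ × ℝ) (F := ℝ)).continuous.continuousAt
      |>.tendsto.comp (t3.prodMk_nhds t2)
    refine (t1.sub t4).congr' ?_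
    filter_upwards [eventually_pos_mem hp] with x hx
    rw [(hder _ hx.1 _ hx.2).fderiv, ← heq _ (hshift _ hx.1 _ hx.2), ← heq _ hx.2]
    simp only [Function.comp, smul_eq_mul, map_smul, map_sub, _root_.smul_apply,
      _root_.sub_apply]
    ring

/-- Maximum principle: if the field `w` points into the compact set `K` off `{G = 1}`, then a
function increasing along `w` wherever it exceeds `C` is bounded by `C` if it is on `{G = 1}`. -/
lemma FlowDeriv.le_of_compact {w : ℝ × ℝ → ℝ × ℝ} {X Y G : ℝ × ℝ → ℝ} {K : Set (ℝ × ℝ)} {C : ℝ}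
    (hK : IsCompact K) (hKq : K ⊆ quadrant) (hG : ContinuousOn G quadrant)
    (hexit : ∀ p ∈ K, G p ≠ 1 → ∀ᶠ s : ℝ in 𝓝[>] 0, p + s • w p ∈ K)
    (hXY : FlowDeriv w X Y) (hΓ : ∀ p ∈ K, G p = 1 → X p ≤ C)
    (hpos : ∀ p ∈ K, C < X p → 0 < Y p) : ∀ p ∈ K, X p ≤ C := by
  intro p₁ hp₁
  by_contra! hlt
  obtain ⟨F, hd, hF⟩ := hXY
  -- `X` may have no derivative at its maximum, so the approximations are maximized instead and a
  -- limit point of their maximizers is used.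
  have hmax : ∀ n : ℕ, ∃ q ∈ K, IsMaxOn (F (1 / ((n : ℝ) + 1))) K q := fun n =>
    hK.exists_isMaxOn ⟨p₁, hp₁⟩ fun q hq =>
      (hd _ (Nat.one_div_pos_of_nat (α := ℝ)) q (hKq hq)).continuousAt.continuousWithinAt
  choose q hqK hqmax using hmax
  obtain ⟨q₀, hq₀K, φ, hφ, hlim⟩ := hK.tendsto_subseq hqK
  have hq₀ := hKq hq₀K
  have hh : Tendsto (fun n : ℕ => 1 / (((φ n : ℕ) : ℝ) + 1)) atTop (𝓝[>] 0) := by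
    refine tendsto_nhdsWithin_iff.2 ⟨tendsto_one_div_add_atTop_nhds_zero_nat.comp hφ.tendsto_atTop,
      Eventually.of_forall fun n => ?_⟩
    exact (Nat.one_div_pos_of_nat (α := ℝ))
  have hpair := hh.prodMk hlim
  have hX := (hF q₀ hq₀).1.comp hpair
  have hY := (hF q₀ hq₀).2.comp hpair
  have hX₁ := (hF p₁ (hKq hp₁)).1.comp (hh.prodMk (tendsto_const_nhds (x := p₁)))
  have hle : X p₁ ≤ X q₀ := le_of_tendsto_of_tendsto' hX₁ hX fun n => hqmax (φ n) hp₁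
  have hGne : G q₀ ≠ 1 := fun h => absurd (hΓ q₀ hq₀K h) (by linarith)
  have hev : ∀ᶠ n in atTop, G (q (φ n)) ≠ 1 :=
    ((hG.continuousAt (quadrant_mem_nhds hq₀)).tendsto.comp hlim).eventually_ne hGne
  -- Off {G = 1} the field lies in the positive tangent cone of `K`, so the derivative along it is
  -- nonpositive at a maximizer; the sign survives in the limit.
  have hYle : Y q₀ ≤ 0 := by
    refine le_of_tendsto hY ?_
    filter_upwards [hev] with n hn
    have hloc : IsLocalMaxOn (F (1 / (((φ n : ℕ) : ℝ) + 1))) K (q (φ n)) :=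
      (hqmax (φ n)).localize
    refine hloc.hasFDerivWithinAt_nonpos
      (hd _ (Nat.one_div_pos_of_nat (α := ℝ)) _ (hKq (hqK _))).hasFDerivAt.hasFDerivWithinAt ?_
    exact mem_posTangentConeAt_of_frequently_mem (hexit _ (hqK _) hn).frequently
  exact absurd (hpos q₀ hq₀K (by linarith)) (by linarith)

/-- Barrier criterion: the sign of the derivative matters only on the boundary f = c, since strict
inequality persists by continuity. -/
lemma eventually_le_of_fderiv_pos {f : ℝ × ℝ → ℝ} {p v : ℝ × ℝ} {c : ℝ}
    (hf : DifferentiableAt ℝ f p) (hc : c ≤ f p) (hpos : f p = c → 0 < fderiv ℝ f p v) :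
    ∀ᶠ s : ℝ in 𝓝[>] 0, c ≤ f (p + s • v) := by
  have hline : HasDerivAt (fun s : ℝ => p + s • v) v 0 := by
    simpa using ((hasDerivAt_id (0 : ℝ)).smul_const v).const_add p
  have hcomp : HasDerivAt (fun s : ℝ => f (p + s • v)) (fderiv ℝ f p v) 0 := by
    have h0 : HasFDerivAt f (fderiv ℝ f p) (p + (0 : ℝ) • v) := by simpa using hf.hasFDerivAt
    exact h0.comp_hasDerivAt 0 hline
  rcases hc.lt_or_eq with h | h
  · have : ∀ᶠ s : ℝ in 𝓝 0, c < f (p + s • v) :=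
      hcomp.continuousAt.eventually (by simpa using lt_mem_nhds h)
    exact (this.filter_mono nhdsWithin_le_nhds).mono fun s hs => hs.le
  · have h1 := hcomp.tendsto_slope
    have h2 : ∀ᶠ s in 𝓝[≠] (0 : ℝ), 0 < slope (fun s : ℝ => f (p + s • v)) 0 s :=
      h1.eventually (lt_mem_nhds (hpos h.symm))
    filter_upwards [h2.filter_mono (nhdsWithin_mono _ fun s hs => ne_of_gt hs),
      eventually_mem_nhdsWithin] with s hs hs0
    rw [slope_def_field] at hs
    simp only [zero_smul, add_zero, sub_zero] at hs
    have := (div_pos_iff_of_pos_right (mem_Ioi.1 hs0)).1 hs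
    linarith

/-! ### The normalized transport field

In the coordinates `(r, Q)` with `Q = (μ + ψ) z` the transport equation becomes
`r ∂_r Ω + F ∂_Q Ω = - Ω / A` with `F = (μ - (D - 1) ψ) z` and `A = ∂_z Q`. -/

/-- The quantitative properties of a stream function on which the transport estimates rest. -/
structure StreamBounds (D μ a a₁ θ β C : ℝ) (ψ : ℝ × ℝ → ℝ) : Prop where
  contDiffOn : ContDiffOn ℝ 2 ψ quadrant
  three_le : 3 ≤ D
  mu_pos : 0 < μ
  a_pos : 0 < a
  a1_pos : 0 < a₁
  lt_mu : (D - 1) * a₁ < μ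
  theta_pos : 0 < θ
  theta_lt : θ < 1
  beta_pos : 0 < β
  beta_eq : β = 1 / μ - (D - 2)
  C_nonneg : 0 ≤ C
  pos : ∀ p ∈ quadrant, 0 < ψ p
  le_a1 : ∀ p ∈ quadrant, ψ p ≤ a₁
  z_pz_le : ∀ p ∈ quadrant, |p.2 * pz ψ p| ≤ ψ p / 10
  z_pr_le : ∀ p ∈ quadrant, |p.2 * pr ψ p| ≤ ψ p / 10
  pr_le : ∀ p ∈ quadrant, |pr ψ p| ≤ a₁
  pz_le : ∀ p ∈ quadrant, |pz ψ p| ≤ a₁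
  sub_a_le : ∀ p ∈ quadrant, |ψ p - a| ≤ a₁ * (p.1 + p.2)
  decay : ∀ p ∈ quadrant, 1 ≤ p.1 ^ 2 + ((μ + ψ p) * p.2) ^ 2 →
    ψ p ≤ C * (p.1 ^ 2 + ((μ + ψ p) * p.2) ^ 2) ^ (-β / 2)
  z_pr_pz_le : ∀ p ∈ quadrant, |p.2 * pr (pz ψ) p| ≤ C * (1 + p.1 ^ (-θ))
  z_pz_pz_le : ∀ p ∈ quadrant, |p.2 * pz (pz ψ) p| ≤ C * (1 + p.1 ^ (-θ))

/-- The stretched height `Q = (μ + ψ) z`. -/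
def strQ (μ : ℝ) (ψ : ℝ × ℝ → ℝ) (p : ℝ × ℝ) : ℝ := (μ + ψ p) * p.2

/-- The velocity `F = (μ - (D - 1) ψ) z` of the stretched height. -/
def strF (D μ : ℝ) (ψ : ℝ × ℝ → ℝ) (p : ℝ × ℝ) : ℝ := (μ - (D - 1) * ψ p) * p.2

/-- `A = ∂_z Q`. -/
def strA (μ : ℝ) (ψ : ℝ × ℝ → ℝ) (p : ℝ × ℝ) : ℝ := μ + ψ p + p.2 * pz ψ p

/-- `g = 1 / A`. -/
def strg (μ : ℝ) (ψ : ℝ × ℝ → ℝ) (p : ℝ × ℝ) : ℝ := (strA μ ψ p)⁻¹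

/-- `H = ∂_r Q`. -/
def strH (ψ : ℝ × ℝ → ℝ) (p : ℝ × ℝ) : ℝ := p.2 * pr ψ p

/-- The vertical component of the normalized transport field. -/
def strB (D μ : ℝ) (ψ : ℝ × ℝ → ℝ) (p : ℝ × ℝ) : ℝ :=
  strg μ ψ p * (strF D μ ψ p - p.1 * strH ψ p)

/-- The transport field, normalized so that `r` grows at unit logarithmic speed. -/
def flowField (D μ : ℝ) (ψ : ℝ × ℝ → ℝ) (p : ℝ × ℝ) : ℝ × ℝ := (p.1, strB D μ ψ p)

/-- The function `r² + Q²` whose unit level is the initial curve. -/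
def level (μ : ℝ) (ψ : ℝ × ℝ → ℝ) (p : ℝ × ℝ) : ℝ := p.1 ^ 2 + strQ μ ψ p ^ 2

namespace StreamBounds

variable {D μ a a₁ θ β C : ℝ} {ψ : ℝ × ℝ → ℝ} {p : ℝ × ℝ}

lemma contDiffOn_one (h : StreamBounds D μ a a₁ θ β C ψ) : ContDiffOn ℝ 1 ψ quadrant :=
  h.contDiffOn.of_le (by norm_num)

lemma contDiffOn_pz (h : StreamBounds D μ a a₁ θ β C ψ) : ContDiffOn ℝ 1 (pz ψ) quadrant :=
  EulerProfile.contDiffOn_pz h.contDiffOn (by norm_num)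

lemma contDiffOn_pr (h : StreamBounds D μ a a₁ θ β C ψ) : ContDiffOn ℝ 1 (pr ψ) quadrant :=
  EulerProfile.contDiffOn_pr h.contDiffOn (by norm_num)

lemma contDiffOn_strQ (h : StreamBounds D μ a a₁ θ β C ψ) : ContDiffOn ℝ 1 (strQ μ ψ) quadrant :=
  (contDiffOn_const.add h.contDiffOn_one).mul contDiff_snd.contDiffOn

lemma contDiffOn_strF (h : StreamBounds D μ a a₁ θ β C ψ) :
    ContDiffOn ℝ 1 (strF D μ ψ) quadrant :=
  (contDiffOn_const.sub (contDiffOn_const.mul h.contDiffOn_one)).mul contDiff_snd.contDiffOn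

lemma contDiffOn_strA (h : StreamBounds D μ a a₁ θ β C ψ) : ContDiffOn ℝ 1 (strA μ ψ) quadrant :=
  (contDiffOn_const.add h.contDiffOn_one).add (contDiff_snd.contDiffOn.mul h.contDiffOn_pz)

lemma contDiffOn_strH (h : StreamBounds D μ a a₁ θ β C ψ) : ContDiffOn ℝ 1 (strH ψ) quadrant :=
  contDiff_snd.contDiffOn.mul h.contDiffOn_pr

lemma contDiffOn_level (h : StreamBounds D μ a a₁ θ β C ψ) :
    ContDiffOn ℝ 1 (level μ ψ) quadrant :=
  (contDiff_fst.contDiffOn.pow 2).add (h.contDiffOn_strQ.pow 2)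

lemma le_strA (h : StreamBounds D μ a a₁ θ β C ψ) (hp : p ∈ quadrant) :
    μ + 9 / 10 * ψ p ≤ strA μ ψ p := by
  have := (abs_le.1 (h.z_pz_le p hp)).1
  unfold strA; linarith

lemma strA_le (h : StreamBounds D μ a a₁ θ β C ψ) (hp : p ∈ quadrant) :
    strA μ ψ p ≤ μ + 11 / 10 * ψ p := by
  have := (abs_le.1 (h.z_pz_le p hp)).2
  unfold strA; linarith

lemma mu_le_strA (h : StreamBounds D μ a a₁ θ β C ψ) (hp : p ∈ quadrant) : μ ≤ strA μ ψ p := by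
  linarith [h.le_strA hp, h.pos p hp]

lemma strA_pos (h : StreamBounds D μ a a₁ θ β C ψ) (hp : p ∈ quadrant) : 0 < strA μ ψ p :=
  h.mu_pos.trans_le (h.mu_le_strA hp)

lemma strg_pos (h : StreamBounds D μ a a₁ θ β C ψ) (hp : p ∈ quadrant) : 0 < strg μ ψ p :=
  inv_pos.2 (h.strA_pos hp)

lemma strg_mul_strA (h : StreamBounds D μ a a₁ θ β C ψ) (hp : p ∈ quadrant) :
    strg μ ψ p * strA μ ψ p = 1 := inv_mul_cancel₀ (h.strA_pos hp).ne'

lemma contDiffOn_strg (h : StreamBounds D μ a a₁ θ β C ψ) : ContDiffOn ℝ 1 (strg μ ψ) quadrant :=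
  h.contDiffOn_strA.inv fun _ hp => (h.strA_pos hp).ne'

lemma contDiffOn_strB (h : StreamBounds D μ a a₁ θ β C ψ) :
    ContDiffOn ℝ 1 (strB D μ ψ) quadrant :=
  h.contDiffOn_strg.mul (h.contDiffOn_strF.sub (contDiff_fst.contDiffOn.mul h.contDiffOn_strH))

lemma contDiffOn_flowField (h : StreamBounds D μ a a₁ θ β C ψ) :
    ContDiffOn ℝ 1 (flowField D μ ψ) quadrant :=
  contDiff_fst.contDiffOn.prodMk h.contDiffOn_strB

/-! #### Partial derivatives -/

lemma pr_strQ (h : StreamBounds D μ a a₁ θ β C ψ) (hp : p ∈ quadrant) :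
    pr (strQ μ ψ) p = strH ψ p := by
  have h1 := hasDerivAt_pr (differentiableAt_of_mem h.contDiffOn_one hp)
  have := ((h1.const_add μ).mul_const p.2).deriv
  exact this.trans (by unfold strH; ring)

lemma pz_strQ (h : StreamBounds D μ a a₁ θ β C ψ) (hp : p ∈ quadrant) :
    pz (strQ μ ψ) p = strA μ ψ p := by
  have h1 := hasDerivAt_pz (differentiableAt_of_mem h.contDiffOn_one hp)
  have := ((h1.const_add μ).mul (hasDerivAt_id p.2)).deriv
  exact this.trans (by simp only [strA, id]; ring)

lemma pr_strF (h : StreamBounds D μ a a₁ θ β C ψ) (hp : p ∈ quadrant) :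
    pr (strF D μ ψ) p = -((D - 1) * strH ψ p) := by
  have h1 := hasDerivAt_pr (differentiableAt_of_mem h.contDiffOn_one hp)
  have := (((h1.const_mul (D - 1)).const_sub μ).mul_const p.2).deriv
  exact this.trans (by unfold strH; ring)

lemma pz_strF (h : StreamBounds D μ a a₁ θ β C ψ) (hp : p ∈ quadrant) :
    pz (strF D μ ψ) p = μ - (D - 1) * (ψ p + p.2 * pz ψ p) := by
  have h1 := hasDerivAt_pz (differentiableAt_of_mem h.contDiffOn_one hp)
  have := (((h1.const_mul (D - 1)).const_sub μ).mul (hasDerivAt_id p.2)).deriv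
  exact this.trans (by simp only [id]; ring)

lemma pr_strA (h : StreamBounds D μ a a₁ θ β C ψ) (hp : p ∈ quadrant) :
    pr (strA μ ψ) p = pr ψ p + p.2 * pr (pz ψ) p := by
  have h1 := hasDerivAt_pr (differentiableAt_of_mem h.contDiffOn_one hp)
  have h2 := hasDerivAt_pr (differentiableAt_of_mem h.contDiffOn_pz hp)
  exact ((h1.const_add μ).add (h2.const_mul p.2)).deriv

lemma pz_strA (h : StreamBounds D μ a a₁ θ β C ψ) (hp : p ∈ quadrant) :
    pz (strA μ ψ) p = 2 * pz ψ p + p.2 * pz (pz ψ) p := by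
  have h1 := hasDerivAt_pz (differentiableAt_of_mem h.contDiffOn_one hp)
  have h2 := hasDerivAt_pz (differentiableAt_of_mem h.contDiffOn_pz hp)
  have := ((h1.const_add μ).add ((hasDerivAt_id p.2).mul h2)).deriv
  exact this.trans (by simp only [id]; ring)

/-- Symmetry of the second derivatives of Q. -/
lemma pz_strH (h : StreamBounds D μ a a₁ θ β C ψ) (hp : p ∈ quadrant) :
    pz (strH ψ) p = pr (strA μ ψ) p := by
  have h2 := hasDerivAt_pz (differentiableAt_of_mem h.contDiffOn_pr hp)
  have := ((hasDerivAt_id p.2).mul h2).deriv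
  rw [h.pr_strA hp, pr_pz_comm h.contDiffOn hp]
  exact this.trans (by simp only [id]; ring)

lemma pr_strg (h : StreamBounds D μ a a₁ θ β C ψ) (hp : p ∈ quadrant) :
    pr (strg μ ψ) p = -(strg μ ψ p ^ 2 * pr (strA μ ψ) p) := by
  have h1 := hasDerivAt_pr (differentiableAt_of_mem h.contDiffOn_strA hp)
  have := (h1.fun_inv (h.strA_pos hp).ne').deriv
  exact this.trans (by unfold strg; rw [neg_div, div_eq_mul_inv, inv_pow, mul_comm])

lemma pz_strg (h : StreamBounds D μ a a₁ θ β C ψ) (hp : p ∈ quadrant) :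
    pz (strg μ ψ) p = -(strg μ ψ p ^ 2 * pz (strA μ ψ) p) := by
  have h1 := hasDerivAt_pz (differentiableAt_of_mem h.contDiffOn_strA hp)
  have := (h1.fun_inv (h.strA_pos hp).ne').deriv
  exact this.trans (by unfold strg; rw [neg_div, div_eq_mul_inv, inv_pow, mul_comm])

lemma pr_strB (h : StreamBounds D μ a a₁ θ β C ψ) (hp : p ∈ quadrant) :
    pr (strB D μ ψ) p = pr (strg μ ψ) p * (strF D μ ψ p - p.1 * strH ψ p)
      + strg μ ψ p * (pr (strF D μ ψ) p - strH ψ p - p.1 * pr (strH ψ) p) := by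
  have h1 := hasDerivAt_pr (differentiableAt_of_mem h.contDiffOn_strg hp)
  have h2 := hasDerivAt_pr (differentiableAt_of_mem h.contDiffOn_strF hp)
  have h3 := hasDerivAt_pr (differentiableAt_of_mem h.contDiffOn_strH hp)
  have := (h1.mul (h2.sub ((hasDerivAt_id p.1).mul h3))).deriv
  exact this.trans (by simp only [id, Pi.sub_apply, Pi.mul_apply]; ring)

lemma pz_strB (h : StreamBounds D μ a a₁ θ β C ψ) (hp : p ∈ quadrant) :
    pz (strB D μ ψ) p = pz (strg μ ψ) p * (strF D μ ψ p - p.1 * strH ψ p)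
      + strg μ ψ p * (pz (strF D μ ψ) p - p.1 * pz (strH ψ) p) := by
  have h1 := hasDerivAt_pz (differentiableAt_of_mem h.contDiffOn_strg hp)
  have h2 := hasDerivAt_pz (differentiableAt_of_mem h.contDiffOn_strF hp)
  have h3 := hasDerivAt_pz (differentiableAt_of_mem h.contDiffOn_strH hp)
  exact (h1.mul (h2.sub (h3.const_mul p.1))).deriv

/-! #### Derivatives along the field -/

lemma fderiv_flowField (h : StreamBounds D μ a a₁ θ β C ψ) (hp : p ∈ quadrant) (e : ℝ × ℝ) :
    fderiv ℝ (flowField D μ ψ) p e = (e.1, fderiv ℝ (strB D μ ψ) p e) := by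
  have := (hasFDerivAt_fst (𝕜 := ℝ) (p := p)).prodMk
    (differentiableAt_of_mem h.contDiffOn_strB hp).hasFDerivAt
  rw [show flowField D μ ψ = fun p => (p.1, strB D μ ψ p) from rfl, this.fderiv]; rfl

lemma fderiv_flow {f : ℝ × ℝ → ℝ} (hf : DifferentiableAt ℝ f p) :
    fderiv ℝ f p (flowField D μ ψ p) = p.1 * pr f p + strB D μ ψ p * pz f p :=
  fderiv_apply_eq hf _

/-- `strB` is chosen for this identity: the velocity of Q contains no derivative of ψ. -/
lemma flow_strQ (h : StreamBounds D μ a a₁ θ β C ψ) (hp : p ∈ quadrant) :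
    fderiv ℝ (strQ μ ψ) p (flowField D μ ψ p) = strF D μ ψ p := by
  rw [fderiv_flow (differentiableAt_of_mem h.contDiffOn_strQ hp), h.pr_strQ hp, h.pz_strQ hp, strB]
  linear_combination (strF D μ ψ p - p.1 * strH ψ p) * h.strg_mul_strA hp

lemma flow_level (h : StreamBounds D μ a a₁ θ β C ψ) (hp : p ∈ quadrant) (v : ℝ × ℝ) :
    fderiv ℝ (level μ ψ) p v
      = 2 * p.1 * v.1 + 2 * strQ μ ψ p * fderiv ℝ (strQ μ ψ) p v := by
  have := ((hasFDerivAt_fst (𝕜 := ℝ) (p := p)).pow 2).add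
    ((differentiableAt_of_mem h.contDiffOn_strQ hp).hasFDerivAt.pow 2)
  have e : level μ ψ = (fun x : ℝ × ℝ => x.1 ^ 2) + fun x => strQ μ ψ x ^ 2 := rfl
  rw [e]
  erw [this.fderiv]
  simp

variable {Om : ℝ × ℝ → ℝ}

/-- Transport of `∂_Q Ω = g ∂_z Ω`. -/
lemma flowDeriv_dQ (h : StreamBounds D μ a a₁ θ β C ψ) (hO : ContDiffOn ℝ 1 Om quadrant)
    (heq : ∀ p ∈ quadrant, fderiv ℝ Om p (flowField D μ ψ p) = -(strg μ ψ p * Om p)) :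
    FlowDeriv (flowField D μ ψ) (fun p => strg μ ψ p * pz Om p)
      (fun p => -((strg μ ψ p + strg μ ψ p * pz (strF D μ ψ) p) * (strg μ ψ p * pz Om p))
        + strg μ ψ p ^ 3 * pz (strA μ ψ) p * Om p) := by
  have hS : ContDiffOn ℝ 1 (fun p => -(strg μ ψ p * Om p)) quadrant :=
    (h.contDiffOn_strg.mul hO).neg
  refine ((FlowDeriv.directional (e := (0, 1)) (by constructor <;> norm_num) h.contDiffOn_flowField
    hO hS heq).mul_left h.contDiffOn_flowField.continuousOn h.contDiffOn_strg).congr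
    (fun p hp => ?_) (fun p hp => ?_)
  · rw [pz_eq_fderiv (differentiableAt_of_mem hO hp)]
  · have hOp := differentiableAt_of_mem hO hp
    have e1 : pz (fun p => -(strg μ ψ p * Om p)) p
        = -(pz (strg μ ψ) p * Om p + strg μ ψ p * pz Om p) :=
      ((hasDerivAt_pz (differentiableAt_of_mem h.contDiffOn_strg hp)).mul
        (hasDerivAt_pz hOp)).neg.deriv
    rw [← pz_eq_fderiv (differentiableAt_of_mem hS hp), ← pz_eq_fderiv hOp, e1,
      h.fderiv_flowField hp, fderiv_apply_eq hOp,
      ← pz_eq_fderiv (differentiableAt_of_mem h.contDiffOn_strB hp),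
      fderiv_flow (differentiableAt_of_mem h.contDiffOn_strg hp), h.pz_strB hp, h.pz_strH hp,
      h.pr_strg hp, h.pz_strg hp, strB]
    ring

/-- Transport of the derivative `∂_r Ω - H ∂_Q Ω` of `Ω` in `r` at fixed `Q`. -/
lemma flowDeriv_dr (h : StreamBounds D μ a a₁ θ β C ψ) (hO : ContDiffOn ℝ 1 Om quadrant)
    (heq : ∀ p ∈ quadrant, fderiv ℝ Om p (flowField D μ ψ p) = -(strg μ ψ p * Om p)) :
    FlowDeriv (flowField D μ ψ) (fun p => pr Om p - strH ψ p * (strg μ ψ p * pz Om p))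
      (fun p => -((1 + strg μ ψ p) * (pr Om p - strH ψ p * (strg μ ψ p * pz Om p)))
        + ((strH ψ p * strg μ ψ p * pz (strF D μ ψ) p + (D - 1) * strH ψ p)
            * (strg μ ψ p * pz Om p)
          + strg μ ψ p ^ 2 * (pr (strA μ ψ) p - strH ψ p * strg μ ψ p * pz (strA μ ψ) p)
            * Om p)) := by
  have hS : ContDiffOn ℝ 1 (fun p => -(strg μ ψ p * Om p)) quadrant :=
    (h.contDiffOn_strg.mul hO).neg
  have hw := h.contDiffOn_flowField.continuousOn
  have d1 := FlowDeriv.directional (e := (1, 0)) (by constructor <;> norm_num)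
    h.contDiffOn_flowField hO hS heq
  have d2 := ((h.flowDeriv_dQ hO heq).mul_left hw h.contDiffOn_strH).neg hw
  refine (d1.add d2).congr (fun p hp => ?_) (fun p hp => ?_)
  · rw [pr_eq_fderiv (differentiableAt_of_mem hO hp)]; ring
  · have hOp := differentiableAt_of_mem hO hp
    have e1 : pr (fun p => -(strg μ ψ p * Om p)) p
        = -(pr (strg μ ψ) p * Om p + strg μ ψ p * pr Om p) :=
      ((hasDerivAt_pr (differentiableAt_of_mem h.contDiffOn_strg hp)).mul
        (hasDerivAt_pr hOp)).neg.deriv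
    -- The two contributions of ∂_r H, hence of z ∂_r² ψ, cancel. This is why `StreamBounds`
    -- controls only the other second derivatives.
    rw [← pr_eq_fderiv (differentiableAt_of_mem hS hp), e1,
      h.fderiv_flowField hp, fderiv_apply_eq hOp,
      ← pr_eq_fderiv (differentiableAt_of_mem h.contDiffOn_strB hp),
      fderiv_flow (differentiableAt_of_mem h.contDiffOn_strH hp), h.pr_strB hp, h.pz_strH hp,
      h.pr_strg hp, h.pr_strF hp, strB]
    ring

end StreamBounds

/-! ### Compact regions and comparison with the initial curve -/

/-- The defining functions are continuous only on the open quadrant, so closedness is obtained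
inside a box that avoids both axes. -/
lemma isCompact_of_subset_box {K T : Set (ℝ × ℝ)} {f : ℝ × ℝ → ℝ × ℝ} {r₀ r₁ z₀ z₁ : ℝ}
    (hf : ContinuousOn f quadrant) (hT : IsClosed T) (hr : 0 < r₀) (hz : 0 < z₀)
    (hbox : K ⊆ Icc r₀ r₁ ×ˢ Icc z₀ z₁) (hK : ∀ p ∈ quadrant, p ∈ K ↔ p.1 ∈ Icc r₀ r₁ ∧ f p ∈ T) :
    IsCompact K := by
  have hBq : Icc r₀ r₁ ×ˢ Icc z₀ z₁ ⊆ quadrant := fun p hp =>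
    ⟨hr.trans_le hp.1.1, hz.trans_le hp.2.1⟩
  have hB : IsCompact (Icc r₀ r₁ ×ˢ Icc z₀ z₁) := isCompact_Icc.prod isCompact_Icc
  have hcl := (hf.mono hBq).preimage_isClosed_of_isClosed hB.isClosed hT
  have : K = Icc r₀ r₁ ×ˢ Icc z₀ z₁ ∩ f ⁻¹' T := by
    ext p
    constructor
    · intro hp
      exact ⟨hbox hp, ((hK p (hBq (hbox hp))).1 hp).2⟩
    · rintro ⟨hp, hpT⟩
      exact (hK p (hBq hp)).2 ⟨hp.1, hpT⟩
  rw [this]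
  exact hB.of_isClosed_subset hcl inter_subset_left

lemma fderiv_fst_apply (p v : ℝ × ℝ) : fderiv ℝ (fun q : ℝ × ℝ => q.1) p v = v.1 := by
  rw [(hasFDerivAt_fst (𝕜 := ℝ) (p := p)).fderiv]; rfl

namespace StreamBounds

variable {D μ a a₁ θ β C : ℝ} {ψ : ℝ × ℝ → ℝ} {p : ℝ × ℝ}

/-- A lower bound for the ratio `F / Q`. -/
def ratio (D μ a₁ : ℝ) : ℝ := (μ - (D - 1) * a₁) / (μ + a₁)

lemma ratio_pos (h : StreamBounds D μ a a₁ θ β C ψ) : 0 < ratio D μ a₁ :=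
  div_pos (sub_pos.2 h.lt_mu) (add_pos h.mu_pos h.a1_pos)

lemma ratio_le_one (h : StreamBounds D μ a a₁ θ β C ψ) : ratio D μ a₁ ≤ 1 := by
  have := h.a1_pos; have := h.mu_pos; have := h.three_le
  rw [ratio, div_le_one (by positivity)]
  nlinarith

lemma strQ_pos (h : StreamBounds D μ a a₁ θ β C ψ) (hp : p ∈ quadrant) : 0 < strQ μ ψ p :=
  mul_pos (add_pos h.mu_pos (h.pos p hp)) hp.2

lemma strF_lt_strQ (h : StreamBounds D μ a a₁ θ β C ψ) (hp : p ∈ quadrant) :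
    strF D μ ψ p < strQ μ ψ p := by
  have := h.pos p hp; have := h.three_le
  exact mul_lt_mul_of_pos_right (by nlinarith) hp.2

lemma ratio_mul_le_strF (h : StreamBounds D μ a a₁ θ β C ψ) (hp : p ∈ quadrant) :
    ratio D μ a₁ * strQ μ ψ p ≤ strF D μ ψ p := by
  have h1 := h.le_a1 p hp; have h2 := h.three_le; have h3 := h.ratio_pos
  have h4 : ratio D μ a₁ * (μ + a₁) = μ - (D - 1) * a₁ :=
    div_mul_cancel₀ _ (add_pos h.mu_pos h.a1_pos).ne'
  rw [strQ, strF, ← mul_assoc]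
  refine mul_le_mul_of_nonneg_right ?_ hp.2.le
  have : ratio D μ a₁ * (μ + ψ p) ≤ ratio D μ a₁ * (μ + a₁) := by gcongr
  nlinarith

lemma strF_pos (h : StreamBounds D μ a a₁ θ β C ψ) (hp : p ∈ quadrant) : 0 < strF D μ ψ p :=
  (mul_pos h.ratio_pos (h.strQ_pos hp)).trans_le (h.ratio_mul_le_strF hp)

lemma strQ_le (h : StreamBounds D μ a a₁ θ β C ψ) (hp : p ∈ quadrant) :
    strQ μ ψ p ≤ (μ + a₁) * p.2 :=
  mul_le_mul_of_nonneg_right (by linarith [h.le_a1 p hp]) hp.2.le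

lemma mul_le_strQ (h : StreamBounds D μ a a₁ θ β C ψ) (hp : p ∈ quadrant) :
    μ * p.2 ≤ strQ μ ψ p :=
  mul_le_mul_of_nonneg_right (by linarith [h.pos p hp]) hp.2.le

lemma fst_le_one (hp : p ∈ quadrant) (hl : level μ ψ p ≤ 1) : p.1 ≤ 1 := by
  have := hp.1; unfold level at hl; nlinarith [sq_nonneg (strQ μ ψ p)]

lemma strQ_le_one (h : StreamBounds D μ a a₁ θ β C ψ) (hp : p ∈ quadrant)
    (hl : level μ ψ p ≤ 1) : strQ μ ψ p ≤ 1 := by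
  have := h.strQ_pos hp; unfold level at hl; nlinarith [sq_nonneg p.1]

lemma eventually_mem_quadrant (hp : p ∈ quadrant) (v : ℝ × ℝ) :
    ∀ᶠ s : ℝ in 𝓝[>] 0, p + s • v ∈ quadrant := by
  have : Tendsto (fun s : ℝ => p + s • v) (𝓝 0) (𝓝 p) :=
    Continuous.tendsto' (by fun_prop) _ _ (by simp)
  exact (this.eventually (quadrant_mem_nhds hp)).filter_mono nhdsWithin_le_nhds

/-- Since r and Q increase along the field, the region r ≥ ε, Q ≥ ε, r² + Q² ≤ 1 can be left only
through the initial curve. Taking ε from the given point makes it compact, and nothing about `X` at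
the axes is needed. -/
lemma le_of_flowDeriv_inner (h : StreamBounds D μ a a₁ θ β C ψ) {X Y : ℝ × ℝ → ℝ} {C₀ : ℝ}
    (hXY : FlowDeriv (flowField D μ ψ) X Y)
    (hΓ : ∀ p ∈ quadrant, level μ ψ p = 1 → X p ≤ C₀)
    (hpos : ∀ p ∈ quadrant, level μ ψ p ≤ 1 → C₀ < X p → 0 < Y p) :
    ∀ p ∈ quadrant, level μ ψ p ≤ 1 → X p ≤ C₀ := by
  intro p₀ hp₀ hl₀
  have hε : 0 < min p₀.1 (strQ μ ψ p₀) := lt_min hp₀.1 (h.strQ_pos hp₀)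
  set ε := min p₀.1 (strQ μ ψ p₀) with hεdef
  set K : Set (ℝ × ℝ) := {p | p ∈ quadrant ∧ ε ≤ p.1 ∧ ε ≤ strQ μ ψ p ∧ level μ ψ p ≤ 1} with hKdef
  have hμa : 0 < μ + a₁ := add_pos h.mu_pos h.a1_pos
  have hK : IsCompact K := by
    refine isCompact_of_subset_box (f := fun p => (strQ μ ψ p, level μ ψ p)) (T := Ici ε ×ˢ Iic 1)
      (r₀ := ε) (r₁ := 1) (z₀ := ε / (μ + a₁)) (z₁ := 1 / μ)
      (h.contDiffOn_strQ.continuousOn.prodMk h.contDiffOn_level.continuousOn)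
      (isClosed_Ici.prod isClosed_Iic) hε (div_pos hε hμa) ?_ ?_
    · rintro p ⟨hp, h1, h2, h3⟩
      refine ⟨⟨h1, fst_le_one hp h3⟩, ?_, ?_⟩
      · rw [div_le_iff₀ hμa, mul_comm]; exact h2.trans (h.strQ_le hp)
      · rw [le_div_iff₀ h.mu_pos, mul_comm]; exact (h.mul_le_strQ hp).trans (h.strQ_le_one hp h3)
    · intro p hp
      constructor
      · rintro ⟨-, h1, h2, h3⟩; exact ⟨⟨h1, fst_le_one hp h3⟩, h2, h3⟩
      · rintro ⟨h1, h2, h3⟩; exact ⟨hp, h1.1, h2, h3⟩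
  refine FlowDeriv.le_of_compact hK (fun p hp => hp.1) h.contDiffOn_level.continuousOn ?_ hXY
    (fun p hp hl => hΓ p hp.1 hl) (fun p hp => hpos p hp.1 hp.2.2.2) p₀
    ⟨hp₀, min_le_left _ _, min_le_right _ _, hl₀⟩
  rintro p ⟨hp, h1, h2, h3⟩ hne
  have e1 := eventually_le_of_fderiv_pos (v := flowField D μ ψ p) (f := fun q => q.1) (c := ε)
    differentiableAt_fst h1 (fun _ => by rw [fderiv_fst_apply]; exact hp.1)
  have e2 := eventually_le_of_fderiv_pos (v := flowField D μ ψ p) (f := strQ μ ψ) (c := ε)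
    (differentiableAt_of_mem h.contDiffOn_strQ hp) h2
    (fun _ => by rw [h.flow_strQ hp]; exact h.strF_pos hp)
  have e3 := eventually_le_of_fderiv_pos (v := flowField D μ ψ p) (f := fun q => -level μ ψ q)
    (c := -1) (differentiableAt_of_mem h.contDiffOn_level hp).neg (neg_le_neg h3)
    (fun he => absurd (neg_injective he) hne)
  filter_upwards [e1, e2, e3, eventually_mem_quadrant hp (flowField D μ ψ p)] with s s1 s2 s3 s4
  exact ⟨s4, s1, s2, neg_le_neg_iff.1 s3⟩

/-- The same argument for the reversed field, along which r and Q decrease. To stay off the axes the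
region is also bounded by Q ≥ ε r and Q^n ≤ c r, with equality at the given point. Backwards, Q / r
increases because F < Q, and Q^n / r decreases because n F > Q. -/
lemma le_of_flowDeriv_outer (h : StreamBounds D μ a a₁ θ β C ψ) {X Y : ℝ × ℝ → ℝ} {C₀ : ℝ}
    (hXY : FlowDeriv (flowField D μ ψ) X Y)
    (hΓ : ∀ p ∈ quadrant, level μ ψ p = 1 → X p ≤ C₀)
    (hneg : ∀ p ∈ quadrant, 1 ≤ level μ ψ p → C₀ < X p → Y p < 0) :
    ∀ p ∈ quadrant, 1 ≤ level μ ψ p → X p ≤ C₀ := by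
  intro p₀ hp₀ hl₀
  have hr := hp₀.1
  have hQ := h.strQ_pos hp₀
  have hq := h.ratio_pos
  -- As F ≥ `ratio` · Q, this choice of n gives n F > Q.
  obtain ⟨n, hn⟩ := exists_nat_gt (1 / ratio D μ a₁)
  have hn' : 1 < n * ratio D μ a₁ := (div_lt_iff₀ hq).1 hn
  set R := p₀.1 + strQ μ ψ p₀ with hR
  set ε := strQ μ ψ p₀ / p₀.1 with hε
  set c := strQ μ ψ p₀ ^ n / p₀.1 with hc
  have hε0 : 0 < ε := by positivity
  have hc0 : 0 < c := by positivity
  set K : Set (ℝ × ℝ) := {p | p ∈ quadrant ∧ 1 ≤ level μ ψ p ∧ p.1 ≤ R ∧ strQ μ ψ p ≤ R ∧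
    0 ≤ strQ μ ψ p - ε * p.1 ∧ 0 ≤ c * p.1 - strQ μ ψ p ^ n} with hKdef
  have hμa : 0 < μ + a₁ := add_pos h.mu_pos h.a1_pos
  -- Outside the curve, r < 1/2 forces Q ≥ 1/2, and then Q^n ≤ c r keeps r away from 0.
  have hlow : ∀ p ∈ K, min (1 / 2) ((1 / 2) ^ n / c) ≤ p.1 := by
    rintro p ⟨hp, h1, -, -, -, h5⟩
    rcases le_or_gt (1 / 2) p.1 with h6 | h6
    · exact (min_le_left _ _).trans h6
    · refine (min_le_right _ _).trans ?_
      rw [div_le_iff₀ hc0]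
      have hQ2 : 1 / 2 ≤ strQ μ ψ p := by
        have := h.strQ_pos hp; have := hp.1
        unfold level at h1
        nlinarith
      have : (1 / 2 : ℝ) ^ n ≤ strQ μ ψ p ^ n := by gcongr
      linarith
  set r₀ := min (1 / 2 : ℝ) ((1 / 2) ^ n / c) with hr₀
  have hr₀0 : 0 < r₀ := lt_min (by norm_num) (by positivity)
  have hK : IsCompact K := by
    refine isCompact_of_subset_box (f := fun p => (strQ μ ψ p, p.1)) (T :=
      {y | 1 ≤ y.2 ^ 2 + y.1 ^ 2 ∧ y.2 ≤ R ∧ y.1 ≤ R ∧ 0 ≤ y.1 - ε * y.2 ∧ 0 ≤ c * y.2 - y.1 ^ n ∧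
        r₀ ≤ y.2})
      (r₀ := r₀) (r₁ := R) (z₀ := ε * r₀ / (μ + a₁)) (z₁ := R / μ)
      (h.contDiffOn_strQ.continuousOn.prodMk continuous_fst.continuousOn)
      ?_ hr₀0 (div_pos (mul_pos hε0 hr₀0) hμa) ?_ ?_
    · simp only [ofPred_and]
      refine IsClosed.inter ?_ (IsClosed.inter ?_ (IsClosed.inter ?_ (IsClosed.inter ?_
        (IsClosed.inter ?_ ?_)))) <;> exact isClosed_le (by fun_prop) (by fun_prop)
    · intro p hpK
      have h0 := hlow p hpK
      obtain ⟨hp, h1, h2, h3, h4, h5⟩ := hpK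
      refine ⟨⟨h0, h2⟩, ?_, ?_⟩
      · rw [div_le_iff₀ hμa, mul_comm p.2]
        have : ε * r₀ ≤ ε * p.1 := by gcongr
        linarith [h.strQ_le hp]
      · rw [le_div_iff₀ h.mu_pos, mul_comm]; exact (h.mul_le_strQ hp).trans h3
    · intro p hp
      constructor
      · intro hpK
        have h0 := hlow p hpK
        obtain ⟨-, h1, h2, h3, h4, h5⟩ := hpK
        exact ⟨⟨h0, h2⟩, h1, h2, h3, h4, h5, h0⟩
      · rintro ⟨-, h1, h2, h3, h4, h5, -⟩; exact ⟨hp, h1, h2, h3, h4, h5⟩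
  refine FlowDeriv.le_of_compact hK (fun p hp => hp.1) h.contDiffOn_level.continuousOn ?_
    hXY.neg_field
    (fun p hp hl => hΓ p hp.1 hl) (fun p hp hX => neg_pos.2 (hneg p hp.1 hp.2.1 hX)) p₀
    ⟨hp₀, hl₀, by linarith, by linarith, ?_, ?_⟩
  · rintro p ⟨hp, h1, h2, h3, h4, h5⟩ hne
    have hF := h.strF_pos hp
    have hQp := h.strQ_pos hp
    have dQ := differentiableAt_of_mem h.contDiffOn_strQ hp
    have e1 := eventually_le_of_fderiv_pos (v := -flowField D μ ψ p) (f := level μ ψ)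
      (c := 1) (differentiableAt_of_mem h.contDiffOn_level hp) h1 (fun he => absurd he hne)
    have e2 := eventually_le_of_fderiv_pos (v := -flowField D μ ψ p) (f := fun q => -q.1) (c := -R)
      differentiableAt_fst.neg (neg_le_neg h2) (fun _ => by
        rw [fderiv_fun_neg, _root_.neg_apply, fderiv_fst_apply]; simpa [flowField] using hp.1)
    have e3 := eventually_le_of_fderiv_pos (v := -flowField D μ ψ p) (f := fun q => -strQ μ ψ q)
      (c := -R) dQ.neg (neg_le_neg h3) (fun _ => by
        rw [fderiv_fun_neg]; simpa [h.flow_strQ hp] using hF)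
    have e4 := eventually_le_of_fderiv_pos (v := -flowField D μ ψ p)
      (f := fun q => strQ μ ψ q - ε * q.1) (c := 0) (dQ.sub (differentiableAt_fst.const_mul ε)) h4
      (fun he => by
        rw [fderiv_fun_sub dQ (differentiableAt_fst.const_mul ε),
          fderiv_const_mul differentiableAt_fst]
        have := h.strF_lt_strQ hp
        simp only [map_neg, _root_.sub_apply, h.flow_strQ hp, _root_.smul_apply,
          fderiv_fst_apply, smul_eq_mul]
        simp only [flowField]
        linarith)
    have e5 := eventually_le_of_fderiv_pos (v := -flowField D μ ψ p)
      (f := fun q => c * q.1 - strQ μ ψ q ^ n) (c := 0)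
      ((differentiableAt_fst.const_mul c).sub (dQ.pow n)) h5
      (fun he => by
        have hn0 : n ≠ 0 := by rintro rfl; simp at hn'; linarith
        obtain ⟨m, rfl⟩ := Nat.exists_eq_succ_of_ne_zero hn0
        have hd := (((hasFDerivAt_fst (𝕜 := ℝ) (p := p)).const_mul c).sub
          (dQ.hasFDerivAt.pow (m + 1))).fderiv
        have hd' : fderiv ℝ (fun q => c * q.1 - strQ μ ψ q ^ (m + 1)) p = _ := hd
        rw [hd']
        simp only [map_neg, _root_.sub_apply, h.flow_strQ hp, _root_.smul_apply,
          ContinuousLinearMap.coe_fst', smul_eq_mul, add_tsub_cancel_right]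
        simp only [flowField]
        have h7 : strQ μ ψ p < ((m + 1 : ℕ) : ℝ) * strF D μ ψ p := by
          have := h.ratio_mul_le_strF hp
          calc strQ μ ψ p = 1 * strQ μ ψ p := (one_mul _).symm
            _ < ((m + 1 : ℕ) : ℝ) * ratio D μ a₁ * strQ μ ψ p := by gcongr
            _ = ((m + 1 : ℕ) : ℝ) * (ratio D μ a₁ * strQ μ ψ p) := by ring
            _ ≤ _ := by gcongr
        have h8 : 0 < strQ μ ψ p ^ m := by positivity
        have h9 := mul_lt_mul_of_pos_left h7 h8
        have h10 : c * p.1 = strQ μ ψ p ^ m * strQ μ ψ p := by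
          rw [← pow_succ]; exact sub_eq_zero.1 he
        simp only [nsmul_eq_mul] at *
        nlinarith)
    filter_upwards [e1, e2, e3, e4, e5, eventually_mem_quadrant hp (-flowField D μ ψ p)]
      with s s1 s2 s3 s4 s5 s6
    exact ⟨s6, s1, neg_le_neg_iff.1 s2, neg_le_neg_iff.1 s3, s4, s5⟩
  · rw [hε]; field_simp; simp
  · rw [hc]; field_simp; simp

end StreamBounds

/-! ### Weighted bounds on either side of the initial curve -/

namespace StreamBounds

variable {D μ a a₁ θ β C : ℝ} {ψ : ℝ × ℝ → ℝ} {p : ℝ × ℝ}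

lemma contDiffOn_fst_rpow (n : ℝ) : ContDiffOn ℝ 1 (fun p : ℝ × ℝ => p.1 ^ n) quadrant :=
  contDiff_fst.contDiffOn.rpow_const_of_ne fun _ hp => hp.1.ne'

lemma hasFDerivAt_fst_rpow (hp : p ∈ quadrant) (n : ℝ) :
    HasFDerivAt (fun q : ℝ × ℝ => q.1 ^ n) ((n * p.1 ^ (n - 1)) • ContinuousLinearMap.fst ℝ ℝ ℝ) p :=
  (hasFDerivAt_fst (𝕜 := ℝ) (p := p)).rpow_const (Or.inl hp.1.ne')

lemma rpow_sub_one_mul {x : ℝ} (hx : 0 < x) (n : ℝ) : x ^ (n - 1) * x = x ^ n := by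
  rw [Real.rpow_sub_one hx.ne', div_mul_cancel₀ _ hx.ne']

/-- The weight used inside the initial curve. -/
def innerWeight (μ θ n N : ℝ) (ψ : ℝ × ℝ → ℝ) (p : ℝ × ℝ) : ℝ :=
  p.1 ^ n * Real.exp (N * (p.1 ^ (1 - θ) + strQ μ ψ p))

lemma contDiffOn_innerWeight (h : StreamBounds D μ a a₁ θ β C ψ) (n N : ℝ) :
    ContDiffOn ℝ 1 (innerWeight μ θ n N ψ) quadrant :=
  (contDiffOn_fst_rpow n).mul
    (contDiffOn_const.mul ((contDiffOn_fst_rpow (1 - θ)).add h.contDiffOn_strQ)).exp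

lemma flow_innerWeight (h : StreamBounds D μ a a₁ θ β C ψ) (hp : p ∈ quadrant) (n N : ℝ) :
    fderiv ℝ (innerWeight μ θ n N ψ) p (flowField D μ ψ p)
      = innerWeight μ θ n N ψ p * (n + N * ((1 - θ) * p.1 ^ (1 - θ) + strF D μ ψ p)) := by
  have h1 := (hasFDerivAt_fst_rpow hp n).mul ((((hasFDerivAt_fst_rpow hp (1 - θ)).add
    (differentiableAt_of_mem h.contDiffOn_strQ hp).hasFDerivAt).const_mul N).exp)
  have h2 : fderiv ℝ (innerWeight μ θ n N ψ) p = _ := h1.fderiv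
  rw [h2, innerWeight, ← rpow_sub_one_mul hp.1 n, ← rpow_sub_one_mul hp.1 (1 - θ)]
  simp only [_root_.add_apply, _root_.smul_apply, h.flow_strQ hp, ContinuousLinearMap.coe_fst',
    smul_eq_mul, Pi.add_apply]
  rw [← rpow_sub_one_mul hp.1 (1 - θ)]
  simp only [flowField]
  ring

/-- Propagation of bounds from the initial curve towards the origin. -/
lemma inner_bound (h : StreamBounds D μ a a₁ θ β C ψ) {X c s : ℝ × ℝ → ℝ}
    (hX : FlowDeriv (flowField D μ ψ) X (fun p => -(c p * X p) + s p)) {n C₁ C₂ C₃ : ℝ}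
    (hC₁ : 0 ≤ C₁) (hC₂ : 0 ≤ C₂)
    (hc : ∀ p ∈ quadrant, level μ ψ p ≤ 1 → c p ≤ n + C₁ * (p.1 ^ (1 - θ) + strQ μ ψ p))
    (hs : ∀ p ∈ quadrant, level μ ψ p ≤ 1 →
      p.1 ^ n * |s p| ≤ C₂ * (p.1 ^ (1 - θ) + strQ μ ψ p))
    (hΓ : ∀ p ∈ quadrant, level μ ψ p = 1 → p.1 ^ n * |X p| ≤ C₃) :
    ∃ B, ∀ p ∈ quadrant, level μ ψ p ≤ 1 → p.1 ^ n * |X p| ≤ B := by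
  have hθ := h.theta_lt
  have hq := h.ratio_pos
  -- The quantity σ = r^{1-θ} + Q grows along the field at a rate of at least c₀ σ. In N c₀ = C₁ +
  -- C₂ + 1 the first term pays for the error in the damping, the second for the source, and the
  -- third makes the sign strict.
  set c₀ := min (1 - θ) (ratio D μ a₁) with hc₀
  have hc₀0 : 0 < c₀ := lt_min (by linarith) hq
  set N := (C₁ + C₂ + 1) / c₀ with hN
  have hN0 : 0 < N := by positivity
  have hNc : N * c₀ = C₁ + C₂ + 1 := div_mul_cancel₀ _ hc₀0.ne'
  set W := innerWeight μ θ n N ψ with hW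
  have hσ0 : ∀ p ∈ quadrant, 0 < p.1 ^ (1 - θ) + strQ μ ψ p := fun p hp =>
    add_pos (Real.rpow_pos_of_pos hp.1 _) (h.strQ_pos hp)
  have hσ2 : ∀ p ∈ quadrant, level μ ψ p ≤ 1 → p.1 ^ (1 - θ) + strQ μ ψ p ≤ 2 := fun p hp hl => by
    have := Real.rpow_le_one hp.1.le (fst_le_one hp hl) (by linarith : 0 ≤ 1 - θ)
    linarith [h.strQ_le_one hp hl]
  have hWle : ∀ p ∈ quadrant, level μ ψ p ≤ 1 → W p ≤ p.1 ^ n * Real.exp (N * 2) := fun p hp hl =>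
    mul_le_mul_of_nonneg_left (Real.exp_le_exp.2 (mul_le_mul_of_nonneg_left (hσ2 p hp hl) hN0.le))
      (Real.rpow_nonneg hp.1.le _)
  have hleW : ∀ p ∈ quadrant, p.1 ^ n ≤ W p := fun p hp =>
    le_mul_of_one_le_right (Real.rpow_nonneg hp.1.le _)
      (Real.one_le_exp (mul_pos hN0 (hσ0 p hp)).le)
  have hw := h.contDiffOn_flowField.continuousOn
  -- The second entry is a floor: where W X exceeds it, the gain (C₂ + 1) σ W X beats the weighted
  -- source, which is at most C₂ σ exp(2N).
  set B := max (|C₃| * Real.exp (N * 2)) (Real.exp (N * 2)) with hB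
  -- Phrased for a generic pair so that it applies to both (X, s) and (-X, -s).
  have key : ∀ X' s' : ℝ × ℝ → ℝ,
      FlowDeriv (flowField D μ ψ) X' (fun p => -(c p * X' p) + s' p) →
      (∀ p, |X' p| = |X p|) → (∀ p, |s' p| = |s p|) →
      ∀ p ∈ quadrant, level μ ψ p ≤ 1 → W p * X' p ≤ B := by
    intro X' s' hX' hXX hss
    refine h.le_of_flowDeriv_inner (hX'.mul_left hw (h.contDiffOn_innerWeight n N)) ?_ ?_
    · intro p hp hl
      calc W p * X' p ≤ W p * |X p| := by
            rw [← hXX]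
            exact mul_le_mul_of_nonneg_left (le_abs_self _)
              ((Real.rpow_nonneg hp.1.le _).trans (hleW p hp))
        _ ≤ p.1 ^ n * Real.exp (N * 2) * |X p| := by gcongr; exact hWle p hp hl.le
        _ = (p.1 ^ n * |X p|) * Real.exp (N * 2) := by ring
        _ ≤ |C₃| * Real.exp (N * 2) := by gcongr; exact (hΓ p hp hl).trans (le_abs_self _)
        _ ≤ B := le_max_left _ _
    · intro p hp hl hBX
      have hflow : fderiv ℝ W p (flowField D μ ψ p) = W p * _ := h.flow_innerWeight hp n N
      change 0 < W p * (-(c p * X' p) + s' p) + X' p * fderiv ℝ W p (flowField D μ ψ p)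
      rw [hflow]
      change B < W p * X' p at hBX
      set σ := p.1 ^ (1 - θ) + strQ μ ψ p with hσ
      have hσp := hσ0 p hp
      have hE := Real.exp_pos (N * 2)
      have hB0 : Real.exp (N * 2) ≤ B := le_max_right _ _
      have hWX : 0 < W p * X' p := hE.trans_le (hB0.trans hBX.le)
      have h1 : c₀ * σ ≤ (1 - θ) * p.1 ^ (1 - θ) + strF D μ ψ p := by
        have h2 : c₀ * p.1 ^ (1 - θ) ≤ (1 - θ) * p.1 ^ (1 - θ) :=
          mul_le_mul_of_nonneg_right (min_le_left _ _) (Real.rpow_nonneg hp.1.le _)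
        have h3 : c₀ * strQ μ ψ p ≤ ratio D μ a₁ * strQ μ ψ p :=
          mul_le_mul_of_nonneg_right (min_le_right _ _) (h.strQ_pos hp).le
        have := h.ratio_mul_le_strF hp
        rw [hσ]; linarith
      have h4 : (C₂ + 1) * σ ≤ n - c p + N * ((1 - θ) * p.1 ^ (1 - θ) + strF D μ ψ p) := by
        have h5 := mul_le_mul_of_nonneg_left h1 hN0.le
        rw [← mul_assoc, hNc] at h5
        have := hc p hp hl
        linarith
      have h6 : W p * |s' p| ≤ C₂ * σ * Real.exp (N * 2) := by
        calc W p * |s' p| ≤ p.1 ^ n * Real.exp (N * 2) * |s p| := by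
              rw [hss]; gcongr; exact hWle p hp hl
          _ = (p.1 ^ n * |s p|) * Real.exp (N * 2) := by ring
          _ ≤ _ := mul_le_mul_of_nonneg_right (hs p hp hl) hE.le
      have h7 : -(W p * |s' p|) ≤ W p * s' p := by
        have := mul_le_mul_of_nonneg_left (neg_abs_le (s' p))
          ((Real.rpow_nonneg hp.1.le _).trans (hleW p hp))
        linarith
      have h8 : (C₂ + 1) * σ * Real.exp (N * 2)
          ≤ (W p * X' p) * (n - c p + N * ((1 - θ) * p.1 ^ (1 - θ) + strF D μ ψ p)) := by
        rw [mul_comm (W p * X' p)]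
        exact mul_le_mul h4 (hB0.trans hBX.le) hE.le ((by positivity : 0 ≤ (C₂ + 1) * σ).trans h4)
      have h9 : 0 < σ * Real.exp (N * 2) := mul_pos hσp hE
      nlinarith
  refine ⟨B, fun p hp hl => ?_⟩
  have k1 := key X s hX (fun _ => rfl) (fun _ => rfl) p hp hl
  have k2 := key (fun p => -X p) (fun p => -s p)
    ((hX.neg hw).congr (fun _ _ => rfl) fun p _ => by ring) (fun _ => abs_neg _)
    (fun _ => abs_neg _) p hp hl
  have : W p * |X p| ≤ B := by
    rcases abs_cases (X p) with hx | hx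
    · rw [hx.1]; exact k1
    · rw [hx.1]; exact k2
  exact (mul_le_mul_of_nonneg_right (hleW p hp) (abs_nonneg _)).trans this

lemma level_pos (h : StreamBounds D μ a a₁ θ β C ψ) (hp : p ∈ quadrant) : 0 < level μ ψ p :=
  add_pos (pow_pos hp.1 2) (pow_pos (h.strQ_pos hp) 2)

/-- The weight used outside the initial curve. -/
def outerWeight (μ β n N : ℝ) (ψ : ℝ × ℝ → ℝ) (p : ℝ × ℝ) : ℝ :=
  p.1 ^ n * Real.exp (N * level μ ψ p ^ (-β / 2))

lemma contDiffOn_outerWeight (h : StreamBounds D μ a a₁ θ β C ψ) (n N : ℝ) :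
    ContDiffOn ℝ 1 (outerWeight μ β n N ψ) quadrant :=
  (contDiffOn_fst_rpow n).mul
    (contDiffOn_const.mul
      (h.contDiffOn_level.rpow_const_of_ne fun _ hp => (h.level_pos hp).ne')).exp

lemma flow_outerWeight (h : StreamBounds D μ a a₁ θ β C ψ) (hp : p ∈ quadrant) (n N : ℝ) :
    fderiv ℝ (outerWeight μ β n N ψ) p (flowField D μ ψ p)
      = outerWeight μ β n N ψ p * (n - N * β * (level μ ψ p ^ (-β / 2 - 1)
          * (p.1 ^ 2 + strQ μ ψ p * strF D μ ψ p))) := by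
  have h1 := (hasFDerivAt_fst_rpow hp n).mul
    ((((differentiableAt_of_mem h.contDiffOn_level hp).hasFDerivAt.rpow_const
      (Or.inl (h.level_pos hp).ne') (p := -β / 2)).const_mul N).exp)
  have h2 : fderiv ℝ (outerWeight μ β n N ψ) p = _ := h1.fderiv
  rw [h2, outerWeight]
  simp only [_root_.add_apply, _root_.smul_apply, h.flow_level hp, h.flow_strQ hp,
    ContinuousLinearMap.coe_fst', smul_eq_mul]
  rw [← rpow_sub_one_mul hp.1 n]
  simp only [flowField]
  ring

/-- Propagation of bounds from the initial curve towards infinity. -/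
lemma outer_bound (h : StreamBounds D μ a a₁ θ β C ψ) {X c s : ℝ × ℝ → ℝ}
    (hX : FlowDeriv (flowField D μ ψ) X (fun p => -(c p * X p) + s p)) {n C₁ C₂ C₃ : ℝ}
    (hC₁ : 0 ≤ C₁)
    (hc : ∀ p ∈ quadrant, 1 ≤ level μ ψ p → n + β - C₁ * ψ p ≤ c p)
    (hs : ∀ p ∈ quadrant, 1 ≤ level μ ψ p → p.1 ^ n * |s p| ≤ C₂)
    (hΓ : ∀ p ∈ quadrant, level μ ψ p = 1 → p.1 ^ n * |X p| ≤ C₃) :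
    ∃ B, ∀ p ∈ quadrant, 1 ≤ level μ ψ p → p.1 ^ n * |X p| ≤ B := by
  have hβ := h.beta_pos
  have hq := h.ratio_pos
  have hC := h.C_nonneg
  -- The exponent N (r² + Q²)^{-β/2} decreases along the field at a rate of at least N β `ratio` (r²
  -- + Q²)^{-β/2}. With this N that covers C₁ ψ, by the decay of ψ.
  set N := C₁ * C / (β * ratio D μ a₁) with hN
  have hN0 : 0 ≤ N := by positivity
  have hNc : N * β * ratio D μ a₁ = C₁ * C := by rw [hN]; field_simp
  set W := outerWeight μ β n N ψ with hW
  have hL1 : ∀ p ∈ quadrant, 1 ≤ level μ ψ p → level μ ψ p ^ (-β / 2) ≤ 1 := fun p hp hl =>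
    Real.rpow_le_one_of_one_le_of_nonpos hl (by linarith)
  have hL0 : ∀ p ∈ quadrant, 0 < level μ ψ p ^ (-β / 2) := fun p hp =>
    Real.rpow_pos_of_pos (h.level_pos hp) _
  have hWle : ∀ p ∈ quadrant, 1 ≤ level μ ψ p → W p ≤ p.1 ^ n * Real.exp N := fun p hp hl =>
    mul_le_mul_of_nonneg_left (Real.exp_le_exp.2
      (mul_le_of_le_one_right hN0 (hL1 p hp hl))) (Real.rpow_nonneg hp.1.le _)
  have hleW : ∀ p ∈ quadrant, p.1 ^ n ≤ W p := fun p hp =>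
    le_mul_of_one_le_right (Real.rpow_nonneg hp.1.le _)
      (Real.one_le_exp (mul_nonneg hN0 (hL0 p hp).le))
  have hw := h.contDiffOn_flowField.continuousOn
  -- Above the second entry the spare damping β outweighs the weighted source, which is at most C₂
  -- exp N.
  set B := max (|C₃| * Real.exp N) (C₂ * Real.exp N / β) with hB
  have hB' : 0 ≤ B := le_max_of_le_left (by positivity)
  have key : ∀ X' s' : ℝ × ℝ → ℝ,
      FlowDeriv (flowField D μ ψ) X' (fun p => -(c p * X' p) + s' p) →
      (∀ p, |X' p| = |X p|) → (∀ p, |s' p| = |s p|) →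
      ∀ p ∈ quadrant, 1 ≤ level μ ψ p → W p * X' p ≤ B := by
    intro X' s' hX' hXX hss
    refine h.le_of_flowDeriv_outer (hX'.mul_left hw (h.contDiffOn_outerWeight n N)) ?_ ?_
    · intro p hp hl
      calc W p * X' p ≤ W p * |X p| := by
            rw [← hXX]
            exact mul_le_mul_of_nonneg_left (le_abs_self _)
              ((Real.rpow_nonneg hp.1.le _).trans (hleW p hp))
        _ ≤ p.1 ^ n * Real.exp N * |X p| := by gcongr; exact hWle p hp hl.ge
        _ = (p.1 ^ n * |X p|) * Real.exp N := by ring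
        _ ≤ |C₃| * Real.exp N := by gcongr; exact (hΓ p hp hl).trans (le_abs_self _)
        _ ≤ B := le_max_left _ _
    · intro p hp hl hBX
      have hflow : fderiv ℝ W p (flowField D μ ψ p) = W p * _ := h.flow_outerWeight hp n N
      change W p * (-(c p * X' p) + s' p) + X' p * fderiv ℝ W p (flowField D μ ψ p) < 0
      rw [hflow]
      change B < W p * X' p at hBX
      have hWX : 0 < W p * X' p := hB'.trans_lt hBX
      have hlp := h.level_pos hp
      have h1 : ratio D μ a₁ * level μ ψ p ≤ p.1 ^ 2 + strQ μ ψ p * strF D μ ψ p := by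
        have h2 := mul_le_mul_of_nonneg_left (h.ratio_mul_le_strF hp) (h.strQ_pos hp).le
        have h3 := mul_le_mul_of_nonneg_right h.ratio_le_one (sq_nonneg p.1)
        unfold level; nlinarith
      have h4 : ratio D μ a₁ * level μ ψ p ^ (-β / 2)
          ≤ level μ ψ p ^ (-β / 2 - 1) * (p.1 ^ 2 + strQ μ ψ p * strF D μ ψ p) := by
        rw [← rpow_sub_one_mul hlp (-β / 2)]
        have := mul_le_mul_of_nonneg_left h1 (Real.rpow_pos_of_pos hlp (-β / 2 - 1)).le
        linarith
      have h5 : C₁ * ψ p ≤ N * β * (level μ ψ p ^ (-β / 2 - 1)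
          * (p.1 ^ 2 + strQ μ ψ p * strF D μ ψ p)) := by
        have h6 := mul_le_mul_of_nonneg_left h4 (mul_nonneg hN0 hβ.le)
        rw [← mul_assoc, hNc] at h6
        have h7 := mul_le_mul_of_nonneg_left (h.decay p hp hl) hC₁
        change C₁ * ψ p ≤ C₁ * (C * level μ ψ p ^ (-β / 2)) at h7
        linarith
      have h6 : W p * |s' p| ≤ C₂ * Real.exp N := by
        calc W p * |s' p| ≤ p.1 ^ n * Real.exp N * |s p| := by
              rw [hss]; gcongr; exact hWle p hp hl
          _ = (p.1 ^ n * |s p|) * Real.exp N := by ring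
          _ ≤ _ := mul_le_mul_of_nonneg_right (hs p hp hl) (Real.exp_pos N).le
      have h7 : W p * s' p ≤ W p * |s' p| :=
        mul_le_mul_of_nonneg_left (le_abs_self _)
          ((Real.rpow_nonneg hp.1.le _).trans (hleW p hp))
      have h8 : C₂ * Real.exp N < β * (W p * X' p) := by
        have := (div_le_iff₀ hβ).1 (le_max_right (|C₃| * Real.exp N) (C₂ * Real.exp N / β))
        nlinarith
      have h9 : (W p * X' p) * (n - c p - N * β * (level μ ψ p ^ (-β / 2 - 1)
          * (p.1 ^ 2 + strQ μ ψ p * strF D μ ψ p))) ≤ (W p * X' p) * (-β) :=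
        mul_le_mul_of_nonneg_left (by linarith [hc p hp hl]) hWX.le
      nlinarith
  refine ⟨B, fun p hp hl => ?_⟩
  have k1 := key X s hX (fun _ => rfl) (fun _ => rfl) p hp hl
  have k2 := key (fun p => -X p) (fun p => -s p)
    ((hX.neg hw).congr (fun _ _ => rfl) fun p _ => by ring) (fun _ => abs_neg _)
    (fun _ => abs_neg _) p hp hl
  have : W p * |X p| ≤ B := by
    rcases abs_cases (X p) with hx | hx
    · rw [hx.1]; exact k1
    · rw [hx.1]; exact k2
  exact (mul_le_mul_of_nonneg_right (hleW p hp) (abs_nonneg _)).trans this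

end StreamBounds

/-! ### Coefficient bounds and transport estimates for the gradient -/

namespace StreamBounds

variable {D μ a a₁ θ β C : ℝ} {ψ Om : ℝ × ℝ → ℝ} {p : ℝ × ℝ}

lemma strg_le (h : StreamBounds D μ a a₁ θ β C ψ) (hp : p ∈ quadrant) : strg μ ψ p ≤ 1 / μ := by
  rw [strg, ← one_div]
  exact one_div_le_one_div_of_le h.mu_pos (h.mu_le_strA hp)

/-- Used outside the curve: the damping reaches 1/μ up to a multiple of ψ, the form of error that
`outer_bound` accepts. -/
lemma le_strg (h : StreamBounds D μ a a₁ θ β C ψ) (hp : p ∈ quadrant) :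
    1 / μ - 2 / μ ^ 2 * ψ p ≤ strg μ ψ p := by
  have hA := h.strA_pos hp
  have h1 := h.strA_le hp
  have h2 := h.pos p hp
  have hμ := h.mu_pos
  have e : strg μ ψ p - (1 / μ - 2 / μ ^ 2 * ψ p)
      = (μ ^ 2 - strA μ ψ p * (μ - 2 * ψ p)) / (strA μ ψ p * μ ^ 2) := by
    rw [strg]; field_simp
  have : 0 ≤ (μ ^ 2 - strA μ ψ p * (μ - 2 * ψ p)) / (strA μ ψ p * μ ^ 2) := by
    apply div_nonneg _ (by positivity)
    have h3 := h.mu_le_strA hp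
    have := mul_le_mul_of_nonneg_right h3 h2.le
    nlinarith
  linarith

/-- This produces the exponent 1/(μ + a). By the gradient bounds on ψ, A falls short of its value μ
+ a at the origin by at most a₁ (r + 2z), and r + 2z is controlled by r^{1-θ} + Q inside the curve.
-/
lemma strg_le_inner (h : StreamBounds D μ a a₁ θ β C ψ) (hp : p ∈ quadrant)
    (hl : level μ ψ p ≤ 1) :
    strg μ ψ p ≤ 1 / (μ + a)
      + a₁ * (1 + 2 / μ) / (μ * (μ + a)) * (p.1 ^ (1 - θ) + strQ μ ψ p) := by
  have hA := h.strA_pos hp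
  have hμ := h.mu_pos
  have ha := h.a_pos
  have ha₁ := h.a1_pos
  have h1 := (abs_le.1 (h.sub_a_le p hp)).1
  have h2 : -(a₁ * p.2) ≤ p.2 * pz ψ p := by
    have := mul_le_mul_of_nonneg_left (abs_le.1 (h.pz_le p hp)).1 hp.2.le
    linarith
  have h3 : p.1 ≤ p.1 ^ (1 - θ) := by
    have := Real.rpow_le_rpow_of_exponent_ge hp.1 (fst_le_one hp hl)
      (by linarith [h.theta_pos] : 1 - θ ≤ 1)
    rwa [Real.rpow_one] at this
  have h4 : p.2 ≤ strQ μ ψ p / μ := by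
    rw [le_div_iff₀ hμ, mul_comm]; exact h.mul_le_strQ hp
  set σ := p.1 ^ (1 - θ) + strQ μ ψ p with hσ
  have hQ := h.strQ_pos hp
  have h5 : μ + a - strA μ ψ p ≤ a₁ * (1 + 2 / μ) * σ := by
    have h6 : μ + a - strA μ ψ p ≤ a₁ * (p.1 + 2 * p.2) := by unfold strA; linarith
    refine h6.trans ?_
    rw [mul_assoc]
    refine mul_le_mul_of_nonneg_left ?_ ha₁.le
    have h7 : (1 + 2 / μ) * σ = p.1 ^ (1 - θ) + strQ μ ψ p + 2 / μ * p.1 ^ (1 - θ)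
        + 2 * (strQ μ ψ p / μ) := by rw [hσ]; ring
    have h8 : 0 ≤ 2 / μ * p.1 ^ (1 - θ) := by have := hp.1; positivity
    linarith
  have e : strg μ ψ p - 1 / (μ + a) = (μ + a - strA μ ψ p) / (strA μ ψ p * (μ + a)) := by
    rw [strg]; field_simp
  have h9 : (μ + a - strA μ ψ p) / (strA μ ψ p * (μ + a)) ≤
      a₁ * (1 + 2 / μ) * σ / (μ * (μ + a)) := by
    have hσ0 : 0 ≤ σ := add_nonneg (Real.rpow_nonneg hp.1.le _) hQ.le
    refine (div_le_div_of_nonneg_right h5 (by positivity)).trans ?_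
    exact div_le_div_of_nonneg_left (by positivity) (by positivity)
      (mul_le_mul_of_nonneg_right (h.mu_le_strA hp) (by positivity))
  rw [mul_div_right_comm] at h9
  linarith

/-- The left side is ∂_Q F, the extra damping of ∂_Q Ω compared with Ω; being at most 1, it costs at
most one power of r near the origin. -/
lemma strg_mul_pz_strF_le (h : StreamBounds D μ a a₁ θ β C ψ) (hp : p ∈ quadrant) :
    strg μ ψ p * pz (strF D μ ψ) p ≤ 1 := by
  have h2 : pz (strF D μ ψ) p ≤ strA μ ψ p := by
    rw [h.pz_strF hp]
    have h1 := (abs_le.1 (h.z_pz_le p hp)).1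
    have := h.pos p hp
    have := h.three_le
    unfold strA
    nlinarith
  exact (mul_le_mul_of_nonneg_left h2 (h.strg_pos hp).le).trans_eq (h.strg_mul_strA hp)

/-- Outside the curve the extra damping may be negative, but only by a multiple of ψ. -/
lemma le_strg_mul_pz_strF (h : StreamBounds D μ a a₁ θ β C ψ) (hp : p ∈ quadrant) :
    -(2 * D / μ * ψ p) ≤ strg μ ψ p * pz (strF D μ ψ) p := by
  have h1 := (abs_le.1 (h.z_pz_le p hp)).2
  have h2 := h.pos p hp
  have h3 := h.three_le
  have hμ := h.mu_pos
  have hg := h.strg_pos hp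
  have h4 : -(2 * D * ψ p) ≤ pz (strF D μ ψ) p := by
    rw [h.pz_strF hp]; nlinarith
  have h5 : strg μ ψ p * (2 * D * ψ p) ≤ 1 / μ * (2 * D * ψ p) := by
    have := h.strg_le hp
    gcongr
  have h6 := mul_le_mul_of_nonneg_left h4 hg.le
  have : 1 / μ * (2 * D * ψ p) = 2 * D / μ * ψ p := by ring
  linarith

lemma abs_strH_le (h : StreamBounds D μ a a₁ θ β C ψ) (hp : p ∈ quadrant) : |strH ψ p| ≤ a₁ := by
  have := h.z_pr_le p hp; have := h.le_a1 p hp; have := h.a1_pos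
  unfold strH; linarith

/-- The factor Q makes H ∂_Q Ω an admissible source in `inner_bound`, where sources must be
O(r^{1-θ} + Q) after weighting. -/
lemma abs_strH_le_mul (h : StreamBounds D μ a a₁ θ β C ψ) (hp : p ∈ quadrant) :
    |strH ψ p| ≤ a₁ / μ * strQ μ ψ p := by
  have hμ := h.mu_pos
  have h1 : |strH ψ p| ≤ p.2 * a₁ := by
    rw [strH, abs_mul, abs_of_pos hp.2]
    exact mul_le_mul_of_nonneg_left (h.pr_le p hp) hp.2.le
  have h4 : p.2 ≤ strQ μ ψ p / μ := by
    rw [le_div_iff₀ hμ, mul_comm]; exact h.mul_le_strQ hp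
  calc |strH ψ p| ≤ p.2 * a₁ := h1
    _ ≤ strQ μ ψ p / μ * a₁ := mul_le_mul_of_nonneg_right h4 h.a1_pos.le
    _ = a₁ / μ * strQ μ ψ p := by ring

lemma abs_pz_strA_le (h : StreamBounds D μ a a₁ θ β C ψ) (hp : p ∈ quadrant) :
    |pz (strA μ ψ) p| ≤ (2 * a₁ + C) * (1 + p.1 ^ (-θ)) := by
  rw [h.pz_strA hp]
  have h1 := h.pz_le p hp
  have h2 := h.z_pz_pz_le p hp
  have h3 := Real.rpow_pos_of_pos hp.1 (-θ)
  have h4 := h.a1_pos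
  calc _ ≤ |2 * pz ψ p| + |p.2 * pz (pz ψ) p| := abs_add_le _ _
    _ ≤ 2 * a₁ + C * (1 + p.1 ^ (-θ)) := by
        rw [abs_mul, abs_of_pos (zero_lt_two' ℝ)]; linarith
    _ ≤ _ := by nlinarith

lemma abs_pr_strA_le (h : StreamBounds D μ a a₁ θ β C ψ) (hp : p ∈ quadrant) :
    |pr (strA μ ψ) p| ≤ (2 * a₁ + C) * (1 + p.1 ^ (-θ)) := by
  rw [h.pr_strA hp]
  have h1 := h.pr_le p hp
  have h2 := h.z_pr_pz_le p hp
  have h3 := Real.rpow_pos_of_pos hp.1 (-θ)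
  have h4 := h.a1_pos
  calc _ ≤ |pr ψ p| + |p.2 * pr (pz ψ) p| := abs_add_le _ _
    _ ≤ a₁ + C * (1 + p.1 ^ (-θ)) := by linarith
    _ ≤ _ := by nlinarith

/-- The source term in the transport of `∂_Q Ω`. -/
lemma abs_source_dQ_le (h : StreamBounds D μ a a₁ θ β C ψ) :
    ∃ K ≥ 0, ∀ p ∈ quadrant, ∀ y : ℝ,
      |strg μ ψ p ^ 3 * pz (strA μ ψ) p * y| ≤ K * ((1 + p.1 ^ (-θ)) * |y|) := by
  have hμ := h.mu_pos; have ha := h.a1_pos; have hC := h.C_nonneg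
  refine ⟨(1 / μ) ^ 3 * (2 * a₁ + C), by positivity, fun p hp y => ?_⟩
  have hg := h.strg_pos hp
  rw [abs_mul, abs_mul, abs_of_pos (pow_pos hg 3)]
  calc strg μ ψ p ^ 3 * |pz (strA μ ψ) p| * |y|
      ≤ (1 / μ) ^ 3 * ((2 * a₁ + C) * (1 + p.1 ^ (-θ))) * |y| := by
        have := h.strg_le hp
        have := h.abs_pz_strA_le hp
        gcongr
    _ = _ := by ring

/-- The source term in the transport of the derivative in `r` at fixed `Q`. -/
lemma abs_source_dr_le (h : StreamBounds D μ a a₁ θ β C ψ) :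
    ∃ K ≥ 0, ∀ p ∈ quadrant, ∀ x y : ℝ,
      |(strH ψ p * strg μ ψ p * pz (strF D μ ψ) p + (D - 1) * strH ψ p) * x
        + strg μ ψ p ^ 2 * (pr (strA μ ψ) p - strH ψ p * strg μ ψ p * pz (strA μ ψ) p) * y|
      ≤ K * (|strH ψ p| * |x|) + K * ((1 + p.1 ^ (-θ)) * |y|) := by
  have hμ := h.mu_pos; have ha := h.a1_pos; have hC := h.C_nonneg; have hD := h.three_le
  set K₁ := 1 + 2 * D / μ * a₁ + (D - 1) with hK₁
  set K₂ := (1 / μ) ^ 2 * ((2 * a₁ + C) + a₁ * (1 / μ) * (2 * a₁ + C)) with hK₂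
  have hK₁0 : 0 ≤ K₁ := by
    have : 0 ≤ D - 1 := by linarith
    positivity
  have hK₂0 : 0 ≤ K₂ := by positivity
  refine ⟨K₁ + K₂, by positivity, fun p hp x y => ?_⟩
  have hg := h.strg_pos hp
  have hgle := h.strg_le hp
  have hH := h.abs_strH_le hp
  have hr := Real.rpow_pos_of_pos hp.1 (-θ)
  have h1 : |strg μ ψ p * pz (strF D μ ψ) p| ≤ 1 + 2 * D / μ * a₁ := by
    have h2 := h.strg_mul_pz_strF_le hp
    have h3 := h.le_strg_mul_pz_strF hp
    have h4 : 2 * D / μ * ψ p ≤ 2 * D / μ * a₁ := by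
      have := h.le_a1 p hp
      gcongr
    have h5 : 0 ≤ 2 * D / μ * a₁ := by positivity
    exact abs_le.2 ⟨by linarith, by linarith⟩
  have h2 : |strH ψ p * strg μ ψ p * pz (strF D μ ψ) p + (D - 1) * strH ψ p|
      ≤ K₁ * |strH ψ p| := by
    have e : strH ψ p * strg μ ψ p * pz (strF D μ ψ) p + (D - 1) * strH ψ p
        = strH ψ p * (strg μ ψ p * pz (strF D μ ψ) p + (D - 1)) := by ring
    rw [e, abs_mul, mul_comm]
    refine mul_le_mul_of_nonneg_right ((abs_add_le _ _).trans ?_) (abs_nonneg _)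
    rw [abs_of_nonneg (by linarith : 0 ≤ D - 1), hK₁]
    linarith
  have h3 : |strg μ ψ p ^ 2 * (pr (strA μ ψ) p - strH ψ p * strg μ ψ p * pz (strA μ ψ) p)|
      ≤ K₂ * (1 + p.1 ^ (-θ)) := by
    rw [abs_mul, abs_of_pos (pow_pos hg 2)]
    have h4 : |pr (strA μ ψ) p - strH ψ p * strg μ ψ p * pz (strA μ ψ) p|
        ≤ ((2 * a₁ + C) + a₁ * (1 / μ) * (2 * a₁ + C)) * (1 + p.1 ^ (-θ)) := by
      refine (abs_sub _ _).trans ?_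
      rw [add_mul, abs_mul, abs_mul, abs_of_pos hg, mul_assoc (a₁ * (1 / μ))]
      have h5 := h.abs_pr_strA_le hp
      have h6 := h.abs_pz_strA_le hp
      gcongr
    rw [hK₂, mul_assoc ((1 / μ) ^ 2)]
    gcongr
  refine (abs_add_le _ _).trans ?_
  rw [abs_mul, abs_mul]
  have h4 := mul_le_mul_of_nonneg_right h2 (abs_nonneg x)
  have h5 := mul_le_mul_of_nonneg_right h3 (abs_nonneg y)
  have h6 : 0 ≤ K₂ * (|strH ψ p| * |x|) := by positivity
  have h7 : 0 ≤ K₁ * ((1 + p.1 ^ (-θ)) * |y|) := by positivity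
  nlinarith

lemma flowDeriv_self (h : StreamBounds D μ a a₁ θ β C ψ) (hO : ContDiffOn ℝ 1 Om quadrant)
    (heq : ∀ p ∈ quadrant, fderiv ℝ Om p (flowField D μ ψ p) = -(strg μ ψ p * Om p)) :
    FlowDeriv (flowField D μ ψ) Om (fun p => -(strg μ ψ p * Om p) + (fun _ => 0) p) :=
  (FlowDeriv.of_contDiffOn h.contDiffOn_flowField.continuousOn hO).congr (fun _ _ => rfl)
    fun p hp => by rw [heq p hp, add_zero]

/-- Q grows at logarithmic rate F / Q, which adds to the damping. -/
lemma flowDeriv_div_strQ (h : StreamBounds D μ a a₁ θ β C ψ) (hO : ContDiffOn ℝ 1 Om quadrant)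
    (heq : ∀ p ∈ quadrant, fderiv ℝ Om p (flowField D μ ψ p) = -(strg μ ψ p * Om p)) :
    FlowDeriv (flowField D μ ψ) (fun p => Om p / strQ μ ψ p)
      (fun p => -((strg μ ψ p + strF D μ ψ p / strQ μ ψ p) * (Om p / strQ μ ψ p))
        + (fun _ => 0) p) := by
  refine ((h.flowDeriv_self hO heq).mul_left h.contDiffOn_flowField.continuousOn
    (h.contDiffOn_strQ.inv fun p hp => (h.strQ_pos hp).ne')).congr
    (fun p hp => div_eq_inv_mul _ _) (fun p hp => ?_)
  have hQ := (h.strQ_pos hp).ne'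
  have hd := (hasDerivAt_inv hQ).comp_hasFDerivAt p
    (differentiableAt_of_mem h.contDiffOn_strQ hp).hasFDerivAt
  have hd' : fderiv ℝ (strQ μ ψ)⁻¹ p = _ := hd.fderiv
  rw [hd']
  simp only [_root_.smul_apply, h.flow_strQ hp, smul_eq_mul, Pi.inv_apply]
  field_simp
  ring

/-- Growth of the vorticity and of its gradient towards the origin. -/
lemma gradient_inner (h : StreamBounds D μ a a₁ θ β C ψ) (hO : ContDiffOn ℝ 1 Om quadrant)
    (heq : ∀ p ∈ quadrant, fderiv ℝ Om p (flowField D μ ψ p) = -(strg μ ψ p * Om p)) {B₀ : ℝ}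
    (hΓ : ∀ p ∈ quadrant, level μ ψ p = 1 → |Om p| ≤ B₀ ∧ |strg μ ψ p * pz Om p| ≤ B₀ ∧
      p.1 * |pr Om p - strH ψ p * (strg μ ψ p * pz Om p)| ≤ B₀) :
    ∃ B, ∀ p ∈ quadrant, level μ ψ p ≤ 1 → p.1 ^ (1 / (μ + a)) * |Om p| ≤ B ∧
      p.1 ^ (1 / (μ + a) + 1) * |strg μ ψ p * pz Om p| ≤ B ∧
      p.1 ^ (1 / (μ + a) + 1) * |pr Om p - strH ψ p * (strg μ ψ p * pz Om p)| ≤ B := by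
  have hμ := h.mu_pos; have ha := h.a_pos; have ha₁ := h.a1_pos
  set k := 1 / (μ + a) with hk
  have hk0 : 0 < k := by positivity
  set C₁ := a₁ * (1 + 2 / μ) / (μ * (μ + a)) with hC₁
  have hC₁0 : 0 ≤ C₁ := by positivity
  have hσ0 : ∀ p ∈ quadrant, 0 ≤ p.1 ^ (1 - θ) + strQ μ ψ p := fun p hp =>
    (add_pos (Real.rpow_pos_of_pos hp.1 _) (h.strQ_pos hp)).le
  have hr1 : ∀ p ∈ quadrant, level μ ψ p = 1 → ∀ n : ℝ, 0 ≤ n → p.1 ^ n ≤ 1 :=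
    fun p hp hl n hn => Real.rpow_le_one hp.1.le (fst_le_one hp hl.le) hn
  have hB₀ : ∀ p ∈ quadrant, level μ ψ p = 1 → 0 ≤ B₀ := fun p hp hl =>
    (abs_nonneg _).trans (hΓ p hp hl).1
  -- The system is triangular: the source of ∂_Q Ω involves only Ω, as the first component of the
  -- field depends on r alone, and the source of the r-derivative at fixed Q involves Ω and ∂_Q Ω.
  -- Hence the order of the three bounds.
  obtain ⟨B₁, hB₁⟩ := h.inner_bound (h.flowDeriv_self hO heq) (n := k) (C₂ := 0) (C₃ := B₀) hC₁0
    le_rfl (fun p hp hl => h.strg_le_inner hp hl) (fun p hp _ => by simp)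
    (fun p hp hl => by
      have := hr1 p hp hl k hk0.le
      have := Real.rpow_nonneg hp.1.le k
      nlinarith [abs_nonneg (Om p), (hΓ p hp hl).1])
  -- The extra power of r in the weight turns the singularity r^{-θ} into r^{1-θ}, an admissible
  -- source.
  have hsrc : ∀ p ∈ quadrant, level μ ψ p ≤ 1 →
      p.1 ^ (k + 1) * ((1 + p.1 ^ (-θ)) * |Om p|) ≤ 2 * |B₁| * (p.1 ^ (1 - θ) + strQ μ ψ p) := by
    intro p hp hl
    have h1 : p.1 ≤ p.1 ^ (1 - θ) := by
      have := Real.rpow_le_rpow_of_exponent_ge hp.1 (fst_le_one hp hl)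
        (by linarith [h.theta_pos] : 1 - θ ≤ 1)
      rwa [Real.rpow_one] at this
    have h2 : p.1 * p.1 ^ (-θ) = p.1 ^ (1 - θ) := by
      rw [sub_eq_add_neg, Real.rpow_add hp.1, Real.rpow_one]
    have h3 : p.1 * (1 + p.1 ^ (-θ)) ≤ 2 * (p.1 ^ (1 - θ) + strQ μ ψ p) := by
      rw [mul_add, h2]; linarith [h.strQ_pos hp]
    rw [Real.rpow_add hp.1, Real.rpow_one]
    calc p.1 ^ k * p.1 * ((1 + p.1 ^ (-θ)) * |Om p|)
        = (p.1 * (1 + p.1 ^ (-θ))) * (p.1 ^ k * |Om p|) := by ring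
      _ ≤ (2 * (p.1 ^ (1 - θ) + strQ μ ψ p)) * |B₁| :=
          mul_le_mul h3 ((hB₁ p hp hl).trans (le_abs_self _))
            (mul_nonneg (Real.rpow_nonneg hp.1.le _) (abs_nonneg _))
            (mul_nonneg zero_le_two (hσ0 p hp))
      _ = _ := by ring
  obtain ⟨K, hK0, hK⟩ := h.abs_source_dQ_le
  obtain ⟨B₂, hB₂⟩ := h.inner_bound (h.flowDeriv_dQ hO heq) (n := k + 1) (C₁ := C₁)
    (C₂ := K * (2 * |B₁|)) (C₃ := B₀) hC₁0 (by positivity)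
    (fun p hp hl => by
      have h1 := h.strg_le_inner hp hl
      have h2 := h.strg_mul_pz_strF_le hp
      linarith)
    (fun p hp hl => by
      calc _ ≤ p.1 ^ (k + 1) * (K * ((1 + p.1 ^ (-θ)) * |Om p|)) :=
            mul_le_mul_of_nonneg_left (hK p hp _) (Real.rpow_nonneg hp.1.le _)
        _ = K * (p.1 ^ (k + 1) * ((1 + p.1 ^ (-θ)) * |Om p|)) := by ring
        _ ≤ K * (2 * |B₁| * (p.1 ^ (1 - θ) + strQ μ ψ p)) :=
            mul_le_mul_of_nonneg_left (hsrc p hp hl) hK0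
        _ = _ := by ring)
    (fun p hp hl => by
      have := hr1 p hp hl (k + 1) (by positivity)
      have := Real.rpow_nonneg hp.1.le (k + 1)
      nlinarith [abs_nonneg (strg μ ψ p * pz Om p), (hΓ p hp hl).2.1])
  obtain ⟨K', hK'0, hK'⟩ := h.abs_source_dr_le
  obtain ⟨B₃, hB₃⟩ := h.inner_bound (h.flowDeriv_dr hO heq) (n := k + 1) (C₁ := C₁)
    (C₂ := K' * (a₁ / μ * |B₂|) + K' * (2 * |B₁|)) (C₃ := B₀) hC₁0 (by positivity)
    (fun p hp hl => by
      have h1 := h.strg_le_inner hp hl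
      linarith)
    (fun p hp hl => by
      refine (mul_le_mul_of_nonneg_left (hK' p hp _ _) (Real.rpow_nonneg hp.1.le _)).trans ?_
      have h1 : p.1 ^ (k + 1) * (|strH ψ p| * |strg μ ψ p * pz Om p|)
          ≤ a₁ / μ * |B₂| * (p.1 ^ (1 - θ) + strQ μ ψ p) := by
        calc _ = |strH ψ p| * (p.1 ^ (k + 1) * |strg μ ψ p * pz Om p|) := by ring
          _ ≤ (a₁ / μ * strQ μ ψ p) * |B₂| :=
              mul_le_mul (h.abs_strH_le_mul hp) ((hB₂ p hp hl).trans (le_abs_self _))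
                (mul_nonneg (Real.rpow_nonneg hp.1.le _) (abs_nonneg _))
                (mul_nonneg (by positivity) (h.strQ_pos hp).le)
          _ = a₁ / μ * |B₂| * strQ μ ψ p := by ring
          _ ≤ _ := by
              have := Real.rpow_nonneg hp.1.le (1 - θ)
              gcongr
              linarith
      have h2 := mul_le_mul_of_nonneg_left h1 hK'0
      have h3 := mul_le_mul_of_nonneg_left (hsrc p hp hl) hK'0
      nlinarith)
    (fun p hp hl => by
      rw [add_comm k, Real.rpow_add hp.1, Real.rpow_one, mul_right_comm, mul_comm]
      have h1 := hr1 p hp hl k hk0.le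
      have h2 := (hΓ p hp hl).2.2
      have h3 : 0 ≤ p.1 * |pr Om p - strH ψ p * (strg μ ψ p * pz Om p)| :=
        mul_nonneg hp.1.le (abs_nonneg _)
      have h4 := Real.rpow_nonneg hp.1.le k
      nlinarith)
  refine ⟨max B₁ (max B₂ B₃), fun p hp hl => ⟨(hB₁ p hp hl).trans (le_max_left _ _),
    (hB₂ p hp hl).trans ((le_max_left _ _).trans (le_max_right _ _)),
    (hB₃ p hp hl).trans ((le_max_right _ _).trans (le_max_right _ _))⟩⟩

/-- Decay of the vorticity and of its gradient towards infinity. -/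
lemma gradient_outer (h : StreamBounds D μ a a₁ θ β C ψ) (hO : ContDiffOn ℝ 1 Om quadrant)
    (heq : ∀ p ∈ quadrant, fderiv ℝ Om p (flowField D μ ψ p) = -(strg μ ψ p * Om p)) {B₀ : ℝ}
    (hΓ : ∀ p ∈ quadrant, level μ ψ p = 1 → |Om p| ≤ B₀ ∧ |strg μ ψ p * pz Om p| ≤ B₀ ∧
      p.1 * |pr Om p - strH ψ p * (strg μ ψ p * pz Om p)| ≤ B₀) :
    ∃ B, ∀ p ∈ quadrant, 1 ≤ level μ ψ p → |Om p| ≤ B ∧ p.1 ^ (D - 2) * |Om p| ≤ B ∧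
      p.1 ^ (D - 2) * |strg μ ψ p * pz Om p| ≤ B ∧
      p.1 ^ (D - 2) * |pr Om p - strH ψ p * (strg μ ψ p * pz Om p)| ≤ B := by
  have hμ := h.mu_pos; have ha₁ := h.a1_pos; have hD := h.three_le; have hβ := h.beta_eq
  have hr1 : ∀ p ∈ quadrant, level μ ψ p = 1 → ∀ n : ℝ, 0 ≤ n → p.1 ^ n ≤ 1 :=
    fun p hp hl n hn => Real.rpow_le_one hp.1.le (fst_le_one hp hl.le) hn
  set C₁ := 2 / μ ^ 2 + 2 * D / μ with hC₁
  have hC₁0 : 0 ≤ C₁ := by positivity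
  have hg : ∀ p ∈ quadrant, 1 / μ - C₁ * ψ p ≤ strg μ ψ p := fun p hp => by
    have h1 := h.le_strg hp
    have h2 : 0 ≤ 2 * D / μ * ψ p := by have := h.pos p hp; positivity
    rw [hC₁, add_mul]; linarith
  -- Since 1/μ = D - 2 + β, both exponents 0 and D - 2 leave at least β of damping. The first serves
  -- for r ≤ 1, the second for large r.
  obtain ⟨B₁, hB₁⟩ := h.outer_bound (h.flowDeriv_self hO heq) (n := 0) (C₂ := 0) (C₃ := B₀) hC₁0
    (fun p hp hl => by linarith [hg p hp]) (fun p hp _ => by simp)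
    (fun p hp hl => by simpa using (hΓ p hp hl).1)
  obtain ⟨B₂, hB₂⟩ := h.outer_bound (h.flowDeriv_self hO heq) (n := D - 2) (C₂ := 0) (C₃ := B₀)
    hC₁0 (fun p hp hl => by linarith [hg p hp]) (fun p hp _ => by simp)
    (fun p hp hl => by
      have := hr1 p hp hl (D - 2) (by linarith)
      have := Real.rpow_nonneg hp.1.le (D - 2)
      nlinarith [abs_nonneg (Om p), (hΓ p hp hl).1])
  simp only [Real.rpow_zero, one_mul] at hB₁
  have hsrc : ∀ p ∈ quadrant, 1 ≤ level μ ψ p →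
      p.1 ^ (D - 2) * ((1 + p.1 ^ (-θ)) * |Om p|) ≤ 2 * (|B₁| + |B₂|) := by
    intro p hp hl
    have b1 := (hB₁ p hp hl).trans (le_abs_self _)
    have b2 := (hB₂ p hp hl).trans (le_abs_self _)
    have hy := abs_nonneg (Om p)
    rcases le_total p.1 1 with hr | hr
    · have h1 : p.1 ^ (D - 2) ≤ 1 := Real.rpow_le_one hp.1.le hr (by linarith)
      -- Here D - 2 ≥ 1 > θ.
      have h2 : p.1 ^ (D - 2) * p.1 ^ (-θ) ≤ 1 := by
        rw [← Real.rpow_add hp.1]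
        exact Real.rpow_le_one hp.1.le hr (by linarith [h.theta_lt])
      calc _ = (p.1 ^ (D - 2) + p.1 ^ (D - 2) * p.1 ^ (-θ)) * |Om p| := by ring
        _ ≤ (1 + 1) * |Om p| := by gcongr
        _ ≤ _ := by linarith [abs_nonneg B₂]
    · have h1 : p.1 ^ (-θ) ≤ 1 :=
        Real.rpow_le_one_of_one_le_of_nonpos hr (by linarith [h.theta_pos])
      have h2 := Real.rpow_nonneg hp.1.le (D - 2)
      calc _ = (1 + p.1 ^ (-θ)) * (p.1 ^ (D - 2) * |Om p|) := by ring
        _ ≤ (1 + 1) * (p.1 ^ (D - 2) * |Om p|) := by gcongr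
        _ ≤ _ := by linarith [abs_nonneg B₁]
  obtain ⟨K, hK0, hK⟩ := h.abs_source_dQ_le
  obtain ⟨B₃, hB₃⟩ := h.outer_bound (h.flowDeriv_dQ hO heq) (n := D - 2) (C₁ := C₁)
    (C₂ := K * (2 * (|B₁| + |B₂|))) (C₃ := B₀) hC₁0
    (fun p hp hl => by
      have h1 := h.le_strg hp
      have h2 := h.le_strg_mul_pz_strF hp
      rw [hC₁, add_mul]; linarith)
    (fun p hp hl => by
      calc _ ≤ p.1 ^ (D - 2) * (K * ((1 + p.1 ^ (-θ)) * |Om p|)) :=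
            mul_le_mul_of_nonneg_left (hK p hp _) (Real.rpow_nonneg hp.1.le _)
        _ = K * (p.1 ^ (D - 2) * ((1 + p.1 ^ (-θ)) * |Om p|)) := by ring
        _ ≤ _ := mul_le_mul_of_nonneg_left (hsrc p hp hl) hK0)
    (fun p hp hl => by
      have := hr1 p hp hl (D - 2) (by linarith)
      have := Real.rpow_nonneg hp.1.le (D - 2)
      nlinarith [abs_nonneg (strg μ ψ p * pz Om p), (hΓ p hp hl).2.1])
  obtain ⟨K', hK'0, hK'⟩ := h.abs_source_dr_le
  obtain ⟨B₄, hB₄⟩ := h.outer_bound (h.flowDeriv_dr hO heq) (n := D - 2) (C₁ := C₁)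
    (C₂ := K' * (a₁ * |B₃|) + K' * (2 * (|B₁| + |B₂|))) (C₃ := B₀) hC₁0
    (fun p hp hl => by linarith [hg p hp])
    (fun p hp hl => by
      refine (mul_le_mul_of_nonneg_left (hK' p hp _ _) (Real.rpow_nonneg hp.1.le _)).trans ?_
      have h1 : p.1 ^ (D - 2) * (|strH ψ p| * |strg μ ψ p * pz Om p|) ≤ a₁ * |B₃| := by
        calc _ = |strH ψ p| * (p.1 ^ (D - 2) * |strg μ ψ p * pz Om p|) := by ring
          _ ≤ a₁ * |B₃| :=
              mul_le_mul (h.abs_strH_le hp) ((hB₃ p hp hl).trans (le_abs_self _))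
                (mul_nonneg (Real.rpow_nonneg hp.1.le _) (abs_nonneg _)) ha₁.le
      have h2 := mul_le_mul_of_nonneg_left h1 hK'0
      have h3 := mul_le_mul_of_nonneg_left (hsrc p hp hl) hK'0
      nlinarith)
    (fun p hp hl => by
      have h1 : p.1 ^ (D - 2) ≤ p.1 := by
        have := Real.rpow_le_rpow_of_exponent_ge hp.1 (fst_le_one hp hl.le)
          (by linarith : 1 ≤ D - 2)
        rwa [Real.rpow_one] at this
      exact (mul_le_mul_of_nonneg_right h1 (abs_nonneg _)).trans (hΓ p hp hl).2.2)
  refine ⟨max (max B₁ B₂) (max B₃ B₄), fun p hp hl => ⟨?_, ?_, ?_, ?_⟩⟩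
  · exact (hB₁ p hp hl).trans ((le_max_left _ _).trans (le_max_left _ _))
  · exact (hB₂ p hp hl).trans ((le_max_right _ _).trans (le_max_left _ _))
  · exact (hB₃ p hp hl).trans ((le_max_left _ _).trans (le_max_right _ _))
  · exact (hB₄ p hp hl).trans ((le_max_right _ _).trans (le_max_right _ _))

/-- The vorticity vanishes linearly on the plane `z = 0`. -/
lemma exists_le_strQ (h : StreamBounds D μ a a₁ θ β C ψ) (hO : ContDiffOn ℝ 1 Om quadrant)
    (heq : ∀ p ∈ quadrant, fderiv ℝ Om p (flowField D μ ψ p) = -(strg μ ψ p * Om p)) {B₀ : ℝ}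
    (hΓ : ∀ p ∈ quadrant, level μ ψ p = 1 → |Om p / strQ μ ψ p| ≤ B₀) :
    ∃ B, ∀ p ∈ quadrant, |Om p| ≤ B * (1 + p.1 ^ (-(1 / μ + 1))) * strQ μ ψ p := by
  have hμ := h.mu_pos; have hD := h.three_le; have hβ := h.beta_eq
  have hFQ : ∀ p ∈ quadrant, strF D μ ψ p / strQ μ ψ p ≤ 1 := fun p hp => by
    rw [div_le_one (h.strQ_pos hp)]; exact (h.strF_lt_strQ hp).le
  have hFQ0 : ∀ p ∈ quadrant, 0 ≤ strF D μ ψ p / strQ μ ψ p := fun p hp =>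
    (div_pos (h.strF_pos hp) (h.strQ_pos hp)).le
  -- The crude bounds 1/A ≤ 1/μ and F / Q ≤ 1 suffice: the power of r is irrelevant, since only
  -- linear vanishing in Q at fixed r is wanted.
  obtain ⟨B₁, hB₁⟩ := h.inner_bound (h.flowDeriv_div_strQ hO heq) (n := 1 / μ + 1) (C₁ := 0)
    (C₂ := 0) (C₃ := B₀) le_rfl le_rfl
    (fun p hp hl => by linarith [h.strg_le hp, hFQ p hp]) (fun p hp _ => by simp)
    (fun p hp hl => by
      have := Real.rpow_le_one hp.1.le (fst_le_one hp hl.le) (by positivity : 0 ≤ 1 / μ + 1)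
      have := Real.rpow_nonneg hp.1.le (1 / μ + 1)
      nlinarith [abs_nonneg (Om p / strQ μ ψ p), hΓ p hp hl])
  obtain ⟨B₂, hB₂⟩ := h.outer_bound (h.flowDeriv_div_strQ hO heq) (n := 0) (C₁ := 2 / μ ^ 2)
    (C₂ := 0) (C₃ := B₀) (by positivity)
    (fun p hp hl => by linarith [h.le_strg hp, hFQ0 p hp]) (fun p hp _ => by simp)
    (fun p hp hl => by simpa using hΓ p hp hl)
  refine ⟨|B₁| + |B₂|, fun p hp => ?_⟩
  have hQ := h.strQ_pos hp
  have hr := Real.rpow_pos_of_pos hp.1 (-(1 / μ + 1))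
  have e : |Om p| = |Om p / strQ μ ψ p| * strQ μ ψ p := by
    rw [abs_div, abs_of_pos hQ, div_mul_cancel₀ _ hQ.ne']
  rw [e]
  refine mul_le_mul_of_nonneg_right ?_ hQ.le
  rcases le_total (level μ ψ p) 1 with hl | hl
  · have h1 := (hB₁ p hp hl).trans (le_abs_self _)
    have h2 := mul_le_mul_of_nonneg_left h1 hr.le
    rw [← mul_assoc, ← Real.rpow_add hp.1, neg_add_cancel, Real.rpow_zero, one_mul] at h2
    nlinarith [abs_nonneg B₁, abs_nonneg B₂]
  · have h1 := (hB₂ p hp hl).trans (le_abs_self _)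
    rw [Real.rpow_zero, one_mul] at h1
    nlinarith [abs_nonneg B₁, abs_nonneg B₂]

end StreamBounds

/-! ### The data on the initial curve -/

/-- The data as a function of the angle, divided by the stretched height `cos σ`. -/
def angularData (d : ℕ) (μ lam : ℝ) (Θ η : ℝ → ℝ) (σ : ℝ) : ℝ :=
  Θ (lam * σ) * Real.sin σ ^ (-(((d : ℝ) - 1) / ((d : ℝ) * μ)))
    * Real.cos σ ^ (-(1 + 1 / ((d : ℝ) * μ))) * chi d μ η σ

section

variable {d : ℕ} {μ lam : ℝ} {Θ η : ℝ → ℝ}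

lemma sin_pos_of_mem {σ : ℝ} (hσ : σ ∈ Ioo 0 (Real.pi / 2)) : 0 < Real.sin σ :=
  Real.sin_pos_of_pos_of_lt_pi hσ.1 (by linarith [hσ.2, Real.pi_pos])

lemma cos_pos_of_mem {σ : ℝ} (hσ : σ ∈ Ioo 0 (Real.pi / 2)) : 0 < Real.cos σ :=
  Real.cos_pos_of_mem_Ioo ⟨by linarith [hσ.1, Real.pi_pos], hσ.2⟩

lemma contDiffOn_angularData (hlam : 1 < lam) (hΘ : IsTheta d μ Θ) (hη : IsEta d η) :
    ContDiffOn ℝ 1 (angularData d μ lam Θ η) (Ioo 0 (Real.pi / 2)) := by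
  have h1 : ContDiffOn ℝ 1 (fun σ => Θ (lam * σ)) (Ioo 0 (Real.pi / 2)) :=
    (hΘ.smooth.of_le (by exact_mod_cast le_top)).comp (contDiff_const.mul contDiff_id).contDiffOn
      fun σ hσ => mul_pos (by linarith) hσ.1
  have h2 : ∀ s : ℝ, ContDiffOn ℝ 1 (fun σ => Real.sin σ ^ s) (Ioo 0 (Real.pi / 2)) := fun s =>
    Real.contDiff_sin.contDiffOn.rpow_const_of_ne fun σ hσ => (sin_pos_of_mem hσ).ne'
  have h3 : ∀ s : ℝ, ContDiffOn ℝ 1 (fun σ => Real.cos σ ^ s) (Ioo 0 (Real.pi / 2)) := fun s =>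
    Real.contDiff_cos.contDiffOn.rpow_const_of_ne fun σ hσ => (cos_pos_of_mem hσ).ne'
  have h4 : ContDiffOn ℝ 1 η (Ioo 0 (Real.pi / 2)) := hη.smooth.of_le (by exact_mod_cast le_top)
  exact ((h1.mul (h2 _)).mul (h3 _)).mul (h4.add ((contDiffOn_const.sub h4).mul (h3 _)))

/-- The power in Θ compensates the negative power of sin σ, with `delta d` ≥ 0 to spare. On products
of powers tan σ d/dσ acts by a bounded factor. -/
lemma angularData_near_zero (hμ : 0 < μ) (hd : 3 ≤ d) (hlam : 1 < lam) (hΘ : IsTheta d μ Θ)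
    (hη : IsEta d η) :
    ∃ σ₀ > 0, ∃ C, ∀ σ ∈ Ioo 0 σ₀, |angularData d μ lam Θ η σ| ≤ C ∧
      |Real.tan σ * deriv (angularData d μ lam Θ η) σ| ≤ C := by
  have hd' : (3 : ℝ) ≤ d := by exact_mod_cast hd
  set s := ((d : ℝ) - 1) / ((d : ℝ) * μ) with hs
  have hs0 : 0 ≤ s := div_nonneg (by linarith) (by positivity)
  set κ := 1 + 1 / ((d : ℝ) * μ) with hκ
  have hκ0 : 0 ≤ κ := by positivity
  set q := delta d + s with hq
  have hδ : 0 ≤ delta d := by unfold delta; split_ifs <;> norm_num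
  have hq0 : 0 ≤ q := add_nonneg hδ hs0
  have hlam0 : 0 < lam := by linarith
  -- Below σ₀ both λσ ≤ 1/10, where Θ is a pure power, and η = 1.
  set σ₀ := min (1 / (10 * lam)) (Real.arctan (2 * d)) with hσ₀
  have hσ₀0 : 0 < σ₀ := lt_min (by positivity)
    (Real.arctan_pos.2 (by linarith))
  have hσ₀1 : σ₀ ≤ 1 / 10 := (min_le_left _ _).trans (by
    apply one_div_le_one_div_of_le <;> linarith)
  have hrange : Ioo 0 σ₀ ⊆ Ioo 0 (Real.pi / 2) := fun σ hσ =>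
    ⟨hσ.1, by linarith [hσ.2, Real.pi_gt_three]⟩
  set f : ℝ → ℝ := fun σ => (lam * σ) ^ q * Real.sin σ ^ (-s) * Real.cos σ ^ (-κ) with hf
  have heq : ∀ σ ∈ Ioo 0 σ₀, angularData d μ lam Θ η σ = f σ := by
    intro σ hσ
    have h1 : lam * σ ∈ Ioc (0 : ℝ) (1 / 10) := by
      refine ⟨mul_pos hlam0 hσ.1, ?_⟩
      have := (hσ.2.le.trans (min_le_left _ _))
      rw [le_div_iff₀ (by positivity)] at this
      linarith
    have h2 : η σ = 1 := hη.eq_one σ ⟨hσ.1, hσ.2.le.trans (min_le_right _ _)⟩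
    simp only [angularData, chi, hΘ.eq_rpow _ h1, h2, f]
    rw [← hs, ← hκ, ← hq]; ring
  have hcos : ∀ σ ∈ Ioo 0 σ₀, 1 / 2 ≤ Real.cos σ := fun σ hσ => by
    have := Real.one_sub_sq_div_two_le_cos (x := σ)
    have h1 := hσ.1; have h2 := hσ.2
    nlinarith
  have hfle : ∀ σ ∈ Ioo 0 σ₀, |f σ| ≤ lam ^ q * 2 ^ s * 2 ^ κ := by
    intro σ hσ
    have hsin := sin_pos_of_mem (hrange hσ)
    have hc := hcos σ hσ
    have hσ1 : σ ≤ 1 := by linarith [hσ.2]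
    rw [abs_of_nonneg (by have := hσ.1; positivity)]
    have e1 : Real.cos σ ^ (-κ) ≤ 2 ^ κ := by
      calc Real.cos σ ^ (-κ) ≤ (1 / 2 : ℝ) ^ (-κ) :=
            Real.rpow_le_rpow_of_nonpos (by norm_num) hc (by linarith)
        _ = 2 ^ κ := by rw [one_div, Real.inv_rpow (by norm_num), Real.rpow_neg (by norm_num), inv_inv]
    have e2 : Real.sin σ ^ (-s) ≤ 2 ^ s * σ ^ (-s) := by
      have h1 : σ / 2 ≤ Real.sin σ := by
        have h2 := Real.mul_le_sin hσ.1.le (hrange hσ).2.le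
        have h3 : 1 / 2 ≤ 2 / Real.pi := by
          rw [div_le_div_iff₀ two_pos Real.pi_pos]; linarith [Real.pi_le_four]
        have := mul_le_mul_of_nonneg_right h3 hσ.1.le
        linarith
      calc Real.sin σ ^ (-s) ≤ (σ / 2) ^ (-s) :=
            Real.rpow_le_rpow_of_nonpos (by linarith [hσ.1]) h1 (by linarith)
        _ = 2 ^ s * σ ^ (-s) := by
          rw [Real.div_rpow hσ.1.le (by norm_num), Real.rpow_neg (by norm_num : (0:ℝ) ≤ 2)]
          rw [div_inv_eq_mul, mul_comm]
    have e3 : σ ^ q * σ ^ (-s) ≤ 1 := by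
      rw [← Real.rpow_add hσ.1]
      exact Real.rpow_le_one hσ.1.le hσ1 (by rw [hq]; linarith)
    have hσ0 := hσ.1
    calc f σ = lam ^ q * σ ^ q * Real.sin σ ^ (-s) * Real.cos σ ^ (-κ) := by
          simp only [hf]; rw [Real.mul_rpow hlam0.le hσ.1.le]
      _ ≤ lam ^ q * σ ^ q * (2 ^ s * σ ^ (-s)) * 2 ^ κ := by gcongr
      _ = lam ^ q * 2 ^ s * 2 ^ κ * (σ ^ q * σ ^ (-s)) := by ring
      _ ≤ lam ^ q * 2 ^ s * 2 ^ κ * 1 := by gcongr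
      _ = _ := mul_one _
  set B := lam ^ q * 2 ^ s * 2 ^ κ with hB
  have hB0 : 0 ≤ B := by positivity
  have hder : ∀ σ ∈ Ioo 0 σ₀, Real.tan σ * deriv (angularData d μ lam Θ η) σ
      = f σ * (q * (Real.sin σ / σ) / Real.cos σ - s + κ * (Real.sin σ / Real.cos σ) ^ 2) := by
    intro σ hσ
    have hsin := sin_pos_of_mem (hrange hσ)
    have hc := cos_pos_of_mem (hrange hσ)
    have hσ0 := hσ.1
    have hev : angularData d μ lam Θ η =ᶠ[𝓝 σ] f := by
      filter_upwards [Ioo_mem_nhds hσ.1 hσ.2] with τ hτ using heq τ hτ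
    have h1 : HasDerivAt (fun σ => (lam * σ) ^ q) (lam * q * (lam * σ) ^ (q - 1)) σ := by
      have := ((hasDerivAt_id σ).const_mul lam).rpow_const (p := q)
        (Or.inl (mul_pos hlam0 hσ.1).ne')
      simpa using this
    have h2 := (Real.hasDerivAt_sin σ).rpow_const (p := -s) (Or.inl hsin.ne')
    have h3 := (Real.hasDerivAt_cos σ).rpow_const (p := -κ) (Or.inl hc.ne')
    have h4 : deriv f σ = _ := ((h1.mul h2).mul h3).deriv
    rw [hev.deriv_eq, h4, Real.tan_eq_sin_div_cos, Real.rpow_sub_one (mul_pos hlam0 hσ.1).ne',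
      Real.rpow_sub_one hsin.ne', Real.rpow_sub_one hc.ne']
    simp only [hf, Pi.mul_apply]
    field_simp
    ring
  refine ⟨σ₀, hσ₀0, max B (B * (2 * q + s + 4 * κ)), fun σ hσ => ⟨?_, ?_⟩⟩
  · rw [heq σ hσ]; exact (hfle σ hσ).trans (le_max_left _ _)
  · rw [hder σ hσ, abs_mul]
    refine le_trans (mul_le_mul (hfle σ hσ) ?_ (abs_nonneg _) hB0) (le_max_right _ _)
    have hsin := sin_pos_of_mem (hrange hσ)
    have hc := hcos σ hσ
    have hc0 : 0 < Real.cos σ := by linarith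
    have h1 : Real.sin σ / σ ≤ 1 := by
      rw [div_le_one hσ.1]; exact (Real.sin_lt hσ.1).le
    have h1' : 0 ≤ Real.sin σ / σ := div_nonneg hsin.le hσ.1.le
    have h2 : q * (Real.sin σ / σ) / Real.cos σ ≤ 2 * q := by
      rw [div_le_iff₀ hc0]
      have : q * (Real.sin σ / σ) ≤ q := mul_le_of_le_one_right hq0 h1
      nlinarith
    have h2' : 0 ≤ q * (Real.sin σ / σ) / Real.cos σ := by positivity
    have h3 : (Real.sin σ / Real.cos σ) ^ 2 ≤ 4 := by
      have : Real.sin σ / Real.cos σ ≤ 2 := by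
        rw [div_le_iff₀ hc0]; linarith [Real.sin_le_one σ]
      have h4 : 0 ≤ Real.sin σ / Real.cos σ := by positivity
      nlinarith
    have h3' := mul_le_mul_of_nonneg_left h3 hκ0
    have h3'' : 0 ≤ κ * (Real.sin σ / Real.cos σ) ^ 2 := by positivity
    rw [abs_le]; constructor <;> linarith

/-- Here η = 0, and the remaining power of cos σ in χ cancels the negative one exactly. -/
lemma angularData_near_pi_div_two (hμ : 0 < μ) (hd : 3 ≤ d) (hlam : 1 < lam) (hΘ : IsTheta d μ Θ)
    (hη : IsEta d η) :
    ∃ σ₁ < Real.pi / 2, ∃ C, ∀ σ ∈ Ioo σ₁ (Real.pi / 2), |angularData d μ lam Θ η σ| ≤ C ∧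
      |Real.tan σ * deriv (angularData d μ lam Θ η) σ| ≤ C := by
  have hd' : (3 : ℝ) ≤ d := by exact_mod_cast hd
  set s := ((d : ℝ) - 1) / ((d : ℝ) * μ) with hs
  have hs0 : 0 ≤ s := div_nonneg (by linarith) (by positivity)
  set σ₁ := Real.arccos (1 / (3 * d)) with hσ₁
  -- Ensures λσ ≥ 1 beyond σ₁, hence Θ(λσ) = 1.
  have h1le : 1 ≤ σ₁ := by
    have h1 : 1 / (3 * (d : ℝ)) ≤ Real.cos 1 := by
      have := Real.one_sub_sq_div_two_le_cos (x := 1)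
      have h2 : 1 / (3 * (d : ℝ)) ≤ 1 / 2 := one_div_le_one_div_of_le two_pos (by linarith)
      linarith
    have h2 := Real.antitone_arccos h1
    rwa [Real.arccos_cos zero_le_one (by linarith [Real.pi_gt_three])] at h2
  have hσ₁lt : σ₁ < Real.pi / 2 := Real.arccos_lt_pi_div_two.2 (by positivity)
  have hrange : Ioo σ₁ (Real.pi / 2) ⊆ Ioo 0 (Real.pi / 2) := fun σ hσ =>
    ⟨by linarith [hσ.1], hσ.2⟩
  have heq : ∀ σ ∈ Ioo σ₁ (Real.pi / 2), angularData d μ lam Θ η σ = Real.sin σ ^ (-s) := by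
    intro σ hσ
    have h1 : Θ (lam * σ) = 1 := hΘ.eq_one _ (by nlinarith [hσ.1])
    have h2 : η σ = 0 := hη.eq_zero σ ⟨hσ.1.le, hσ.2⟩
    simp only [angularData, chi, h1, h2]
    rw [← hs, Real.rpow_neg (cos_pos_of_mem (hrange hσ)).le]
    have := (Real.rpow_pos_of_pos (cos_pos_of_mem (hrange hσ)) (1 + 1 / ((d : ℝ) * μ))).ne'
    rw [zero_add, sub_zero, one_mul, one_mul, mul_assoc, inv_mul_cancel₀ this, mul_one]
  have hsin1 : 0 < Real.sin 1 := Real.sin_pos_of_pos_of_lt_pi one_pos (by linarith [Real.pi_gt_three])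
  have hle : ∀ σ ∈ Ioo σ₁ (Real.pi / 2), Real.sin σ ^ (-s) ≤ Real.sin 1 ^ (-s) := fun σ hσ =>
    Real.rpow_le_rpow_of_nonpos hsin1
      (Real.sin_le_sin_of_le_of_le_pi_div_two (by linarith [Real.pi_pos]) hσ.2.le
        (by linarith [hσ.1])) (by linarith)
  refine ⟨σ₁, hσ₁lt, max (Real.sin 1 ^ (-s)) (s * Real.sin 1 ^ (-s)), fun σ hσ => ?_⟩
  have hsin := sin_pos_of_mem (hrange hσ)
  have hpow := Real.rpow_pos_of_pos hsin (-s)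
  constructor
  · rw [heq σ hσ, abs_of_pos hpow]
    exact (hle σ hσ).trans (le_max_left _ _)
  · have hev : angularData d μ lam Θ η =ᶠ[𝓝 σ] fun σ => Real.sin σ ^ (-s) := by
      filter_upwards [Ioo_mem_nhds hσ.1 hσ.2] with τ hτ using heq τ hτ
    have h2 := ((Real.hasDerivAt_sin σ).rpow_const (p := -s) (Or.inl hsin.ne')).deriv
    have hc := cos_pos_of_mem (hrange hσ)
    have e : Real.tan σ * deriv (angularData d μ lam Θ η) σ = -(s * Real.sin σ ^ (-s)) := by
      rw [hev.deriv_eq, h2, Real.tan_eq_sin_div_cos, Real.rpow_sub_one hsin.ne']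
      field_simp
    rw [e, abs_neg, abs_of_nonneg (mul_nonneg hs0 hpow.le)]
    exact (mul_le_mul_of_nonneg_left (hle σ hσ) hs0).trans (le_max_right _ _)

/-- The operator tan σ d/dσ is r d/dr for r = sin σ. Compactness covers the angles between the two
ends. -/
lemma angularData_bound (hμ : 0 < μ) (hd : 3 ≤ d) (hlam : 1 < lam) (hΘ : IsTheta d μ Θ)
    (hη : IsEta d η) :
    ∃ C, ∀ σ ∈ Ioo 0 (Real.pi / 2), |angularData d μ lam Θ η σ| ≤ C ∧
      |Real.tan σ * deriv (angularData d μ lam Θ η) σ| ≤ C := by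
  obtain ⟨σ₀, hσ₀, C₀, h₀⟩ := angularData_near_zero hμ hd hlam hΘ hη
  obtain ⟨σ₁, hσ₁, C₁, h₁⟩ := angularData_near_pi_div_two hμ hd hlam hΘ hη
  have hsmooth := contDiffOn_angularData (lam := lam) hlam hΘ hη
  obtain ⟨b, hb₁, hb₂⟩ := exists_between hσ₁
  have hsub : Icc (σ₀ / 2) b ⊆ Ioo 0 (Real.pi / 2) := fun σ hσ =>
    ⟨by linarith [hσ.1], hσ.2.trans_lt hb₂⟩
  have hc1 : ContinuousOn (angularData d μ lam Θ η) (Icc (σ₀ / 2) b) :=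
    hsmooth.continuousOn.mono hsub
  have hc2 : ContinuousOn (fun σ => Real.tan σ * deriv (angularData d μ lam Θ η) σ)
      (Icc (σ₀ / 2) b) := by
    refine ContinuousOn.mul (fun σ hσ => ?_)
      ((hsmooth.continuousOn_deriv_of_isOpen isOpen_Ioo le_rfl).mono hsub)
    exact (Real.continuousAt_tan.2 (cos_pos_of_mem (hsub hσ)).ne').continuousWithinAt
  obtain ⟨C₂, h₂⟩ := isCompact_Icc.exists_bound_of_continuousOn hc1
  obtain ⟨C₃, h₃⟩ := isCompact_Icc.exists_bound_of_continuousOn hc2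
  refine ⟨max (max C₀ C₁) (max C₂ C₃), fun σ hσ => ?_⟩
  rcases lt_or_ge σ σ₀ with h | h
  · exact ⟨(h₀ σ ⟨hσ.1, h⟩).1.trans ((le_max_left _ _).trans (le_max_left _ _)),
      (h₀ σ ⟨hσ.1, h⟩).2.trans ((le_max_left _ _).trans (le_max_left _ _))⟩
  rcases lt_or_ge σ₁ σ with h' | h'
  · exact ⟨(h₁ σ ⟨h', hσ.2⟩).1.trans ((le_max_right _ _).trans (le_max_left _ _)),
      (h₁ σ ⟨h', hσ.2⟩).2.trans ((le_max_right _ _).trans (le_max_left _ _))⟩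
  · have hm : σ ∈ Icc (σ₀ / 2) b := ⟨by linarith, by linarith⟩
    exact ⟨(h₂ σ hm).trans ((le_max_left _ _).trans (le_max_right _ _)),
      (h₃ σ hm).trans ((le_max_right _ _).trans (le_max_right _ _))⟩

lemma arcsin_mem {r : ℝ} (hr : r ∈ Ioo (0 : ℝ) 1) : Real.arcsin r ∈ Ioo 0 (Real.pi / 2) :=
  ⟨Real.arcsin_pos.2 hr.1, Real.arcsin_lt_pi_div_two.2 hr.2⟩

/-- The data on the initial curve are `E(r) Q` with `E` and `r E'` bounded. -/
lemma exists_radialData (hμ : 0 < μ) (hd : 3 ≤ d) (hlam : 1 < lam) (hΘ : IsTheta d μ Θ)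
    (hη : IsEta d η) :
    ∃ E : ℝ → ℝ, ContDiffOn ℝ 1 E (Ioo 0 1) ∧
      (∃ C, ∀ r ∈ Ioo (0 : ℝ) 1, |E r| ≤ C ∧ |r * deriv E r| ≤ C) ∧
      ∀ σ ∈ Ioo (0 : ℝ) (Real.pi / 2), E (Real.sin σ) * Real.cos σ
        = Θ (lam * σ) * Real.sin σ ^ (-(((d : ℝ) - 1) / ((d : ℝ) * μ)))
          * Real.cos σ ^ (-(1 / ((d : ℝ) * μ))) * chi d μ η σ := by
  obtain ⟨C, hC⟩ := angularData_bound hμ hd hlam hΘ hη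
  have hsmooth := contDiffOn_angularData (lam := lam) hlam hΘ hη
  refine ⟨fun r => angularData d μ lam Θ η (Real.arcsin r), ?_, ⟨C, fun r hr => ?_⟩,
    fun σ hσ => ?_⟩
  · refine hsmooth.comp (fun r hr => ?_) fun r hr => arcsin_mem hr
    exact (Real.contDiffAt_arcsin (by linarith [hr.1]) hr.2.ne).contDiffWithinAt
  · have hm := arcsin_mem hr
    refine ⟨(hC _ hm).1, ?_⟩
    have h1 : HasDerivAt (angularData d μ lam Θ η)
        (deriv (angularData d μ lam Θ η) (Real.arcsin r)) (Real.arcsin r) :=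
      ((hsmooth.contDiffAt (isOpen_Ioo.mem_nhds hm)).differentiableAt one_ne_zero).hasDerivAt
    have h2 := h1.comp r (Real.hasDerivAt_arcsin (by linarith [hr.1]) hr.2.ne)
    have h3 : deriv (fun r => angularData d μ lam Θ η (Real.arcsin r)) r = _ := h2.deriv
    have h4 := (hC _ hm).2
    rw [Real.tan_arcsin] at h4
    rw [h3]
    convert h4 using 2
    ring
  · have h1 : Real.arcsin (Real.sin σ) = σ :=
      Real.arcsin_sin (by linarith [hσ.1, Real.pi_pos]) hσ.2.le
    have hc := cos_pos_of_mem hσ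
    simp only [h1, angularData]
    rw [neg_add, Real.rpow_add hc, Real.rpow_neg_one]
    field_simp

end

/-! ### Gradient of the vorticity on the initial curve -/

namespace StreamBounds

variable {D μ a a₁ θ β C : ℝ} {ψ Om : ℝ × ℝ → ℝ}

/-- The data fix the tangential derivative and the equation fixes the derivative along the field,
which is transversal to the curve. As Ω - E(r) Q vanishes on the curve, its differential is c · d(r²
+ Q²), and evaluation on the field determines c. -/
lemma bounds_on_curve (h : StreamBounds D μ a a₁ θ β C ψ) (hO : ContDiffOn ℝ 1 Om quadrant)
    (heq : ∀ p ∈ quadrant, fderiv ℝ Om p (flowField D μ ψ p) = -(strg μ ψ p * Om p))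
    {E : ℝ → ℝ} {CE : ℝ} (hE : ContDiffOn ℝ 1 E (Ioo 0 1))
    (hCE : ∀ r ∈ Ioo (0 : ℝ) 1, |E r| ≤ CE ∧ |r * deriv E r| ≤ CE)
    (hdata : ∀ p ∈ quadrant, level μ ψ p = 1 → Om p = E p.1 * strQ μ ψ p) :
    ∃ B₀, ∀ p ∈ quadrant, level μ ψ p = 1 → |Om p / strQ μ ψ p| ≤ B₀ ∧ |Om p| ≤ B₀ ∧
      |strg μ ψ p * pz Om p| ≤ B₀ ∧
      p.1 * |pr Om p - strH ψ p * (strg μ ψ p * pz Om p)| ≤ B₀ := by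
  have hq := h.ratio_pos
  have hμ := h.mu_pos
  -- Evaluated on the field, the numerator bounds Ω / A, E F and Q r E', while r² + Q² grows at a
  -- rate of at least 2 `ratio`.
  set c₀ := (|CE| / μ + 2 * |CE|) / (2 * ratio D μ a₁) with hc₀
  have hc₀0 : 0 ≤ c₀ := by positivity
  refine ⟨|CE| + 2 * c₀, fun p hp hl => ?_⟩
  have hr := hp.1
  have hQ := h.strQ_pos hp
  have hQ1 := h.strQ_le_one hp hl.le
  have hr1 : p.1 < 1 := by unfold level at hl; nlinarith
  have hrm : p.1 ∈ Ioo (0 : ℝ) 1 := ⟨hr, hr1⟩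
  have hEp := (hCE _ hrm).1.trans (le_abs_self _)
  have hE'p := (hCE _ hrm).2.trans (le_abs_self _)
  have hOle : |Om p| ≤ |CE| := by
    rw [hdata p hp hl, abs_mul, abs_of_pos hQ]
    nlinarith [abs_nonneg (E p.1)]
  have hEat : ContDiffAt ℝ 1 E p.1 := hE.contDiffAt (isOpen_Ioo.mem_nhds hrm)
  set Φ : ℝ × ℝ → ℝ := fun q => Om q - E q.1 * strQ μ ψ q with hΦ
  have hΦC : ContDiffAt ℝ 1 Φ p :=
    (contDiffAt_of_mem hO hp).sub ((hEat.comp p contDiffAt_fst).mul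
      (contDiffAt_of_mem h.contDiffOn_strQ hp))
  have hΦ' : ∀ v, fderiv ℝ Φ p v = fderiv ℝ Om p v
      - (E p.1 * fderiv ℝ (strQ μ ψ) p v + strQ μ ψ p * (deriv E p.1 * v.1)) := by
    intro v
    have h1 : HasFDerivAt (fun q : ℝ × ℝ => E q.1) (deriv E p.1 • ContinuousLinearMap.fst ℝ ℝ ℝ) p :=
      (hEat.differentiableAt one_ne_zero).hasDerivAt.comp_hasFDerivAt p hasFDerivAt_fst
    have h2 := (differentiableAt_of_mem hO hp).hasFDerivAt.sub
      (h1.mul (differentiableAt_of_mem h.contDiffOn_strQ hp).hasFDerivAt)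
    have h3 : fderiv ℝ Φ p = _ := h2.fderiv
    rw [h3]
    simp [mul_comm]
  -- A function vanishing on the curve has a trivial extremum there, which gives access to Lagrange
  -- multipliers.
  have hext : IsLocalExtrOn Φ {x | level μ ψ x = level μ ψ p} p := by
    left
    have hp0 : Φ p = 0 := by simp only [hΦ, hdata p hp hl, sub_self]
    change ∀ᶠ x in 𝓝[_] p, Φ p ≤ Φ x
    filter_upwards [self_mem_nhdsWithin, nhdsWithin_le_nhds (quadrant_mem_nhds hp)] with x hx hxq
    have hx1 : level μ ψ x = 1 := by rw [← hl]; exact hx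
    have : Φ x = 0 := by simp only [hΦ, hdata x hxq hx1, sub_self]
    rw [hp0, this]
  obtain ⟨s, t, hst, hlin⟩ := hext.exists_multipliers_of_hasStrictFDerivAt_1d
    ((contDiffAt_of_mem h.contDiffOn_level hp).hasStrictFDerivAt one_ne_zero)
    (hΦC.hasStrictFDerivAt one_ne_zero)
  have hlin' : ∀ v, s * fderiv ℝ (level μ ψ) p v + t * fderiv ℝ Φ p v = 0 := fun v => by
    have := congrArg (fun L : ℝ × ℝ →L[ℝ] ℝ => L v) hlin
    simpa using this
  have hflow : fderiv ℝ (level μ ψ) p (flowField D μ ψ p)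
      = 2 * (p.1 ^ 2 + strQ μ ψ p * strF D μ ψ p) := by
    rw [h.flow_level hp, h.flow_strQ hp]; simp only [flowField]; ring
  have hNlow : ratio D μ a₁ ≤ p.1 ^ 2 + strQ μ ψ p * strF D μ ψ p := by
    have h2 := mul_le_mul_of_nonneg_left (h.ratio_mul_le_strF hp) hQ.le
    have h3 := mul_le_mul_of_nonneg_right h.ratio_le_one (sq_nonneg p.1)
    unfold level at hl
    have h4 : ratio D μ a₁ = ratio D μ a₁ * (p.1 ^ 2 + strQ μ ψ p ^ 2) := by rw [hl, mul_one]
    rw [h4]; nlinarith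
  have ht : t ≠ 0 := by
    rintro rfl
    have h1 := hlin' (flowField D μ ψ p)
    rw [hflow, zero_mul, add_zero] at h1
    have : s = 0 := (mul_eq_zero.1 h1).resolve_right
      (mul_pos two_pos (hq.trans_le hNlow)).ne'
    exact hst (by rw [this]; rfl)
  set c := -(s / t) with hc
  have hΦc : ∀ v, fderiv ℝ Φ p v = c * fderiv ℝ (level μ ψ) p v := fun v => by
    have := hlin' v
    rw [hc]; field_simp; linarith
  have hg := h.strg_pos hp
  have hc_le : |c| ≤ c₀ := by
    have h1 := hΦc (flowField D μ ψ p)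
    rw [hΦ', heq p hp, h.flow_strQ hp, hflow] at h1
    simp only [flowField] at h1
    have h2 : |c| * (2 * ratio D μ a₁) ≤ |CE| / μ + 2 * |CE| := by
      calc |c| * (2 * ratio D μ a₁)
          ≤ |c| * (2 * (p.1 ^ 2 + strQ μ ψ p * strF D μ ψ p)) := by gcongr
        _ = |c * (2 * (p.1 ^ 2 + strQ μ ψ p * strF D μ ψ p))| := by
          rw [abs_mul, abs_of_pos (by linarith : 0 < 2 * (p.1 ^ 2 + strQ μ ψ p * strF D μ ψ p))]
        _ = |-(strg μ ψ p * Om p)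
              - (E p.1 * strF D μ ψ p + strQ μ ψ p * (deriv E p.1 * p.1))| := by rw [← h1]
        _ ≤ |CE| / μ + 2 * |CE| := by
          have e1 : |strg μ ψ p * Om p| ≤ |CE| / μ := by
            rw [abs_mul, abs_of_pos hg]
            have := mul_le_mul (h.strg_le hp) hOle (abs_nonneg _) (by positivity)
            linarith [one_div_mul_eq_div μ |CE|]
          have e2 : |E p.1 * strF D μ ψ p| ≤ |CE| := by
            rw [abs_mul, abs_of_pos (h.strF_pos hp)]
            have := h.strF_lt_strQ hp
            exact (mul_le_mul hEp (by linarith) (h.strF_pos hp).le (abs_nonneg _)).trans_eq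
              (mul_one _)
          have e3 : |strQ μ ψ p * (deriv E p.1 * p.1)| ≤ |CE| := by
            rw [abs_mul, abs_of_pos hQ, mul_comm (deriv E p.1)]
            nlinarith [abs_nonneg (p.1 * deriv E p.1)]
          rw [abs_le] at e1 e2 e3 ⊢
          constructor <;> linarith
    rw [hc₀, le_div_iff₀ (by positivity)]
    exact h2
  have hX : strg μ ψ p * pz Om p = E p.1 + 2 * c * strQ μ ψ p := by
    have h1 := hΦc (0, 1)
    have e1 := (pz_eq_fderiv (differentiableAt_of_mem h.contDiffOn_strQ hp)).symm
    rw [hΦ', h.flow_level hp, ← pz_eq_fderiv (differentiableAt_of_mem hO hp), e1,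
      h.pz_strQ hp] at h1
    simp only [mul_zero, add_zero, zero_add] at h1
    have h2 := h.strg_mul_strA hp
    have h3 : pz Om p = strA μ ψ p * (E p.1 + 2 * c * strQ μ ψ p) := by linarith
    rw [h3, ← mul_assoc, h2, one_mul]
  have hT : pr Om p - strH ψ p * (strg μ ψ p * pz Om p)
      = strQ μ ψ p * deriv E p.1 + 2 * c * p.1 := by
    have h1 := hΦc (1, 0)
    have e1 := (pr_eq_fderiv (differentiableAt_of_mem h.contDiffOn_strQ hp)).symm
    rw [hΦ', h.flow_level hp, ← pr_eq_fderiv (differentiableAt_of_mem hO hp), e1,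
      h.pr_strQ hp] at h1
    rw [hX]
    simp only [mul_one] at h1
    linarith
  have hcQ : |2 * c * strQ μ ψ p| ≤ 2 * c₀ := by
    rw [abs_mul, abs_mul, abs_two, abs_of_pos hQ]
    nlinarith [abs_nonneg c]
  refine ⟨?_, by linarith, ?_, ?_⟩
  · rw [hdata p hp hl, mul_div_cancel_right₀ _ hQ.ne']; linarith
  · rw [hX]; exact (abs_add_le _ _).trans (add_le_add hEp hcQ)
  · rw [hT, ← abs_of_pos hr, ← abs_mul, abs_of_pos hr]
    have e : p.1 * (strQ μ ψ p * deriv E p.1 + 2 * c * p.1)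
        = strQ μ ψ p * (p.1 * deriv E p.1) + 2 * c * p.1 ^ 2 := by ring
    rw [e]
    refine (abs_add_le _ _).trans (add_le_add ?_ ?_)
    · rw [abs_mul, abs_of_pos hQ]
      nlinarith [abs_nonneg (p.1 * deriv E p.1)]
    · rw [abs_mul, abs_mul, abs_two, abs_of_pos (pow_pos hr 2)]
      nlinarith [abs_nonneg c, pow_le_one₀ hr.le hr1.le (n := 2)]

end StreamBounds

/-! ### Consequences of the parameter ranges -/

section Parameters

variable {d : ℕ} {a μ : ℝ}

lemma a_pos (hd : 3 ≤ d) (ha : ARange d a) : 0 < a := by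
  have hd' : (3 : ℝ) ≤ d := by exact_mod_cast hd
  refine lt_trans (div_pos (by norm_num) (mul_pos ?_ ?_)) ha.1 <;> linarith

/-- In the variables x = a (d-1)(d-2) and m = μ (d-2) the parameter ranges read 4(d-1)/(4d-3) < x <
1 and (x+3)/4 < m < 1; the inequalities below become polynomial ones in x, m and d. -/
lemma lt_mul_a (hd : 3 ≤ d) (ha : ARange d a) :
    4 * ((d : ℝ) - 1) < (4 * d - 3) * (a * ((d : ℝ) - 1) * ((d : ℝ) - 2)) := by
  have hd' : (3 : ℝ) ≤ d := by exact_mod_cast hd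
  have h1 : (0 : ℝ) < (4 * d - 3) * (d - 2) := mul_pos (by linarith) (by linarith)
  have h2 := (div_lt_iff₀ h1).1 ha.1
  have h3 := mul_lt_mul_of_pos_right h2 (by linarith : (0 : ℝ) < d - 1)
  linarith

lemma mul_a_lt_one (hd : 3 ≤ d) (ha : ARange d a) :
    a * ((d : ℝ) - 1) * ((d : ℝ) - 2) < 1 := by
  have hd' : (3 : ℝ) ≤ d := by exact_mod_cast hd
  have h1 : (0 : ℝ) < (d - 1) * (d - 2) := mul_pos (by linarith) (by linarith)
  have := (lt_div_iff₀ h1).1 ha.2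
  linarith

lemma mul_a1_eq (hd : 3 ≤ d) :
    2 * (a1 d a * ((d : ℝ) - 1) * ((d : ℝ) - 2)) = a * ((d : ℝ) - 1) * ((d : ℝ) - 2) + 1 := by
  have hd' : (3 : ℝ) ≤ d := by exact_mod_cast hd
  have h1 : (d : ℝ) - 1 ≠ 0 := by intro h; linarith
  have h2 : (d : ℝ) - 2 ≠ 0 := by intro h; linarith
  unfold a1; field_simp

lemma mul_mu_lt_one (hd : 3 ≤ d) (hμ : MuRange d a μ) : μ * ((d : ℝ) - 2) < 1 := by
  have hd' : (3 : ℝ) ≤ d := by exact_mod_cast hd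
  exact (lt_div_iff₀ (by linarith)).1 hμ.2

lemma lt_four_mul_mu (hd : 3 ≤ d) (hμ : MuRange d a μ) :
    a * ((d : ℝ) - 1) * ((d : ℝ) - 2) + 3 < 4 * (μ * ((d : ℝ) - 2)) := by
  have hd' : (3 : ℝ) ≤ d := by exact_mod_cast hd
  have h2 : (0 : ℝ) < d - 2 := by linarith
  have h3 := mul_lt_mul_of_pos_right hμ.1 h2
  have h4 : 1 / (2 * ((d : ℝ) - 2)) * (d - 2) = 1 / 2 := by field_simp
  have := mul_a1_eq (a := a) hd
  rw [add_mul, h4] at h3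
  linarith

lemma a1_pos (hd : 3 ≤ d) (ha : ARange d a) : 0 < a1 d a := by
  have hd' : (3 : ℝ) ≤ d := by exact_mod_cast hd
  have := a_pos hd ha
  have h1 : (0 : ℝ) < 2 * (d - 1) * (d - 2) := mul_pos (by linarith) (by linarith)
  unfold a1; positivity

lemma mu_pos (hd : 3 ≤ d) (ha : ARange d a) (hμ : MuRange d a μ) : 0 < μ := by
  have hd' : (3 : ℝ) ≤ d := by exact_mod_cast hd
  have h1 := lt_four_mul_mu hd hμ
  have h2 : (0 : ℝ) < a * (d - 1) * (d - 2) :=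
    mul_pos (mul_pos (a_pos hd ha) (by linarith)) (by linarith)
  by_contra! h
  nlinarith

/-- `μ (d - 2)` is closer to `1` than `1 / d`. -/
lemma sub_one_lt_mul_mu (hd : 3 ≤ d) (ha : ARange d a) (hμ : MuRange d a μ) :
    (d : ℝ) - 1 < d * (μ * ((d : ℝ) - 2)) := by
  have hd' : (3 : ℝ) ≤ d := by exact_mod_cast hd
  have h1 := lt_four_mul_mu hd hμ
  have h2 := lt_mul_a hd ha
  set x := a * ((d : ℝ) - 1) * ((d : ℝ) - 2)
  set m := μ * ((d : ℝ) - 2)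
  have h8 : (0 : ℝ) < 4 * d - 3 := by linarith
  have h3 : 16 * (d : ℝ) - 13 < (4 * d - 3) * (4 * m) := by
    nlinarith [mul_lt_mul_of_pos_left h1 h8]
  have h4 := mul_lt_mul_of_pos_left h3 (by linarith : (0 : ℝ) < d)
  refine lt_of_mul_lt_mul_left ?_ (by linarith : (0 : ℝ) ≤ 4 * (4 * d - 3))
  nlinarith

/-- Keeps F positive. It follows from (x+1)/2 < (x+3)/4 < m, valid as x < 1. -/
lemma mul_a1_lt_mu (hd : 3 ≤ d) (ha : ARange d a) (hμ : MuRange d a μ) :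
    ((d : ℝ) - 1) * a1 d a < μ := by
  have hd' : (3 : ℝ) ≤ d := by exact_mod_cast hd
  have h1 := lt_four_mul_mu hd hμ
  have h2 := mul_a_lt_one hd ha
  have h3 := mul_a1_eq (a := a) hd
  have h4 : (0 : ℝ) < d - 2 := by linarith
  refine lt_of_mul_lt_mul_right ?_ h4.le
  linarith

/-- Makes the Hessian singularity r^{d-3-γ} weaker than 1/r. Cleared of denominators, the claim is 1
< (d-3) μ + (2d-3) a. -/
lemma gam_lt (hd : 3 ≤ d) (ha : ARange d a) (hμ : MuRange d a μ) :
    gam d a μ < (d : ℝ) - 2 := by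
  have hd' : (3 : ℝ) ≤ d := by exact_mod_cast hd
  have h0 := a_pos hd ha
  have hμ0 := mu_pos hd ha hμ
  have h1 := lt_four_mul_mu hd hμ
  have h2 := lt_mul_a hd ha
  rw [gam, div_lt_iff₀ (by positivity)]
  have h4 : (0 : ℝ) < (d - 1) * (d - 2) := mul_pos (by linarith) (by linarith)
  have key : ((d : ℝ) - 1) * (d - 2)
      < (d - 3) * (d - 1) * (μ * ((d : ℝ) - 2)) + (2 * d - 3) * (a * ((d : ℝ) - 1) * ((d : ℝ) - 2)) := by
    set x := a * ((d : ℝ) - 1) * ((d : ℝ) - 2)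
    set m := μ * ((d : ℝ) - 2)
    have h5 : (d - 3) * (d - 1) * (x + 3) ≤ ((d : ℝ) - 3) * (d - 1) * (4 * m) :=
      mul_le_mul_of_nonneg_left h1.le (mul_nonneg (by linarith) (by linarith))
    have h6 : ((d : ℝ) - 3) * (d - 1) + 4 * (2 * d - 3) > 0 := by nlinarith
    have h7 := mul_lt_mul_of_pos_left h2 h6
    have h8 : (0 : ℝ) < 4 * d - 3 := by linarith
    refine lt_of_mul_lt_mul_left ?_ h8.le
    nlinarith [mul_le_mul_of_nonneg_left h5 h8.le]
  refine lt_of_mul_lt_mul_right ?_ h4.le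
  nlinarith

lemma alphaStar_pos (hd : 3 ≤ d) (ha : ARange d a) (hμ : MuRange d a μ) :
    0 < alphaStar d a μ := by
  have hd' : (3 : ℝ) ≤ d := by exact_mod_cast hd
  have h0 := a_pos hd ha
  have hμ0 := mu_pos hd ha hμ
  have h1 := lt_four_mul_mu hd hμ
  have h2 := lt_mul_a hd ha
  rw [alphaStar, sub_pos, div_lt_iff₀ (by positivity)]
  refine lt_of_mul_lt_mul_right ?_ (by linarith : (0 : ℝ) ≤ d - 1)
  set x := a * ((d : ℝ) - 1) * ((d : ℝ) - 2) with hx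
  set m := μ * ((d : ℝ) - 2) with hm
  have e : ((d : ℝ) - 2) * (μ + a) * (d - 1) = m * (d - 1) + x := by rw [hx, hm]; ring
  rw [e]
  have h8 : (0 : ℝ) < 4 * d - 3 := by linarith
  have h3 : 16 * (d : ℝ) - 13 < (4 * d - 3) * (4 * m) := by
    nlinarith [mul_lt_mul_of_pos_left h1 h8]
  have h4 := mul_lt_mul_of_pos_left h3 (by linarith : (0 : ℝ) < d - 1)
  refine lt_of_mul_lt_mul_left ?_ (by linarith : (0 : ℝ) ≤ 4 * (4 * d - 3))
  nlinarith

/-- From m, x < 1 one gets m (d-1) + x ≤ d, and (d-3) d < (d-1)(d-2). -/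
lemma alphaStar_lt_one (hd : 3 ≤ d) (ha : ARange d a) (hμ : MuRange d a μ) :
    alphaStar d a μ < 1 := by
  have hd' : (3 : ℝ) ≤ d := by exact_mod_cast hd
  have h0 := a_pos hd ha
  have hμ0 := mu_pos hd ha hμ
  have h1 := mul_mu_lt_one hd hμ
  have h2 := mul_a_lt_one hd ha
  have h3 : (d : ℝ) - 3 < 1 / (μ + a) := by
    rw [lt_div_iff₀ (by positivity)]
    have h4 : (0 : ℝ) < (d - 1) * (d - 2) := mul_pos (by linarith) (by linarith)
    refine lt_of_mul_lt_mul_right ?_ h4.le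
    set x := a * ((d : ℝ) - 1) * ((d : ℝ) - 2) with hx
    set m := μ * ((d : ℝ) - 2) with hm
    have e : ((d : ℝ) - 3) * (μ + a) * ((d - 1) * (d - 2)) = (d - 3) * (m * (d - 1) + x) := by
      rw [hx, hm]; ring
    rw [e]
    have h5 : m * (d - 1) + x ≤ d := by nlinarith
    have := mul_le_mul_of_nonneg_left h5 (by linarith : (0 : ℝ) ≤ d - 3)
    nlinarith
  unfold alphaStar; linarith

end Parameters

/-! ### The class `𝒜_M` satisfies the transport hypotheses -/

lemma one_le_jap (p : ℝ × ℝ) : 1 ≤ jap p :=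
  Real.one_le_sqrt.2 (by nlinarith [sq_nonneg p.1, sq_nonneg p.2])

lemma one_le_japz (z : ℝ) : 1 ≤ japz z := Real.one_le_sqrt.2 (by nlinarith [sq_nonneg z])

lemma japz_le_jap (p : ℝ × ℝ) : japz p.2 ≤ jap p :=
  Real.sqrt_le_sqrt (by nlinarith [sq_nonneg p.1])

lemma le_japz {z : ℝ} : z ≤ japz z := Real.le_sqrt_of_sq_le (by linarith)

lemma abs_pr_le_gradNorm (f : ℝ × ℝ → ℝ) (p : ℝ × ℝ) : |pr f p| ≤ gradNorm f p :=
  Real.abs_le_sqrt (by nlinarith [sq_nonneg (pz f p)])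

lemma abs_pz_le_gradNorm (f : ℝ × ℝ → ℝ) (p : ℝ × ℝ) : |pz f p| ≤ gradNorm f p :=
  Real.abs_le_sqrt (by nlinarith [sq_nonneg (pr f p)])

lemma abs_pr_pz_le_hessNorm (f : ℝ × ℝ → ℝ) (p : ℝ × ℝ) : |pr (pz f) p| ≤ hessNorm f p :=
  Real.abs_le_sqrt (by
    nlinarith [sq_nonneg (pr (pr f) p), sq_nonneg (pz (pr f) p), sq_nonneg (pz (pz f) p)])

lemma abs_pz_pz_le_hessNorm (f : ℝ × ℝ → ℝ) (p : ℝ × ℝ) : |pz (pz f) p| ≤ hessNorm f p :=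
  Real.abs_le_sqrt (by
    nlinarith [sq_nonneg (pr (pr f) p), sq_nonneg (pz (pr f) p), sq_nonneg (pr (pz f) p)])

/-- Mean value theorem on the segment from the origin: differentiability is needed only in its
interior, which lies in the open quadrant. -/
lemma abs_sub_origin_le {ψ : ℝ × ℝ → ℝ} {L : ℝ} (hc : ContinuousOn ψ closedQuadrant)
    (hd : ContDiffOn ℝ 1 ψ quadrant) (hr : ∀ p ∈ quadrant, |pr ψ p| ≤ L)
    (hz : ∀ p ∈ quadrant, |pz ψ p| ≤ L) {p : ℝ × ℝ} (hp : p ∈ quadrant) :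
    |ψ p - ψ (0, 0)| ≤ L * (p.1 + p.2) := by
  have hmem : ∀ t ∈ Ioo (0 : ℝ) 1, t • p ∈ quadrant := fun t ht =>
    ⟨mul_pos ht.1 hp.1, mul_pos ht.1 hp.2⟩
  have hline : ∀ t : ℝ, HasDerivAt (fun t : ℝ => t • p) p t := fun t => by
    simpa using (hasDerivAt_id t).smul_const p
  obtain ⟨t, ht, he⟩ := exists_hasDerivAt_eq_slope (fun t : ℝ => ψ (t • p))
    (fun t => fderiv ℝ ψ (t • p) p) one_pos
    (hc.comp (by fun_prop) fun t ht => ⟨mul_nonneg ht.1 hp.1.le, mul_nonneg ht.1 hp.2.le⟩)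
    (fun t ht => (differentiableAt_of_mem hd (hmem t ht)).hasFDerivAt.comp_hasDerivAt t (hline t))
  simp only [one_smul, zero_smul, sub_zero, div_one] at he
  rw [show ((0 : ℝ), (0 : ℝ)) = 0 from rfl, ← he,
    fderiv_apply_eq (differentiableAt_of_mem hd (hmem t ht))]
  have h1 := mul_le_mul_of_nonneg_left (hr _ (hmem t ht)) hp.1.le
  have h2 := mul_le_mul_of_nonneg_left (hz _ (hmem t ht)) hp.2.le
  refine (abs_add_le _ _).trans ?_
  rw [abs_mul, abs_mul, abs_of_pos hp.1, abs_of_pos hp.2]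
  linarith

lemma rpow_neg_le_one_add {r s t : ℝ} (hr : 0 < r) (hs : 0 ≤ s) (hst : s ≤ t) :
    r ^ (-s) ≤ 1 + r ^ (-t) := by
  rcases le_total r 1 with h | h
  · have := Real.rpow_le_rpow_of_exponent_ge hr h (neg_le_neg hst)
    linarith
  · have := Real.rpow_le_one_of_one_le_of_nonpos h (neg_nonpos.2 hs)
    have := Real.rpow_nonneg hr.le (-t)
    linarith

lemma MemA.exists_streamBounds {d : ℕ} {a μ M : ℝ} {ψ : ℝ × ℝ → ℝ} (hd : 3 ≤ d)
    (ha : ARange d a) (hμ : MuRange d a μ) (hM : 1 < M) (h : MemA d a μ M ψ) :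
    ∃ θ C, StreamBounds d μ a (a1 d a) θ (1 / μ - ((d : ℝ) - 2)) C ψ := by
  have hd' : (3 : ℝ) ≤ d := by exact_mod_cast hd
  have ha0 := a_pos hd ha
  have hμ0 := mu_pos hd ha hμ
  have ha₁ := a1_pos hd ha
  set κ := 1 / ((d : ℝ) * μ) with hκ
  have hκ0 : 0 ≤ κ := by positivity
  have hm := sub_one_lt_mul_mu hd ha hμ
  have hm1 := mul_mu_lt_one hd hμ
  -- Makes the exponent -1 + κ nonpositive, so that ⟨r,z⟩ may be replaced by ⟨z⟩ in the gradient
  -- bound.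
  have hκ1 : κ ≤ 1 := by
    rw [hκ, div_le_one (by positivity)]
    have : (1 : ℝ) * (d - 2) ≤ d * μ * (d - 2) := by linarith
    exact le_of_mul_le_mul_right this (by linarith)
  set β := 1 / μ - ((d : ℝ) - 2) with hβ
  have hβ0 : 0 < β := by
    rw [hβ, sub_pos, lt_div_iff₀ hμ0]; linarith
  set θ₁ := ((d : ℝ) - 1) / ((d : ℝ) * μ) - ((d : ℝ) - 3) with hθ₁
  have hθ₁0 : 0 ≤ θ₁ := by
    rw [hθ₁, sub_nonneg, le_div_iff₀ (by positivity)]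
    refine le_of_mul_le_mul_right (a := (d : ℝ) - 2) ?_ (by linarith)
    have : ((d : ℝ) - 3) * d * (μ * (d - 2)) ≤ (d - 3) * d * 1 :=
      mul_le_mul_of_nonneg_left hm1.le (mul_nonneg (by linarith) (by linarith))
    nlinarith
  have hθ₁1 : θ₁ < 1 := by
    have : ((d : ℝ) - 1) / ((d : ℝ) * μ) < (d : ℝ) - 2 := by
      rw [div_lt_iff₀ (by positivity)]; linarith
    rw [hθ₁]; linarith
  set θ₂ := gam d a μ - ((d : ℝ) - 3) with hθ₂
  have hθ₂1 : θ₂ < 1 := by have := gam_lt hd ha hμ; rw [hθ₂]; linarith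
  -- The two terms of the Hessian bound are singular like r^{-θ₁} and r^{-θ₂}; the entry 1/2 only
  -- secures θ > 0.
  set θ := max (max θ₁ θ₂) (1 / 2) with hθ
  -- Chosen so that r² + Q² ≤ c ⟨r,z⟩², which converts decay in ⟨r,z⟩ into decay in r² + Q².
  set c := max 1 ((μ + a1 d a) ^ 2) with hc
  have hc1 : 1 ≤ c := le_max_left _ _
  have hc0 : 0 < c := by linarith
  -- The first summand serves the decay of ψ, the other two the two terms of the Hessian bound.
  set C := M * c ^ (β / 2) + M + a1 d a with hC
  have hcβ : 0 < c ^ (β / 2) := Real.rpow_pos_of_pos hc0 _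
  have hC0 : 0 ≤ C := by positivity
  have hpos : ∀ p ∈ quadrant, 0 < ψ p := fun p hp => h.pos p (quadrant_subset_closedQuadrant hp)
  have hle : ∀ p ∈ quadrant, ψ p ≤ a1 d a := fun p hp =>
    h.le_a1 p (quadrant_subset_closedQuadrant hp)
  have hupper : ∀ p ∈ quadrant, ψ p ≤ M * jap p ^ (-β) := fun p hp => by
    have := h.upper p (quadrant_subset_closedQuadrant hp)
    rwa [show (d : ℝ) - 2 - 1 / μ = -β by rw [hβ]; ring] at this
  have hj0 : ∀ p, 0 < jap p := fun p => by linarith [one_le_jap p]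
  have hjz0 : ∀ z, 0 < japz z := fun z => by linarith [one_le_japz z]
  have hgrad : ∀ p ∈ quadrant, gradNorm ψ p ≤ 1 / 10 * (japz p.2)⁻¹ * ψ p := by
    intro p hp
    refine (h.grad_le p hp).trans (mul_le_mul_of_nonneg_right ?_ (hpos p hp).le)
    rw [mul_assoc]
    refine mul_le_mul_of_nonneg_left ?_ (by norm_num)
    calc jap p ^ (-1 + κ) * japz p.2 ^ (-κ)
        ≤ japz p.2 ^ (-1 + κ) * japz p.2 ^ (-κ) :=
          mul_le_mul_of_nonneg_right
            (Real.rpow_le_rpow_of_nonpos (hjz0 _) (japz_le_jap p) (by linarith))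
            (Real.rpow_nonneg (hjz0 _).le _)
      _ = (japz p.2)⁻¹ := by
          rw [← Real.rpow_add (hjz0 _), add_neg_cancel_right, Real.rpow_neg_one]
  have hgrad1 : ∀ p ∈ quadrant, gradNorm ψ p ≤ a1 d a := fun p hp => by
    have h1 := hgrad p hp
    have h2 : (japz p.2)⁻¹ ≤ 1 := inv_le_one_of_one_le₀ (one_le_japz _)
    have h3 := hpos p hp
    have h4 := hle p hp
    have h5 := mul_le_mul_of_nonneg_right h2 h3.le
    nlinarith
  have hzgrad : ∀ p ∈ quadrant, p.2 * gradNorm ψ p ≤ ψ p / 10 := fun p hp => by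
    have h1 := mul_le_mul_of_nonneg_left (hgrad p hp) hp.2.le
    have h2 : p.2 * (japz p.2)⁻¹ ≤ 1 := by
      rw [← div_eq_mul_inv, div_le_one (hjz0 _)]; exact le_japz
    have h5 := mul_le_mul_of_nonneg_right h2 (hpos p hp).le
    linarith
  have hhess : ∀ p ∈ quadrant, p.2 * hessNorm ψ p ≤ C * (1 + p.1 ^ (-θ)) := by
    intro p hp
    have hψ := hpos p hp
    have hr := Real.rpow_pos_of_pos hp.1 (-θ)
    have hz := hp.2
    refine (mul_le_mul_of_nonneg_left (h.hess_le p hp) hp.2.le).trans ?_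
    rw [show (d : ℝ) - 3 - ((d : ℝ) - 1) / ((d : ℝ) * μ) = -θ₁ by rw [hθ₁]; ring,
      show 2 - (d : ℝ) + 1 / μ = β by rw [hβ]; ring,
      show (d : ℝ) - 3 - gam d a μ = -θ₂ by rw [hθ₂]; ring]
    have e1 : p.2 * (jap p ^ β * p.1 ^ (-θ₁) * japz p.2 ^ (-1 - κ)) * ψ p
        ≤ M * (1 + p.1 ^ (-θ)) := by
      have s1 : p.2 * japz p.2 ^ (-1 - κ) ≤ 1 := by
        have : japz p.2 ^ (-1 - κ) ≤ japz p.2 ^ (-1 : ℝ) :=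
          Real.rpow_le_rpow_of_exponent_le (one_le_japz _) (by linarith)
        rw [Real.rpow_neg_one] at this
        calc p.2 * japz p.2 ^ (-1 - κ) ≤ p.2 * (japz p.2)⁻¹ := by gcongr
          _ ≤ 1 := by rw [← div_eq_mul_inv, div_le_one (hjz0 _)]; exact le_japz
      have s2 : jap p ^ β * ψ p ≤ M := by
        have := mul_le_mul_of_nonneg_left (hupper p hp) (Real.rpow_nonneg (hj0 p).le β)
        rw [mul_left_comm, ← Real.rpow_add (hj0 p), add_neg_cancel, Real.rpow_zero, mul_one] at this
        exact this
      have s3 : p.1 ^ (-θ₁) ≤ 1 + p.1 ^ (-θ) :=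
        rpow_neg_le_one_add hp.1 hθ₁0 ((le_max_left _ _).trans (le_max_left _ _))
      calc _ = (p.2 * japz p.2 ^ (-1 - κ)) * ((jap p ^ β * ψ p) * p.1 ^ (-θ₁)) := by ring
        _ ≤ 1 * (M * (1 + p.1 ^ (-θ))) := by
            have := Real.rpow_nonneg (hj0 p).le β
            have := Real.rpow_nonneg hp.1.le (-θ₁)
            gcongr
        _ = _ := one_mul _
    have e2 : p.2 * (if p.1 ^ 2 + p.2 ^ 2 ≤ 1 then p.1 ^ (-θ₂) else 0) * ψ p
        ≤ a1 d a * (1 + p.1 ^ (-θ)) := by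
      split_ifs with hif
      · have hr1 : p.1 ≤ 1 := by nlinarith [sq_nonneg p.2, hp.1]
        have hz1 : p.2 ≤ 1 := by nlinarith [sq_nonneg p.1, hp.2]
        have s3 : p.1 ^ (-θ₂) ≤ p.1 ^ (-θ) := Real.rpow_le_rpow_of_exponent_ge hp.1 hr1
          (neg_le_neg ((le_max_right _ _).trans (le_max_left _ _)))
        calc p.2 * p.1 ^ (-θ₂) * ψ p ≤ 1 * p.1 ^ (-θ) * a1 d a := by
              have := hle p hp
              have := Real.rpow_nonneg hp.1.le (-θ₂)
              gcongr
          _ ≤ _ := by linarith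
      · simp only [mul_zero, zero_mul]; positivity
    have hMc : 0 ≤ M * c ^ (β / 2) * (1 + p.1 ^ (-θ)) := by positivity
    have e3 : 0 ≤ p.2 * (jap p ^ β * p.1 ^ (-θ₁) * japz p.2 ^ (-1 - κ)) * ψ p := by
      have := Real.rpow_nonneg (hj0 p).le β
      have := Real.rpow_nonneg hp.1.le (-θ₁)
      have := Real.rpow_nonneg (hjz0 p.2).le (-1 - κ)
      positivity
    have e4 : 0 ≤ p.2 * (if p.1 ^ 2 + p.2 ^ 2 ≤ 1 then p.1 ^ (-θ₂) else 0) * ψ p := by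
      split_ifs
      · have := Real.rpow_nonneg hp.1.le (-θ₂); positivity
      · simp
    rw [hC]
    nlinarith
  refine ⟨θ, C, ?_⟩
  constructor
  · exact h.contDiffOn
  · exact hd'
  · exact hμ0
  · exact ha0
  · exact ha₁
  · exact mul_a1_lt_mu hd ha hμ
  · exact lt_of_lt_of_le (by norm_num) (le_max_right _ _)
  · exact max_lt (max_lt hθ₁1 hθ₂1) (by norm_num)
  · exact hβ0
  · rfl
  · exact hC0
  · exact hpos
  · exact hle
  · intro p hp
    rw [abs_mul, abs_of_pos hp.2]
    exact (mul_le_mul_of_nonneg_left (abs_pz_le_gradNorm ψ p) hp.2.le).trans (hzgrad p hp)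
  · intro p hp
    rw [abs_mul, abs_of_pos hp.2]
    exact (mul_le_mul_of_nonneg_left (abs_pr_le_gradNorm ψ p) hp.2.le).trans (hzgrad p hp)
  · exact fun p hp => (abs_pr_le_gradNorm ψ p).trans (hgrad1 p hp)
  · exact fun p hp => (abs_pz_le_gradNorm ψ p).trans (hgrad1 p hp)
  · intro p hp
    have := abs_sub_origin_le h.continuousOn (h.contDiffOn.of_le (by norm_num))
      (fun p hp => (abs_pr_le_gradNorm ψ p).trans (hgrad1 p hp))
      (fun p hp => (abs_pz_le_gradNorm ψ p).trans (hgrad1 p hp)) hp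
    rwa [h.origin] at this
  · intro p hp hl
    set G := p.1 ^ 2 + ((μ + ψ p) * p.2) ^ 2 with hG
    have hGj : G ≤ c * jap p ^ 2 := by
      have h1 : (μ + ψ p) ^ 2 ≤ c := by
        refine le_trans ?_ (le_max_right _ _)
        have := hpos p hp; have := hle p hp
        gcongr
      rw [jap, Real.sq_sqrt (by positivity), hG, mul_pow]
      nlinarith [sq_nonneg p.1, mul_le_mul_of_nonneg_right h1 (sq_nonneg p.2)]
    have hG0 : 0 < G := by linarith
    have h2 : jap p ^ (-β) = (jap p ^ 2) ^ (-β / 2) := by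
      rw [← Real.rpow_natCast, ← Real.rpow_mul (hj0 p).le]; congr 1; push_cast; ring
    have h3 : (c * jap p ^ 2) ^ (-β / 2) ≤ G ^ (-β / 2) :=
      Real.rpow_le_rpow_of_nonpos hG0 hGj (by linarith)
    rw [Real.mul_rpow hc0.le (sq_nonneg _), ← h2] at h3
    have h4 : c ^ (β / 2) * c ^ (-β / 2) = 1 := by
      rw [← Real.rpow_add hc0, show β / 2 + -β / 2 = 0 by ring, Real.rpow_zero]
    have h5 : jap p ^ (-β) ≤ c ^ (β / 2) * G ^ (-β / 2) := by
      calc jap p ^ (-β) = c ^ (β / 2) * (c ^ (-β / 2) * jap p ^ (-β)) := by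
            rw [← mul_assoc, h4, one_mul]
        _ ≤ _ := mul_le_mul_of_nonneg_left h3 hcβ.le
    have h6 := mul_le_mul_of_nonneg_left h5 (by linarith : 0 ≤ M)
    have h7 : 0 ≤ (M + a1 d a) * G ^ (-β / 2) := by
      have := Real.rpow_nonneg hG0.le (-β / 2); positivity
    have := hupper p hp
    rw [hC]; linarith
  · intro p hp
    rw [abs_mul, abs_of_pos hp.2]
    exact (mul_le_mul_of_nonneg_left (abs_pr_pz_le_hessNorm ψ p) hp.2.le).trans (hhess p hp)
  · intro p hp
    rw [abs_mul, abs_of_pos hp.2]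
    exact (mul_le_mul_of_nonneg_left (abs_pz_pz_le_hessNorm ψ p) hp.2.le).trans (hhess p hp)

/-! ### Bounds for the vorticity and its gradient -/

section Vorticity

variable {d : ℕ} {a μ M lam : ℝ} {Θ η : ℝ → ℝ} {ψ Ω : ℝ × ℝ → ℝ}

lemma IsTransportImage.flow_eq {θ β C a₁ : ℝ} (h : StreamBounds d μ a a₁ θ β C ψ)
    (hΩ : IsTransportImage d μ lam Θ η ψ Ω) :
    ∀ p ∈ quadrant, fderiv ℝ Ω p (flowField d μ ψ p) = -(strg μ ψ p * Ω p) := by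
  intro p hp
  have h1 := hΩ.eqn p hp
  have h2 := h.strg_mul_strA hp
  rw [StreamBounds.fderiv_flow (differentiableAt_of_mem hΩ.contDiffOn hp)]
  unfold strB strF strH
  change strA μ ψ p * _ + _ = _ at h1
  linear_combination strg μ ψ p * h1 - p.1 * pr Ω p * h2

lemma IsTransportImage.data_eq {θ β C a₁ : ℝ} (h : StreamBounds d μ a a₁ θ β C ψ)
    (hΩ : IsTransportImage d μ lam Θ η ψ Ω) {E : ℝ → ℝ}
    (hE : ∀ σ ∈ Ioo (0 : ℝ) (Real.pi / 2), E (Real.sin σ) * Real.cos σ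
        = Θ (lam * σ) * Real.sin σ ^ (-(((d : ℝ) - 1) / ((d : ℝ) * μ)))
          * Real.cos σ ^ (-(1 / ((d : ℝ) * μ))) * chi d μ η σ) :
    ∀ p ∈ quadrant, level μ ψ p = 1 → Ω p = E p.1 * strQ μ ψ p := by
  intro p hp hl
  have hQ := h.strQ_pos hp
  have hr1 : p.1 < 1 := by have := hp.1; unfold level at hl; nlinarith
  have hm := arcsin_mem ⟨hp.1, hr1⟩
  have hsin : Real.sin (Real.arcsin p.1) = p.1 :=
    Real.sin_arcsin (by linarith [hp.1]) hr1.le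
  have hcos : Real.cos (Real.arcsin p.1) = strQ μ ψ p := by
    rw [Real.cos_arcsin, show 1 - p.1 ^ 2 = strQ μ ψ p ^ 2 by unfold level at hl; linarith,
      Real.sqrt_sq hQ.le]
  have h1 := hΩ.data _ hm p.2 (by
    rw [hsin]
    refine ⟨?_, hp.1, hp.2⟩
    rw [← mul_pow]; exact hl)
  rw [← hE _ hm, hsin, hcos] at h1
  exact h1

/-- Inside the curve, d - 2 = α + 1/(μ + a) turns the growth rates of Ω and ∇Ω into r^α and r^{α-1}.
Outside, everything is bounded. -/
lemma vorticity_bounds (hd : 3 ≤ d) (ha : ARange d a) (hμ : MuRange d a μ) (hM : 1 < M)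
    (hlam : 1 < lam) (hΘ : IsTheta d μ Θ) (hη : IsEta d η) (hψ : MemA d a μ M ψ)
    (hΩ : IsTransportImage d μ lam Θ η ψ Ω) :
    ∃ B ≥ 0, ∀ p ∈ quadrant,
      |p.1 ^ (d - 2) * Ω p| ≤ B ∧
      |p.1 ^ (d - 2) * Ω p| ≤ B * p.1 ^ alphaStar d a μ ∧
      |pr (fun q => q.1 ^ (d - 2) * Ω q) p| ≤ B * (1 + p.1 ^ (alphaStar d a μ - 1)) ∧
      |pz (fun q => q.1 ^ (d - 2) * Ω q) p| ≤ B * (1 + p.1 ^ (alphaStar d a μ - 1)) := by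
  have hd' : (3 : ℝ) ≤ d := by exact_mod_cast hd
  obtain ⟨θ, C, h⟩ := hψ.exists_streamBounds hd ha hμ hM
  have hμ0 := h.mu_pos
  have ha₁ := h.a1_pos
  have hα0 := alphaStar_pos hd ha hμ
  have hα1 := alphaStar_lt_one hd ha hμ
  obtain ⟨E, hE, ⟨CE, hCE⟩, hdata⟩ := exists_radialData h.mu_pos hd hlam hΘ hη
  have heq := hΩ.flow_eq h
  obtain ⟨B₀, hB₀⟩ := h.bounds_on_curve hΩ.contDiffOn heq hE hCE (hΩ.data_eq h hdata)
  have hΓ := fun p hp hl => (hB₀ p hp hl).2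
  obtain ⟨B₁, hin⟩ := h.gradient_inner hΩ.contDiffOn heq hΓ
  obtain ⟨B₂, hout⟩ := h.gradient_outer hΩ.contDiffOn heq hΓ
  set α := alphaStar d a μ with hα
  have hαk : α = (d : ℝ) - 2 - 1 / (μ + a) := rfl
  set k := 1 / (μ + a) with hk
  set B := |B₁| + |B₂| with hB
  have hB0 : 0 ≤ B := by positivity
  have hB₁ : B₁ ≤ B := (le_abs_self _).trans (by linarith [abs_nonneg B₂])
  have hB₂ : B₂ ≤ B := (le_abs_self _).trans (by linarith [abs_nonneg B₁])
  have main : ∀ p ∈ quadrant, p.1 ^ ((d : ℝ) - 2) * |Ω p| ≤ B ∧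
      p.1 ^ ((d : ℝ) - 2) * |Ω p| ≤ B * p.1 ^ α ∧
      p.1 ^ ((d : ℝ) - 3) * |Ω p| ≤ B * (1 + p.1 ^ (α - 1)) ∧
      p.1 ^ ((d : ℝ) - 2) * |strg μ ψ p * pz Ω p| ≤ B * (1 + p.1 ^ (α - 1)) ∧
      p.1 ^ ((d : ℝ) - 2) * |pr Ω p - strH ψ p * (strg μ ψ p * pz Ω p)|
        ≤ B * (1 + p.1 ^ (α - 1)) := by
    intro p hp
    have hr := hp.1
    have hα' := Real.rpow_pos_of_pos hr α
    have hα'' := Real.rpow_pos_of_pos hr (α - 1)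
    rcases le_total (level μ ψ p) 1 with hl | hl
    · obtain ⟨i1, i2, i3⟩ := hin p hp hl
      have hr1 := StreamBounds.fst_le_one hp hl
      have hle1 : p.1 ^ α ≤ 1 := Real.rpow_le_one hr.le hr1 hα0.le
      have e1 : p.1 ^ ((d : ℝ) - 2) = p.1 ^ α * p.1 ^ k := by
        rw [← Real.rpow_add hr]; congr 1; rw [hαk]; ring
      have e2 : p.1 ^ ((d : ℝ) - 3) = p.1 ^ (α - 1) * p.1 ^ k := by
        rw [← Real.rpow_add hr]; congr 1; rw [hαk]; ring
      have e3 : p.1 ^ ((d : ℝ) - 2) = p.1 ^ (α - 1) * p.1 ^ (k + 1) := by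
        rw [← Real.rpow_add hr]; congr 1; rw [hαk]; ring
      have b : p.1 ^ ((d : ℝ) - 2) * |Ω p| ≤ B * p.1 ^ α := by
        rw [e1, mul_assoc, mul_comm]
        exact mul_le_mul_of_nonneg_right (i1.trans hB₁) hα'.le
      have s : ∀ y, y ≤ B₁ → p.1 ^ (α - 1) * y ≤ B * (1 + p.1 ^ (α - 1)) := fun y hy => by
        have := mul_le_mul_of_nonneg_left (hy.trans hB₁) hα''.le
        linarith
      refine ⟨b.trans (mul_le_of_le_one_right hB0 hle1), b, ?_, ?_, ?_⟩
      · rw [e2, mul_assoc]; exact s _ i1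
      · rw [e3, mul_assoc]; exact s _ i2
      · rw [e3, mul_assoc]; exact s _ i3
    · obtain ⟨o1, o2, o3, o4⟩ := hout p hp hl
      have s : ∀ y, y ≤ B₂ → y ≤ B * (1 + p.1 ^ (α - 1)) := fun y hy => by
        have : 0 ≤ B * p.1 ^ (α - 1) := by positivity
        linarith
      refine ⟨o2.trans hB₂, ?_, s _ ?_, s _ o3, s _ o4⟩
      -- Close to the axis the bound on Ω itself is used, with α ≤ d - 2.
      · rcases le_total p.1 1 with hr1 | hr1
        · have : p.1 ^ ((d : ℝ) - 2) ≤ p.1 ^ α :=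
            Real.rpow_le_rpow_of_exponent_ge hr hr1 (by linarith)
          rw [mul_comm B]
          exact mul_le_mul this (o1.trans hB₂) (abs_nonneg _) hα'.le
        · exact (o2.trans hB₂).trans
            (le_mul_of_one_le_right hB0 (Real.one_le_rpow hr1 hα0.le))
      · rcases le_total p.1 1 with hr1 | hr1
        · have : p.1 ^ ((d : ℝ) - 3) ≤ 1 := Real.rpow_le_one hr.le hr1 (by linarith)
          exact (mul_le_of_le_one_left (abs_nonneg _) this).trans o1
        · have : p.1 ^ ((d : ℝ) - 3) ≤ p.1 ^ ((d : ℝ) - 2) :=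
            Real.rpow_le_rpow_of_exponent_le hr1 (by linarith)
          exact (mul_le_mul_of_nonneg_right this (abs_nonneg _)).trans o2
  have c2 : ((d - 2 : ℕ) : ℝ) = (d : ℝ) - 2 := by rw [Nat.cast_sub (by omega)]; norm_num
  have c3 : ((d - 2 - 1 : ℕ) : ℝ) = (d : ℝ) - 3 := by
    rw [Nat.cast_sub (by omega), c2]; norm_num; ring
  -- Covers d - 2 from differentiating r^{d-2}, 1 + a₁ from ∂_r = (∂_r at fixed Q) + H ∂_Q, and μ +
  -- 2 a₁ ≥ A from ∂_z = A ∂_Q.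
  set L := B * (d + 1 + μ + 2 * a1 d a) with hL
  have hLB : B ≤ L := le_mul_of_one_le_right hB0 (by linarith)
  refine ⟨L, hB0.trans hLB, fun p hp => ?_⟩
  have hr := hp.1
  have n2 : p.1 ^ (d - 2) = p.1 ^ ((d : ℝ) - 2) := by rw [← c2, Real.rpow_natCast]
  have n3 : p.1 ^ (d - 2 - 1) = p.1 ^ ((d : ℝ) - 3) := by rw [← c3, Real.rpow_natCast]
  have hS : 0 ≤ 1 + p.1 ^ (α - 1) := by have := Real.rpow_pos_of_pos hr (α - 1); linarith
  have hα' := Real.rpow_pos_of_pos hr α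
  have hpow := Real.rpow_nonneg hr.le ((d : ℝ) - 2)
  have hpow3 := Real.rpow_nonneg hr.le ((d : ℝ) - 3)
  obtain ⟨m1, m2, m3, m4, m5⟩ := main p hp
  have hOd := differentiableAt_of_mem hΩ.contDiffOn hp
  have hX : pz Ω p = strA μ ψ p * (strg μ ψ p * pz Ω p) := by
    rw [← mul_assoc, mul_comm (strA μ ψ p), h.strg_mul_strA hp, one_mul]
  refine ⟨?_, ?_, ?_, ?_⟩
  · rw [abs_mul, abs_of_nonneg (pow_nonneg hr.le _), n2]; exact m1.trans hLB
  · rw [abs_mul, abs_of_nonneg (pow_nonneg hr.le _), n2]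
    exact m2.trans (mul_le_mul_of_nonneg_right hLB hα'.le)
  · have e : pr (fun q => q.1 ^ (d - 2) * Ω q) p
        = ((d : ℝ) - 2) * (p.1 ^ ((d : ℝ) - 3) * Ω p) + p.1 ^ ((d : ℝ) - 2) * pr Ω p := by
      have h1 := ((hasDerivAt_pow (d - 2) p.1).mul (hasDerivAt_pr hOd)).deriv
      refine h1.trans ?_
      rw [c2, n2, n3]; ring
    have e' : pr Ω p = (pr Ω p - strH ψ p * (strg μ ψ p * pz Ω p))
        + strH ψ p * (strg μ ψ p * pz Ω p) := by ring
    have t1 : |((d : ℝ) - 2) * (p.1 ^ ((d : ℝ) - 3) * Ω p)|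
        ≤ ((d : ℝ) - 2) * (B * (1 + p.1 ^ (α - 1))) := by
      rw [abs_mul, abs_mul, abs_of_nonneg hpow3, abs_of_nonneg (by linarith : (0 : ℝ) ≤ d - 2)]
      exact mul_le_mul_of_nonneg_left m3 (by linarith)
    have t2 : |p.1 ^ ((d : ℝ) - 2) * pr Ω p| ≤ (1 + a1 d a) * (B * (1 + p.1 ^ (α - 1))) := by
      rw [abs_mul, abs_of_nonneg hpow]
      calc p.1 ^ ((d : ℝ) - 2) * |pr Ω p|
          ≤ p.1 ^ ((d : ℝ) - 2) * (|pr Ω p - strH ψ p * (strg μ ψ p * pz Ω p)|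
            + |strH ψ p| * |strg μ ψ p * pz Ω p|) := by
              refine mul_le_mul_of_nonneg_left ?_ hpow
              rw [← abs_mul]
              conv_lhs => rw [e']
              exact abs_add_le _ _
        _ = p.1 ^ ((d : ℝ) - 2) * |pr Ω p - strH ψ p * (strg μ ψ p * pz Ω p)|
            + |strH ψ p| * (p.1 ^ ((d : ℝ) - 2) * |strg μ ψ p * pz Ω p|) := by ring
        _ ≤ B * (1 + p.1 ^ (α - 1)) + a1 d a * (B * (1 + p.1 ^ (α - 1))) :=
            add_le_add m5 (mul_le_mul (h.abs_strH_le hp) m4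
              (mul_nonneg hpow (abs_nonneg _)) ha₁.le)
        _ = _ := by ring
    rw [e]
    refine (abs_add_le _ _).trans ((add_le_add t1 t2).trans ?_)
    rw [hL]
    have := mul_nonneg hB0 hS
    nlinarith
  · have e : pz (fun q => q.1 ^ (d - 2) * Ω q) p = p.1 ^ ((d : ℝ) - 2) * pz Ω p := by
      rw [← n2]; exact ((hasDerivAt_pz hOd).const_mul (p.1 ^ (d - 2))).deriv
    rw [e, hX, abs_mul, abs_of_nonneg hpow, abs_mul, abs_of_pos (h.strA_pos hp)]
    have hA : strA μ ψ p ≤ μ + 2 * a1 d a := by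
      have := h.strA_le hp; have := h.le_a1 p hp; linarith
    calc p.1 ^ ((d : ℝ) - 2) * (strA μ ψ p * |strg μ ψ p * pz Ω p|)
        = strA μ ψ p * (p.1 ^ ((d : ℝ) - 2) * |strg μ ψ p * pz Ω p|) := by ring
      _ ≤ (μ + 2 * a1 d a) * (B * (1 + p.1 ^ (α - 1))) :=
          mul_le_mul hA m4 (mul_nonneg hpow (abs_nonneg _)) (by linarith)
      _ ≤ _ := by
          rw [hL]
          have := mul_nonneg hB0 hS
          nlinarith

/-- Purely qualitative: `K` may degenerate as r → 0, and it disappears in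
`le_mul_of_le_mul_of_lipschitz`. -/
lemma vorticity_le_mul_height (hd : 3 ≤ d) (ha : ARange d a) (hμ : MuRange d a μ) (hM : 1 < M)
    (hlam : 1 < lam) (hΘ : IsTheta d μ Θ) (hη : IsEta d η) (hψ : MemA d a μ M ψ)
    (hΩ : IsTransportImage d μ lam Θ η ψ Ω) {r : ℝ} (hr : 0 < r) :
    ∃ K, ∀ z > 0, |r ^ (d - 2) * Ω (r, z)| ≤ K * z := by
  obtain ⟨θ, C, h⟩ := hψ.exists_streamBounds hd ha hμ hM
  obtain ⟨E, hE, ⟨CE, hCE⟩, hdata⟩ := exists_radialData h.mu_pos hd hlam hΘ hη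
  have heq := hΩ.flow_eq h
  obtain ⟨B₀, hB₀⟩ := h.bounds_on_curve hΩ.contDiffOn heq hE hCE (hΩ.data_eq h hdata)
  obtain ⟨B, hB⟩ := h.exists_le_strQ hΩ.contDiffOn heq fun p hp hl => (hB₀ p hp hl).1
  refine ⟨r ^ (d - 2) * (|B| * (1 + r ^ (-(1 / μ + 1))) * (μ + a1 d a)), fun z hz => ?_⟩
  have hp : (r, z) ∈ quadrant := ⟨hr, hz⟩
  have hpow := Real.rpow_pos_of_pos hr (-(1 / μ + 1))
  rw [abs_mul, abs_of_pos (pow_pos hr _), mul_assoc]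
  refine mul_le_mul_of_nonneg_left ?_ (pow_pos hr _).le
  calc |Ω (r, z)| ≤ B * (1 + r ^ (-(1 / μ + 1))) * strQ μ ψ (r, z) := hB _ hp
    _ ≤ |B| * (1 + r ^ (-(1 / μ + 1))) * ((μ + a1 d a) * z) := by
        have h1 := (h.strQ_pos hp).le
        have h2 := h.strQ_le hp
        have h3 := le_abs_self B
        gcongr
    _ = _ := by ring

end Vorticity

/-! ### Hölder continuity -/

/-- The odd extension of a function of one positive variable. -/
def oddExtension (f : ℝ → ℝ) (z : ℝ) : ℝ := if 0 < z then f z else if z < 0 then -f (-z) else 0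

/-- Across z = 0 one compares through the value 0, since |y - z| = |y| + |z| for opposite signs. -/
lemma oddExtension_sub_le {f : ℝ → ℝ} {L : ℝ} (hf : ∀ y > 0, ∀ z > 0, |f y - f z| ≤ L * |y - z|)
    (h0 : ∀ z > 0, |f z| ≤ L * z) (y z : ℝ) :
    |oddExtension f y - oddExtension f z| ≤ L * |y - z| := by
  have opp : ∀ y > 0, ∀ z < 0, |f y + f (-z)| ≤ L * |y - z| := fun y hy z hz => by
    rw [abs_of_pos (by linarith : 0 < y - z)]
    have := abs_add_le (f y) (f (-z))
    linarith [h0 y hy, h0 (-z) (by linarith)]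
  unfold oddExtension
  rcases lt_trichotomy y 0 with hy | rfl | hy <;> rcases lt_trichotomy z 0 with hz | rfl | hz
  · rw [if_neg hy.not_gt, if_pos hy, if_neg hz.not_gt, if_pos hz]
    have := hf (-z) (by linarith) (-y) (by linarith)
    rwa [neg_sub_neg, show y - z = -z - -y by ring]
  · rw [if_neg hy.not_gt, if_pos hy]
    have := h0 (-y) (by linarith)
    simpa [abs_of_neg hy] using this
  · rw [if_neg hy.not_gt, if_pos hy, if_pos hz]
    have := opp z hz y hy
    rwa [← abs_neg, abs_sub_comm y z, show -(-f (-y) - f z) = f z + f (-y) by ring]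
  · rw [if_neg hz.not_gt, if_pos hz]
    have := h0 (-z) (by linarith)
    simpa [abs_of_neg hz] using this
  · simp
  · rw [if_pos hz]
    simpa [abs_of_pos hz] using h0 z hz
  · rw [if_pos hy, if_neg hz.not_gt, if_pos hz, sub_neg_eq_add]
    exact opp y hy z hz
  · rw [if_pos hy]
    simpa [abs_of_pos hy] using h0 y hy
  · rw [if_pos hy, if_pos hz]
    exact hf y hy z hz

lemma abs_oddExtension_le {f : ℝ → ℝ} {B : ℝ} (hB : 0 ≤ B) (hf : ∀ z > 0, |f z| ≤ B) (z : ℝ) :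
    |oddExtension f z| ≤ B := by
  unfold oddExtension
  split_ifs with h1 h2
  · exact hf z h1
  · rw [abs_neg]; exact hf (-z) (by linarith)
  · simpa using hB

lemma abs_oddExtension_sub_le {f g : ℝ → ℝ} {B : ℝ} (hB : 0 ≤ B) (hf : ∀ z > 0, |f z - g z| ≤ B)
    (z : ℝ) : |oddExtension f z - oddExtension g z| ≤ B := by
  unfold oddExtension
  split_ifs with h1 h2
  · exact hf z h1
  · rw [neg_sub_neg, abs_sub_comm]; exact hf (-z) (by linarith)
  · simpa using hB

lemma abs_sub_le_of_slice_snd {f : ℝ × ℝ → ℝ} {L r : ℝ} (hr : 0 < r)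
    (hf : ContDiffOn ℝ 1 f quadrant) (hL : ∀ z > 0, |pz f (r, z)| ≤ L) :
    ∀ y > 0, ∀ z > 0, |f (r, y) - f (r, z)| ≤ L * |y - z| := by
  intro y hy z hz
  have := (convex_Ioi (0 : ℝ)).norm_image_sub_le_of_norm_hasDerivWithin_le
    (f := fun s => f (r, s)) (f' := fun s => pz f (r, s)) (C := L)
    (fun s hs => (hasDerivAt_pz (differentiableAt_of_mem hf
      (p := (r, s)) ⟨hr, hs⟩)).hasDerivWithinAt) (fun s hs => hL s hs) hz hy
  simpa using this

lemma abs_sub_le_of_slice_fst {f : ℝ × ℝ → ℝ} {L ρ z : ℝ} (hρ : 0 < ρ) (hz : 0 < z)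
    (hf : ContDiffOn ℝ 1 f quadrant) (hL : ∀ r ≥ ρ, |pr f (r, z)| ≤ L) :
    ∀ r ≥ ρ, ∀ s ≥ ρ, |f (r, z) - f (s, z)| ≤ L * |r - s| := by
  intro r hr s hs
  have := (convex_Ici ρ).norm_image_sub_le_of_norm_hasDerivWithin_le
    (f := fun s => f (s, z)) (f' := fun s => pr f (s, z)) (C := L)
    (fun s hs => (hasDerivAt_pr (differentiableAt_of_mem hf
      (p := (s, z)) ⟨hρ.trans_le hs, hz⟩)).hasDerivWithinAt) (fun s hs => hL s hs) hs hr
  simpa using this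

/-- Linear vanishing with any constant gives f → 0 at 0; comparing f(z) with f(e) as e → 0 then
leaves the Lipschitz constant only. -/
lemma le_mul_of_le_mul_of_lipschitz {f : ℝ → ℝ} {L K : ℝ}
    (hf : ∀ y > 0, ∀ z > 0, |f y - f z| ≤ L * |y - z|) (hK : ∀ z > 0, |f z| ≤ K * z) :
    ∀ z > 0, |f z| ≤ L * z := by
  intro z hz
  have hlim : Tendsto (fun e : ℝ => L * |z - e| + K * e) (𝓝[>] 0) (𝓝 (L * z)) := by
    refine (Continuous.tendsto' (by fun_prop) _ _ ?_).mono_left nhdsWithin_le_nhds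
    simp [abs_of_pos hz]
  refine ge_of_tendsto hlim ?_
  filter_upwards [self_mem_nhdsWithin] with e he
  have h1 := hf z hz e he
  have h2 := hK e he
  have := abs_sub_abs_le_abs_sub (f z) (f e)
  linarith

/-- The function `r^n Ω`, odd in `z`, extended by zero to the axis. -/
def profile (n : ℕ) (Ω : ℝ × ℝ → ℝ) (r z : ℝ) : ℝ := if r = 0 then 0 else r ^ n * oddExt Ω r z

lemma profile_eq {n : ℕ} {Ω : ℝ × ℝ → ℝ} {r z : ℝ} (hr : r ≠ 0) :
    profile n Ω r z = oddExtension (fun z => r ^ n * Ω (r, z)) z := by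
  rw [profile, if_neg hr, oddExtension, oddExt]
  split_ifs <;> ring

section Holder

variable {n : ℕ} {Ω : ℝ × ℝ → ℝ} {α B : ℝ}

lemma abs_profile_le (hB : 0 ≤ B) (h : ∀ p ∈ quadrant, |p.1 ^ n * Ω p| ≤ B) {r : ℝ} (hr : 0 ≤ r)
    (z : ℝ) : |profile n Ω r z| ≤ B := by
  rcases hr.eq_or_lt with rfl | hr
  · simpa [profile] using hB
  · rw [profile_eq hr.ne']
    exact abs_oddExtension_le hB (fun z hz => h (r, z) ⟨hr, hz⟩) z

lemma abs_profile_le_rpow (hB : 0 ≤ B) (h : ∀ p ∈ quadrant, |p.1 ^ n * Ω p| ≤ B * p.1 ^ α)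
    {r : ℝ} (hr : 0 ≤ r) (z : ℝ) : |profile n Ω r z| ≤ B * r ^ α := by
  rcases hr.eq_or_lt with rfl | hr
  · simpa [profile] using mul_nonneg hB (Real.rpow_nonneg le_rfl _)
  · rw [profile_eq hr.ne']
    exact abs_oddExtension_le (mul_nonneg hB (Real.rpow_nonneg hr.le _))
      (fun z hz => h (r, z) ⟨hr, hz⟩) z

/-- Move in r at fixed z, then in z at fixed r'. This path stays in r ≥ ρ, where the gradient bound
is largest at ρ because α < 1. -/
lemma abs_profile_sub_le (hB : 0 ≤ B) (hα : α < 1) (hΩ : ContDiffOn ℝ 1 Ω quadrant)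
    (hr : ∀ p ∈ quadrant, |pr (fun q => q.1 ^ n * Ω q) p| ≤ B * (1 + p.1 ^ (α - 1)))
    (hz : ∀ p ∈ quadrant, |pz (fun q => q.1 ^ n * Ω q) p| ≤ B * (1 + p.1 ^ (α - 1)))
    (h0 : ∀ r > 0, ∃ K, ∀ z > 0, |r ^ n * Ω (r, z)| ≤ K * z)
    {ρ r r' : ℝ} (hρ : 0 < ρ) (hρr : ρ ≤ r) (hρr' : ρ ≤ r') (z z' : ℝ) :
    |profile n Ω r z - profile n Ω r' z'|
      ≤ B * (1 + ρ ^ (α - 1)) * |r - r'| + B * (1 + ρ ^ (α - 1)) * |z - z'| := by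
  set L := B * (1 + ρ ^ (α - 1)) with hL
  have hL0 : 0 ≤ L := by have := Real.rpow_pos_of_pos hρ (α - 1); positivity
  have hmono : ∀ s ≥ ρ, B * (1 + s ^ (α - 1)) ≤ L := fun s hs => by
    have := Real.rpow_le_rpow_of_nonpos hρ hs (by linarith : α - 1 ≤ 0)
    rw [hL]; gcongr
  have hf : ContDiffOn ℝ 1 (fun q : ℝ × ℝ => q.1 ^ n * Ω q) quadrant :=
    (contDiff_fst.contDiffOn.pow n).mul hΩ
  have hr'0 : 0 < r' := hρ.trans_le hρr'
  have hr0 : 0 < r := hρ.trans_le hρr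
  rw [profile_eq hr0.ne', profile_eq hr'0.ne']
  have s1 : |oddExtension (fun z => r ^ n * Ω (r, z)) z
      - oddExtension (fun z => r' ^ n * Ω (r', z)) z| ≤ L * |r - r'| :=
    abs_oddExtension_sub_le (mul_nonneg hL0 (abs_nonneg _)) (fun z hz =>
      abs_sub_le_of_slice_fst hρ hz hf
        (fun s hs => (hr (s, z) ⟨hρ.trans_le hs, hz⟩).trans (hmono s hs)) r hρr r' hρr') z
  have s2 : |oddExtension (fun z => r' ^ n * Ω (r', z)) z
      - oddExtension (fun z => r' ^ n * Ω (r', z)) z'| ≤ L * |z - z'| := by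
    have hlip := abs_sub_le_of_slice_snd hr'0 hf
      (fun z hz' => (hz (r', z) ⟨hr'0, hz'⟩).trans (hmono r' hρr'))
    obtain ⟨K, hK⟩ := h0 r' hr'0
    exact oddExtension_sub_le hlip (le_mul_of_le_mul_of_lipschitz hlip hK) z z'
  exact (abs_sub_le _ _ _).trans (add_le_add s1 s2)

/-- A bounded function on the half-plane which is `O(r^α)` and whose gradient is `O(1 + r^{α-1})`
is `α`-Hölder. -/
lemma holder_of_gradient {v : ℝ → ℝ → ℝ} (hB : 0 ≤ B) (hα0 : 0 < α) (hα1 : α < 1)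
    (h1 : ∀ r ≥ 0, ∀ z, |v r z| ≤ B) (h2 : ∀ r ≥ 0, ∀ z, |v r z| ≤ B * r ^ α)
    (h3 : ∀ ρ > 0, ∀ r ≥ ρ, ∀ r' ≥ ρ, ∀ z z', |v r z - v r' z'|
      ≤ B * (1 + ρ ^ (α - 1)) * |r - r'| + B * (1 + ρ ^ (α - 1)) * |z - z'|)
    {r r' z z' δ : ℝ} (hr : 0 ≤ r) (hr' : 0 ≤ r') (hδr : |r - r'| ≤ δ) (hδz : |z - z'| ≤ δ) :
    |v r z - v r' z'| ≤ 4 * B * δ ^ α := by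
  have hδ0 : 0 ≤ δ := (abs_nonneg _).trans hδr
  rcases hδ0.eq_or_lt with rfl | hδ
  · have e1 : r = r' := sub_eq_zero.1 (abs_nonpos_iff.1 hδr)
    have e2 : z = z' := sub_eq_zero.1 (abs_nonpos_iff.1 hδz)
    subst e1 e2
    rw [sub_self, abs_zero]
    exact mul_nonneg (by linarith) (Real.rpow_nonneg le_rfl _)
  have hδα := Real.rpow_pos_of_pos hδ α
  have tri : |v r z - v r' z'| ≤ |v r z| + |v r' z'| := abs_sub _ _
  rcases le_total 1 δ with h | h
  · have := Real.one_le_rpow h hα0.le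
    have := h1 r hr z
    have := h1 r' hr' z'
    nlinarith
  -- Near the axis, relative to δ, the size O(r^α) suffices. Otherwise both radii are at least δ and
  -- the gradient bound at ρ = δ gives δ^{α-1} · δ.
  by_cases hcase : r ≤ 2 * δ ∧ r' ≤ 2 * δ
  · have hpow : ∀ s, 0 ≤ s → s ≤ 2 * δ → s ^ α ≤ 2 * δ ^ α := fun s hs hs2 => by
      calc s ^ α ≤ (2 * δ) ^ α := Real.rpow_le_rpow hs hs2 hα0.le
        _ = 2 ^ α * δ ^ α := Real.mul_rpow zero_le_two hδ0
        _ ≤ 2 ^ (1 : ℝ) * δ ^ α := by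
            have := Real.rpow_le_rpow_of_exponent_le (one_le_two (α := ℝ)) hα1.le
            gcongr
        _ = _ := by rw [Real.rpow_one]
    have e1 := mul_le_mul_of_nonneg_left (hpow r hr hcase.1) hB
    have e2 := mul_le_mul_of_nonneg_left (hpow r' hr' hcase.2) hB
    have := h2 r hr z
    have := h2 r' hr' z'
    linarith
  · have hge : δ ≤ r ∧ δ ≤ r' := by
      rw [not_and_or, not_le, not_le] at hcase
      rw [abs_le] at hδr
      rcases hcase with hc | hc <;> constructor <;> linarith
    have e1 := h3 δ hδ r hge.1 r' hge.2 z z'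
    have e2 : 1 ≤ δ ^ (α - 1) :=
      Real.one_le_rpow_of_pos_of_le_one_of_nonpos hδ h (by linarith)
    have e3 : δ ^ (α - 1) * δ = δ ^ α := StreamBounds.rpow_sub_one_mul hδ α
    have e4 : B * (1 + δ ^ (α - 1)) * |r - r'| ≤ 2 * B * δ ^ α := by
      calc B * (1 + δ ^ (α - 1)) * |r - r'| ≤ B * (δ ^ (α - 1) + δ ^ (α - 1)) * δ := by gcongr
        _ = 2 * B * δ ^ α := by rw [← e3]; ring
    have e5 : B * (1 + δ ^ (α - 1)) * |z - z'| ≤ 2 * B * δ ^ α := by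
      calc B * (1 + δ ^ (α - 1)) * |z - z'| ≤ B * (δ ^ (α - 1) + δ ^ (α - 1)) * δ := by gcongr
        _ = 2 * B * δ ^ α := by rw [← e3]; ring
    linarith

/-- Multiplication of such a function by the angular factor `x_i / r` keeps it Hölder. -/
lemma holder_of_angular_factor {v v' c c' x x' r r' δ K : ℝ} (hB : 0 ≤ B) (hα0 : 0 < α)
    (hα1 : α < 1) (hr : 0 ≤ r) (hr' : 0 ≤ r') (hx : |x| ≤ r)
    (hc : c = x / r) (hc' : c' = x' / r') (hx' : |x'| ≤ r') (hv0 : r = 0 → v = 0)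
    (hv0' : r' = 0 → v' = 0) (hv' : |v'| ≤ B * r' ^ α) (hvv : |v - v'| ≤ K * δ ^ α)
    (hδr : |r - r'| ≤ δ) (hδx : |x - x'| ≤ δ) :
    |c * v - c' * v'| ≤ (K + 2 * B) * δ ^ α := by
  have hδ0 : 0 ≤ δ := (abs_nonneg _).trans hδr
  have hδα := Real.rpow_nonneg hδ0 α
  have hc1 : |c| ≤ 1 := by
    rw [hc, abs_div, abs_of_nonneg hr]; exact div_le_one_of_le₀ hx hr
  have hc1' : |c'| ≤ 1 := by
    rw [hc', abs_div, abs_of_nonneg hr']; exact div_le_one_of_le₀ hx' hr'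
  have hBδ : 0 ≤ 2 * B * δ ^ α := by positivity
  -- On the axis v vanishes, so the value 0 of the quotient x / 0 plays no role.
  rcases hr'.eq_or_lt with h0' | hr'
  · have e := hv0' h0'.symm
    rw [e, sub_zero] at hvv
    rw [e, mul_zero, sub_zero, abs_mul]
    have := mul_le_of_le_one_left (abs_nonneg v) hc1
    linarith
  rcases hr.eq_or_lt with h0 | hr
  · have e := hv0 h0.symm
    rw [e, zero_sub, abs_neg] at hvv
    rw [e, mul_zero, zero_sub, abs_neg, abs_mul]
    have := mul_le_of_le_one_left (abs_nonneg v') hc1'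
    linarith
  have e : c * v - c' * v' = c * (v - v') + (c - c') * v' := by ring
  have t1 : |c * (v - v')| ≤ K * δ ^ α := by
    rw [abs_mul]; exact (mul_le_of_le_one_left (abs_nonneg _) hc1).trans hvv
  have hcc2 : |c - c'| ≤ 2 := (abs_sub _ _).trans (by linarith)
  -- The angular factor is homogeneous of degree 0, hence has Lipschitz constant of order 1 / r'.
  have hcc : |c - c'| * r' ≤ 2 * δ := by
    have h1 : (c - c') * r' = (x - x') + c * (r' - r) := by rw [hc, hc']; field_simp; ring
    calc |c - c'| * r' = |(c - c') * r'| := by rw [abs_mul, abs_of_pos hr']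
      _ ≤ |x - x'| + |c * (r' - r)| := by rw [h1]; exact abs_add_le _ _
      _ ≤ δ + 1 * δ := by
          rw [abs_mul, abs_sub_comm r' r]
          exact add_le_add hδx (mul_le_mul hc1 hδr (abs_nonneg _) zero_le_one)
      _ = 2 * δ := by ring
  have t2 : |(c - c') * v'| ≤ 2 * B * δ ^ α := by
    rw [abs_mul]
    have hr'α := Real.rpow_nonneg hr'.le α
    -- For r' ≤ δ the trivial bound |c - c'| ≤ 2 suffices; for r' ≥ δ the factor δ / r' leaves δ
    -- r'^{α-1} ≤ δ^α.
    rcases le_total r' δ with h | h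
    · have h1 : r' ^ α ≤ δ ^ α := Real.rpow_le_rpow hr'.le h hα0.le
      calc |c - c'| * |v'| ≤ 2 * (B * r' ^ α) :=
            mul_le_mul hcc2 hv' (abs_nonneg _) zero_le_two
        _ ≤ 2 * (B * δ ^ α) := by gcongr
        _ = _ := by ring
    · rcases hδ0.eq_or_lt with hδ | hδ
      · have : |c - c'| = 0 := by
          rw [← hδ, mul_zero] at hcc
          have := abs_nonneg (c - c')
          nlinarith
        rw [this, zero_mul]; exact hBδ
      have h1 : r' ^ (α - 1) ≤ δ ^ (α - 1) :=
        Real.rpow_le_rpow_of_nonpos hδ h (by linarith)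
      have hr'α1 := Real.rpow_nonneg hr'.le (α - 1)
      calc |c - c'| * |v'| ≤ |c - c'| * (B * r' ^ α) := by gcongr
        _ = (|c - c'| * r') * (B * r' ^ (α - 1)) := by
            rw [← StreamBounds.rpow_sub_one_mul hr' α]; ring
        _ ≤ (2 * δ) * (B * δ ^ (α - 1)) := by gcongr
        _ = 2 * B * δ ^ α := by rw [← StreamBounds.rpow_sub_one_mul hδ α]; ring
  rw [e]
  refine (abs_add_le _ _).trans ?_
  linarith

end Holder

lemma memCHolder_of_dist_le {X : Type*} [PseudoMetricSpace X] {α B K : ℝ} (hα : 0 < α)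
    {f : X → ℝ} (hB : ∀ x, |f x| ≤ B) (hK : ∀ x y, |f x - f y| ≤ K * dist x y ^ α) :
    MemCHolder α f := by
  refine ⟨⟨B, hB⟩, K.toNNReal, fun x y => ?_⟩
  have h1 : dist (f x) (f y) ≤ K.toNNReal * dist x y ^ α := by
    rw [Real.dist_eq]
    refine (hK x y).trans (mul_le_mul_of_nonneg_right (Real.le_coe_toNNReal K)
      (Real.rpow_nonneg dist_nonneg _))
  rw [edist_dist, edist_dist, Real.coe_toNNReal α hα.le,
    ENNReal.ofReal_rpow_of_nonneg dist_nonneg hα.le, ← ENNReal.ofReal_coe_nnreal,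
    ← ENNReal.ofReal_mul NNReal.zero_le_coe]
  exact ENNReal.ofReal_le_ofReal h1

lemma MemCHolder.cHolderNorm_lt_top {X : Type*} [PseudoEMetricSpace X] {α : ℝ} {f : X → ℝ}
    (hf : MemCHolder α f) : cHolderNorm α f < ∞ := by
  obtain ⟨⟨B, hB⟩, h⟩ := hf
  refine ENNReal.add_lt_top.2 ⟨?_, eHolderNorm_lt_top.2 h⟩
  refine lt_of_le_of_lt (iSup_le fun x => ?_) (ENNReal.ofReal_lt_top (r := B))
  rw [Real.enorm_eq_ofReal_abs]
  exact ENNReal.ofReal_le_ofReal (hB x)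

/-! ### Cylindrical coordinates -/

section Radius

variable {d : ℕ}

/-- The orthogonal projection away from the last coordinate axis. -/
def horizontal (x : EuclideanSpace ℝ (Fin d)) : EuclideanSpace ℝ (Fin d) :=
  WithLp.toLp 2 fun i => if (i : ℕ) + 1 < d then x i else 0

lemma radius_eq_norm (x : EuclideanSpace ℝ (Fin d)) : radius x = ‖horizontal x‖ := by
  rw [EuclideanSpace.norm_eq, radius]
  congr 1
  refine Finset.sum_congr rfl fun i _ => ?_
  simp only [horizontal]
  split_ifs <;> simp

lemma radius_nonneg (x : EuclideanSpace ℝ (Fin d)) : 0 ≤ radius x := Real.sqrt_nonneg _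

lemma abs_radius_sub_le (x y : EuclideanSpace ℝ (Fin d)) : |radius x - radius y| ≤ dist x y := by
  rw [radius_eq_norm, radius_eq_norm, dist_eq_norm]
  refine (abs_norm_sub_norm_le _ _).trans ?_
  rw [EuclideanSpace.norm_eq, EuclideanSpace.norm_eq]
  refine Real.sqrt_le_sqrt (Finset.sum_le_sum fun i _ => ?_)
  simp only [horizontal, PiLp.sub_apply]
  split_ifs <;> simp [sq_nonneg]

lemma abs_apply_le_radius (x : EuclideanSpace ℝ (Fin d)) {i : Fin d} (hi : (i : ℕ) + 1 < d) :
    |x i| ≤ radius x := by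
  rw [radius_eq_norm]
  have := PiLp.norm_apply_le (horizontal x) i
  simpa [horizontal, hi] using this

lemma abs_apply_sub_le {ι : Type*} [Fintype ι] (x y : EuclideanSpace ℝ ι) (i : ι) :
    |x i - y i| ≤ dist x y := by
  rw [dist_eq_norm]
  simpa using PiLp.norm_apply_le (x - y) i

end Radius

end EulerProfile

end

open EulerProfile in
theorem proposition2p8 (d : ℕ) (hd : 3 ≤ d) (a μ M lam : ℝ) (Θ η : ℝ → ℝ) (ψ Ω : ℝ × ℝ → ℝ)
    (ha : EulerProfile.ARange d a) (hμ : EulerProfile.MuRange d a μ)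
    (hM : 1 < M) (hlam : 1 < lam)
    (hΘ : EulerProfile.IsTheta d μ Θ) (hη : EulerProfile.IsEta d η)
    (hfix : EulerProfile.IsFixedPoint d a μ M lam Θ η ψ Ω) :
    (0 < EulerProfile.alphaStar d a μ ∧ EulerProfile.alphaStar d a μ < 1) ∧
    EulerProfile.MemCHolder (EulerProfile.alphaStar d a μ) (EulerProfile.scalarVorticity d Ω) ∧
    ∀ i : Fin d, (i : ℕ) + 1 < d →
      EulerProfile.MemCHolder (EulerProfile.alphaStar d a μ)
        (EulerProfile.cartesianVorticity hd Ω i) ∧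
      EulerProfile.cHolderNorm (EulerProfile.alphaStar d a μ) (EulerProfile.scalarVorticity d Ω) +
        EulerProfile.cHolderNorm (EulerProfile.alphaStar d a μ)
          (EulerProfile.cartesianVorticity hd Ω i) < ∞ := by
  have hα0 := alphaStar_pos hd ha hμ
  have hα1 := alphaStar_lt_one hd ha hμ
  set α := alphaStar d a μ
  obtain ⟨B, hB, hbd⟩ := vorticity_bounds hd ha hμ hM hlam hΘ hη hfix.mem hfix.transport
  have hbdd : ∀ r ≥ 0, ∀ z, |profile (d - 2) Ω r z| ≤ B := fun r hr z =>
    abs_profile_le hB (fun p hp => (hbd p hp).1) hr z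
  have hpow : ∀ r ≥ 0, ∀ z, |profile (d - 2) Ω r z| ≤ B * r ^ α := fun r hr z =>
    abs_profile_le_rpow hB (fun p hp => (hbd p hp).2.1) hr z
  have hlip : ∀ ρ > 0, ∀ r ≥ ρ, ∀ r' ≥ ρ, ∀ z z',
      |profile (d - 2) Ω r z - profile (d - 2) Ω r' z'|
        ≤ B * (1 + ρ ^ (α - 1)) * |r - r'| + B * (1 + ρ ^ (α - 1)) * |z - z'| :=
    fun ρ hρ r hr r' hr' z z' => abs_profile_sub_le hB hα1 hfix.transport.contDiffOn
      (fun p hp => (hbd p hp).2.2.1) (fun p hp => (hbd p hp).2.2.2)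
      (fun r hr => vorticity_le_mul_height hd ha hμ hM hlam hΘ hη hfix.mem hfix.transport hr)
      hρ hr hr' z z'
  have hscalar : MemCHolder α (scalarVorticity d Ω) := by
    refine memCHolder_of_dist_le hα0 (B := B) (K := 4 * B) (fun p => hbdd _ p.2 (p.1 1))
      fun p q => ?_
    exact holder_of_gradient hB hα0 hα1 hbdd hpow hlip p.2 q.2
      (abs_apply_sub_le p.1 q.1 0) (abs_apply_sub_le p.1 q.1 1)
  refine ⟨⟨hα0, hα1⟩, hscalar, fun i hi => ?_⟩
  -- Splits off the bounded angular factor x_i / r, so that the scalar estimates apply.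
  have heq : ∀ x, cartesianVorticity hd Ω i x
      = x i / radius x * profile (d - 2) Ω (radius x) (height hd x) := fun x => by
    rw [cartesianVorticity, profile]
    split_ifs with h
    · simp
    · rw [show d - 2 = d - 3 + 1 by omega, pow_succ]; field_simp
  have hcart : MemCHolder α (cartesianVorticity hd Ω i) := by
    refine memCHolder_of_dist_le hα0 (B := B) (K := 4 * B + 2 * B) (fun x => ?_) fun x y => ?_
    · rw [heq, abs_mul, abs_div, abs_of_nonneg (radius_nonneg x)]
      exact (mul_le_of_le_one_left (abs_nonneg _)
        (div_le_one_of_le₀ (abs_apply_le_radius x hi) (radius_nonneg x))).trans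
        (hbdd _ (radius_nonneg x) _)
    · rw [heq, heq]
      exact holder_of_angular_factor hB hα0 hα1 (radius_nonneg x) (radius_nonneg y)
        (abs_apply_le_radius x hi) rfl rfl (abs_apply_le_radius y hi)
        (fun h => by rw [profile, if_pos h]) (fun h => by rw [profile, if_pos h])
        (hpow _ (radius_nonneg y) _)
        (holder_of_gradient hB hα0 hα1 hbdd hpow hlip (radius_nonneg x) (radius_nonneg y)
          (abs_radius_sub_le x y) (abs_apply_sub_le x y _))
        (abs_radius_sub_le x y) (abs_apply_sub_le x y i)
  exact ⟨hcart, ENNReal.add_lt_top.2 ⟨hscalar.cHolderNorm_lt_top, hcart.cHolderNorm_lt_top⟩⟩
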